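/- **Conventions.** Sequences are indexed by $1,2,3,\dots$. Put $e(x)=\exp(2\pi i x)$. For integers $r,s>1$ write $r\sim s$ if $r^p=s^q$ for some positive integers $p,q$. The discrepancy of a real sequence $(x_n)_{n\ge1}$ is $$D_N(x_n)=\sup_{I\subset[0,1)}\Bigl|\tfrac1N\#\{1\le n\le N: x_n \bmod 1\in I\}-|I|\Bigr|,$$ the supremum being over all subintervals $I$ of $[0,1)$. A real number is normal to base $b\ge2$ if every block of $k\ge1$ base-$b$ digits occurs in its base-$b$ expansion after the point with asymptotic frequency $b^{-k}$; it is absolutely normal if it is normal to every integer base $b\ge 2$. **Data.** (a) For all integers $r,s>1$ let $a(r,s)\in(0,\tfrac12)$ be such that, whenever $r\not\sim s$, $$\sum_{n=0}^{N-1}\ \prod_{k=K+1}^{\infty}\bigl|\cos(\pi r^n l/s^k)\bigr|\le 2N^{1-a(r,s)}\qquad\text{for all integers } N,K,l\ge1 \text{ with } l\ge s^K.$$ (For $r\sim s$ the value $a(r,s)\in(0,\frac12)$ is arbitrary.) (b) Let $r_i=i+1$ for $i\ge1$, and let $(s_j)_{j\ge1}$ be a sequence of integers $s_j>2$ with $s_m\le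 m s_1$ for all $m$, such that for each integer $r\ge2$ one has $r\not\sim s_m$ for all sufficiently large $m$. (c) Put $\beta_k=\min_{1\le i,j\le k}a(r_i,s_j)$ and $\gamma_k=\max(r_1,\dots,r_k,s_1,\dots,s_k)$. Let $\phi(1)=1$ and, for $k\ge2$, let $\phi(k)$ be the largest integer $p$ with $$p\le\phi(k-1)+1,\qquad \beta_p\ge\beta_1k^{-1/4},\qquad \gamma_p\le\gamma_1k .$$ Put $r'_i=r_{\phi(i)}$ and $s'_i=s_{\phi(i)}$. (d) For each integer $r\ge2$ let $m_0(r)$ be a natural number such that $r\not\sim s'_m$ for all $m\ge m_0(r)$. **Algorithm.** For $m\ge1$ and real $x>1$ put $\langle m\rangle=\lfloor e^{\sqrt m}+2s_1m^3\rfloor$, $\langle m;x\rangle=\lfloor\langle m\rangle/\log x\rfloor$, $a_m=\langle m;s'_m\rangle$ and $b_m=\langle m+1;s'_m\rangle$. Let $\xi_0=0$. For $m\ge1$, let $\eta_m$ be the smallest number of the form $g\,(s'_m)^{-a_m}$ with $g\in\mathbb Z$ and $g\,(s'_m)^{-a_m}\ge\xi_{m-1}$, and let $\xi_m$ be the smallest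 of those numbers $$x=\eta_m+\sum_{k=a_m+1}^{b_m-2}c_k\,(s'_m)^{-k},\qquad c_k\in\{0,1\},$$ that minimize, among all numbers of this form, $$A'_m(x)=\sum_{\substack{t=-m\\ t\ne0}}^{m}\ \sum_{\substack{1\le i\le m\\ m_0(r'_i)\le m}}\ \Bigl|\sum_{j=\langle m;r'_i\rangle+1}^{\langle m+1;r'_i\rangle}e\bigl((r'_i)^j\,t\,x\bigr)\Bigr|^2 .$$ **Theorem.** Exponents $a(r,s)$ as in (a) exist. For every choice of the data (a), (b), (d), the sequence $(\xi_m)$ converges to a limit $\xi$, the number $\xi$ is absolutely normal, and for every integer $r\ge2$ there are $C>0$ and $N_0$ (which may depend on $r$ and on the data) such that for all $N\ge N_0$ $$D_N\bigl(\{r^n\xi\}\bigr)\le C\,\frac{\log\log N}{\log N}.$$ -/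

import Mathlib

open Filter Topology

noncomputable section

/-! ### Discrepancy and normality -/

/-- Discrepancy `D_N` of the sequence `x 1, x 2, …` modulo one: the supremum, over all
subintervals `I` of `[0,1)` (order-connected subsets, with or without endpoints), of
`|#{1 ≤ n ≤ N : x n mod 1 ∈ I} / N - |I||`. -/
def discrepancy (x : ℕ → ℝ) (N : ℕ) : ℝ :=
  sSup {d : ℝ | ∃ I : Set ℝ, I ⊆ Set.Ico 0 1 ∧ I.OrdConnected ∧
    d = |(({n : ℕ | 1 ≤ n ∧ n ≤ N ∧ Int.fract (x n) ∈ I}.ncard : ℝ) / N)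
          - (MeasureTheory.volume I).toReal|}

/-- The `(n+1)`-st digit after the point of `x` in base `b`. -/
def baseDigit (b : ℕ) (x : ℝ) (n : ℕ) : ℤ := ⌊(b : ℝ) ^ (n + 1) * x⌋ % (b : ℤ)

/-- `x` is normal to base `b`: every block `w` of `k ≥ 1` base-`b` digits occurs among the digits
after the point with asymptotic frequency `b ^ (-k)`. -/
def IsNormalTo (b : ℕ) (x : ℝ) : Prop :=
  ∀ k : ℕ, 1 ≤ k → ∀ w : Fin k → ℕ, (∀ i, w i < b) →
    Tendsto (fun N : ℕ =>
        ({n : ℕ | n < N ∧ ∀ i : Fin k, baseDigit b x (n + i) = (w i : ℤ)}.ncard : ℝ) / N)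
      atTop (𝓝 (1 / (b : ℝ) ^ k))

/-- Normal to every integer base `b ≥ 2`. -/
def IsAbsolutelyNormal (x : ℝ) : Prop := ∀ b : ℕ, 2 ≤ b → IsNormalTo b x

namespace Schmidt

/-! ### The exponents -/

/-- `r ∼ s`: for integers `r, s > 1`, each is a rational power of the other. -/
def MultDep (r s : ℕ) : Prop := ∃ p q : ℕ, 0 < p ∧ 0 < q ∧ r ^ p = s ^ q

/-- `a` is an exponent for the pair `(r, s)`: it lies in `(0, 1/2)` and, if `r ≁ s`, then
`∑_{n < N} ∏_{k > K} |cos (π r^n l / s^k)| ≤ 2 N^(1-a)` for all `N, K, l ≥ 1` with `l ≥ s^K`.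
For `r ∼ s` nothing but `0 < a < 1/2` is required. The infinite product of numbers in `[0,1]`
always converges, possibly to `0`. -/
def IsCosExponent (r s : ℕ) (a : ℝ) : Prop :=
  0 < a ∧ a < 1 / 2 ∧
    (¬ MultDep r s → ∀ N K l : ℕ, 1 ≤ N → 1 ≤ K → 1 ≤ l → s ^ K ≤ l →
      ∑ n ∈ Finset.range N,
          ∏' k : ℕ, |Real.cos (Real.pi * (r : ℝ) ^ n * l / (s : ℝ) ^ (K + 1 + k))|
        ≤ 2 * (N : ℝ) ^ (1 - a))

/-! ### The sequences of bases

Sequences are indexed by `1, 2, 3, …`; the values at `0` play no role. -/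

/-- `r_i`, the increasing enumeration `2, 3, 4, …` of the integers `≥ 2`, for `i ≥ 1`. -/
def baseR (i : ℕ) : ℕ := i + 1

/-- The requirements on the sequence `s_1, s_2, …` before repetition. -/
def IsBaseSequence (s : ℕ → ℕ) : Prop :=
  (∀ m, 1 ≤ m → 2 < s m) ∧ (∀ m, 1 ≤ m → s m ≤ m * s 1) ∧
    ∀ r, 2 ≤ r → ∃ m₁, ∀ m, 1 ≤ m → m₁ ≤ m → ¬ MultDep r (s m)

/-- `β_k = min_{1 ≤ i, j ≤ k} a (r_i, s_j)`, for `k ≥ 1`. -/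
def beta (a : ℕ → ℕ → ℝ) (s : ℕ → ℕ) (k : ℕ) : ℝ :=
  sInf ((fun p : ℕ × ℕ => a (baseR p.1) (s p.2)) '' (Set.Icc 1 k ×ˢ Set.Icc 1 k))

/-- `γ_k = max (r_1, …, r_k, s_1, …, s_k)`. -/
def gamma (s : ℕ → ℕ) (k : ℕ) : ℕ := (Finset.Icc 1 k).sup fun i => max (baseR i) (s i)

open Classical in
/-- The repetition function: `φ 1 = 1`, and for `k ≥ 2`, `φ k` is the largest `p` such that
`p ≤ φ (k-1) + 1`, `β_p ≥ β_1 / k^(1/4)` and `γ_p ≤ γ_1 k`. -/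
def phi (a : ℕ → ℕ → ℝ) (s : ℕ → ℕ) : ℕ → ℕ
  | 0 => 0
  | 1 => 1
  | k + 2 => Nat.findGreatest
      (fun p => beta a s 1 / ((k + 2 : ℕ) : ℝ) ^ (1 / 4 : ℝ) ≤ beta a s p ∧
        gamma s p ≤ gamma s 1 * (k + 2))
      (phi a s (k + 1) + 1)

/-- `r'_i = r_{φ(i)}`. -/
def repR (a : ℕ → ℕ → ℝ) (s : ℕ → ℕ) (i : ℕ) : ℕ := baseR (phi a s i)

/-- `s'_i = s_{φ(i)}`. -/
def repS (a : ℕ → ℕ → ℝ) (s : ℕ → ℕ) (i : ℕ) : ℕ := s (phi a s i)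

/-- `m₀` is an admissible threshold for `σ`: every `r ≥ 2` is multiplicatively independent of
`σ m` for all `m ≥ m₀ r`. -/
def IsThreshold (σ : ℕ → ℕ) (m₀ : ℕ → ℕ) : Prop :=
  ∀ r, 2 ≤ r → ∀ m, 1 ≤ m → m₀ r ≤ m → ¬ MultDep r (σ m)

/-! ### The algorithm

In this section `ρ` and `σ` are the sequences of bases `r` and `s` (after repetition). -/

/-- `⟨m⟩ = ⌊e^{√m} + 2 s_1 m^3⌋`. -/
def ang (σ : ℕ → ℕ) (m : ℕ) : ℕ := ⌊Real.exp (Real.sqrt m) + 2 * (σ 1 : ℝ) * (m : ℝ) ^ 3⌋₊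

/-- `⟨m; x⟩ = ⌊⟨m⟩ / log x⌋` for an integer `x > 1`. -/
def angb (σ : ℕ → ℕ) (m x : ℕ) : ℕ := ⌊(ang σ m : ℝ) / Real.log x⌋₊

/-- `η_m(x)`: the smallest number `g s_m^{-a_m} ≥ x` with `g` an integer, `a_m = ⟨m; s_m⟩`. -/
def eta (σ : ℕ → ℕ) (m : ℕ) (x : ℝ) : ℝ :=
  (⌈x * (σ m : ℝ) ^ angb σ m (σ m)⌉ : ℝ) / (σ m : ℝ) ^ angb σ m (σ m)

/-- `σ_m(x)`: all numbers `η_m(x) + ∑ c_k s_m^{-k}` with digits `c_k ∈ {0,1}`, where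
`a_m + 1 ≤ k ≤ b_m - 2`, `a_m = ⟨m; s_m⟩` and `b_m = ⟨m+1; s_m⟩`. -/
def candidates (σ : ℕ → ℕ) (m : ℕ) (x : ℝ) : Set ℝ :=
  {y | ∃ c : ℕ → ℕ, (∀ k, c k = 0 ∨ c k = 1) ∧
    y = eta σ m x +
      ∑ k ∈ Finset.Icc (angb σ m (σ m) + 1) (angb σ (m + 1) (σ m) - 2),
        (c k : ℝ) / (σ m : ℝ) ^ k}

/-- `e(x) = exp(2πix)`. -/
def expo (x : ℝ) : ℂ := Complex.exp (2 * Real.pi * Complex.I * x)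

/-- The function `A'_m(x)` that step `m` minimizes: the sum over `0 < |t| ≤ m` and over `i ≤ m` with
`m₀(r_i) ≤ m` of `|∑_{⟨m; r_i⟩ < j ≤ ⟨m+1; r_i⟩} e(r_i^j t x)|²`. -/
def weylSum (ρ σ m₀ : ℕ → ℕ) (m : ℕ) (x : ℝ) : ℝ :=
  ∑ t ∈ (Finset.Icc (-(m : ℤ)) m).erase 0,
    ∑ i ∈ (Finset.Icc 1 m).filter (fun i => m₀ (ρ i) ≤ m),
      ‖∑ j ∈ Finset.Ioc (angb σ m (ρ i)) (angb σ (m + 1) (ρ i)),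
          expo ((ρ i : ℝ) ^ j * t * x)‖ ^ 2

/-- The elements of `σ_m(x)` at which `A'_m` is minimal. -/
def minimizers (ρ σ m₀ : ℕ → ℕ) (m : ℕ) (x : ℝ) : Set ℝ :=
  {y | y ∈ candidates σ m x ∧ ∀ z ∈ candidates σ m x, weylSum ρ σ m₀ m y ≤ weylSum ρ σ m₀ m z}

/-- The sequence the algorithm computes: `ξ_0 = 0`, and `ξ_m` is the smallest of the elements of
`σ_m(ξ_{m-1})` that minimize `A'_m` (see `isLeast_xi`). -/
def xi (ρ σ m₀ : ℕ → ℕ) : ℕ → ℝ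
  | 0 => 0
  | m + 1 => sInf (minimizers ρ σ m₀ (m + 1) (xi ρ σ m₀ m))

theorem finite_candidates (σ : ℕ → ℕ) (m : ℕ) (x : ℝ) : (candidates σ m x).Finite := by
  set F := Finset.Icc (angb σ m (σ m) + 1) (angb σ (m + 1) (σ m) - 2)
  refine (F.powerset.finite_toSet.image
    (fun T => eta σ m x + ∑ k ∈ T, 1 / (σ m : ℝ) ^ k)).subset ?_
  rintro y ⟨c, hc, rfl⟩
  refine ⟨F.filter (fun k => c k = 1),
    Finset.mem_coe.2 (Finset.mem_powerset.2 (Finset.filter_subset _ _)), ?_⟩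
  simp only [Finset.sum_filter]
  congr 1
  refine Finset.sum_congr rfl fun k _ => ?_
  rcases hc k with h | h <;> simp [h]

theorem nonempty_candidates (σ : ℕ → ℕ) (m : ℕ) (x : ℝ) : (candidates σ m x).Nonempty :=
  ⟨_, fun _ => 0, fun _ => Or.inl rfl, rfl⟩

theorem isLeast_xi (ρ σ m₀ : ℕ → ℕ) (m : ℕ) :
    IsLeast (minimizers ρ σ m₀ (m + 1) (xi ρ σ m₀ m)) (xi ρ σ m₀ (m + 1)) := by
  have hf : (minimizers ρ σ m₀ (m + 1) (xi ρ σ m₀ m)).Finite :=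
    (finite_candidates σ (m + 1) (xi ρ σ m₀ m)).subset fun _ h => h.1
  have hn : (minimizers ρ σ m₀ (m + 1) (xi ρ σ m₀ m)).Nonempty := by
    obtain ⟨y, hy, h⟩ := (finite_candidates σ (m + 1) (xi ρ σ m₀ m)).exists_minimalFor
      (weylSum ρ σ m₀ (m + 1)) _ (nonempty_candidates σ (m + 1) (xi ρ σ m₀ m))
    exact ⟨y, hy, fun z hz => (le_total _ _).elim id (h hz)⟩
  exact ⟨hn.csInf_mem hf, fun y hy => csInf_le hf.bddBelow hy⟩

end Schmidt

end

namespace Schmidt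

/-! ### Infinite products of numbers in the unit interval -/

/-! Exponents. Let `r ≁ s`. Dirichlet's theorem gives `r^d = s^e · exp η` with `η` tiny but, since
`r^d` and `s^e` are distinct integers, not too tiny. Along the progression `n + d t` the number
`r^(n+dt) x` is therefore, up to powers of `s`, a slowly moving point. Dividing by a power of `s`
only drops factors from the cosine product, so `s^j` such points can be rescaled to be at least 1
apart within a span below `s^(j+4)`. Their integer parts are then distinct modulo `s^(j+4)`, and
over all residues modulo `s^J` the product of `J` cosines has mean `O((4/5)^J)`, by averaging one
digit at a time (`sum_prod_cosMajorant_le`). Averaging the whole sum over the shifts `d t` and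
taking `s^(3j) ≈ N` saves a power of `N` (`exists_sum_cosProd_le_rpow`).

Construction. A minimizer does at least as well as the average over all digit choices. Expanding the
square, the average of `e((r^j - r^g) t x)` factors into a product of cosines (`weylSum_xi_le`). Up
to a factor 2 and a few exceptional indices these are the infinite products governed by the
exponents `a(r,s)`, so each block sum of length about `H = e^√m` has mean square about `H^(2 - a)`
(`weylSum_xi_le_explicit`). The repetition of bases keeps `a ≥ β m^(-1/4)`, and `H^(-β m^(-1/4)) =
exp(-β m^(1/4))` still beats every power of `m`. Later steps move `ξ` by so little that block sums
at `ξ_m` and at the limit differ by a polynomial in `m` (`norm_sum_expo_sub_le`).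

Discrepancy. If `N` lies in block `M`, frequencies `t ≤ M/2` are controlled on every complete block
from `M/2` on, and earlier blocks are negligible. An Erdős–Turán type inequality with cutoff `T ≈
M/2` and smoothing width `1/√M` gives discrepancy `O(1/√M)`. The incomplete last block has relative
length of the same order, and `log N ≤ 3√M`. The result is `O(1/log N)`, stronger than what is
claimed; it also gives normality, as a digit block corresponds to an interval. -/

theorem antitone_prod_of_mem_unit {f : ℕ → ℝ} (h0 : ∀ k, 0 ≤ f k) (h1 : ∀ k, f k ≤ 1) :
    Antitone fun S : Finset ℕ => ∏ k ∈ S, f k := by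
  intro S T hST
  simp only
  rw [← Finset.prod_sdiff hST]
  exact mul_le_of_le_one_left (Finset.prod_nonneg fun k _ => h0 k)
    (Finset.prod_le_one (fun k _ => h0 k) fun k _ => h1 k)

theorem hasProd_iInf_of_mem_unit {f : ℕ → ℝ} (h0 : ∀ k, 0 ≤ f k) (h1 : ∀ k, f k ≤ 1) :
    HasProd f (⨅ S : Finset ℕ, ∏ k ∈ S, f k) := by
  have hb : BddBelow (Set.range fun S : Finset ℕ => ∏ k ∈ S, f k) :=
    ⟨0, by rintro _ ⟨S, rfl⟩; exact Finset.prod_nonneg fun k _ => h0 k⟩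
  exact tendsto_atTop_ciInf (antitone_prod_of_mem_unit h0 h1) hb

theorem tprod_le_prod_of_mem_unit {f : ℕ → ℝ} (h0 : ∀ k, 0 ≤ f k) (h1 : ∀ k, f k ≤ 1)
    (S : Finset ℕ) : ∏' k, f k ≤ ∏ k ∈ S, f k := by
  rw [(hasProd_iInf_of_mem_unit h0 h1).tprod_eq]
  exact ciInf_le ⟨0, by rintro _ ⟨S, rfl⟩; exact Finset.prod_nonneg fun k _ => h0 k⟩ S

theorem le_tprod_of_mem_unit {f : ℕ → ℝ} (h0 : ∀ k, 0 ≤ f k) (h1 : ∀ k, f k ≤ 1) {c : ℝ}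
    (h : ∀ n, c ≤ ∏ k ∈ Finset.range n, f k) : c ≤ ∏' k, f k := by
  rw [(hasProd_iInf_of_mem_unit h0 h1).tprod_eq]
  refine le_ciInf fun S => ?_
  obtain ⟨n, hn⟩ := S.exists_nat_subset_range
  exact (h n).trans (antitone_prod_of_mem_unit h0 h1 hn)

/-! ### Sums of products of cosines over residues -/

theorem sum_cos_add_two_pi_mul_div (s : ℕ) (hs : 2 ≤ s) (z : ℝ) :
    ∑ c ∈ Finset.range s, Real.cos (z + 2 * Real.pi * (c / s)) = 0 := by
  have hs0 : s ≠ 0 := by omega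
  have h := (Complex.isPrimitiveRoot_exp s hs0).geom_sum_eq_zero (by omega)
  have h2 : ∀ c ∈ Finset.range s, Real.cos (z + 2 * Real.pi * (c / s)) =
      (Complex.exp (z * Complex.I) * (Complex.exp (2 * Real.pi * Complex.I / s)) ^ c).re := by
    intro c _
    rw [← Complex.exp_nat_mul, ← Complex.exp_add, ← Complex.exp_ofReal_mul_I_re]
    congr 2
    push_cast
    ring
  rw [Finset.sum_congr rfl h2, ← Complex.re_sum, ← Finset.mul_sum, h]
  simp

/-- Cauchy–Schwarz: the mean of `cos²` over the `s` shifts is exactly 1/2, and 71/100 exceeds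
`1/√2`. -/
theorem sum_abs_cos_le (s : ℕ) (hs : 2 ≤ s) (z : ℝ) :
    ∑ c ∈ Finset.range s, |Real.cos (Real.pi * (z + c / s))| ≤ s * (71 / 100) := by
  have h1 : (∑ c ∈ Finset.range s, |Real.cos (Real.pi * (z + c / s))|) ^ 2 ≤
      s * ∑ c ∈ Finset.range s, |Real.cos (Real.pi * (z + c / s))| ^ 2 := by
    simpa using sq_sum_le_card_mul_sum_sq (s := Finset.range s)
      (f := fun c : ℕ => |Real.cos (Real.pi * (z + c / s))|)
  have h2 : ∑ c ∈ Finset.range s, |Real.cos (Real.pi * (z + c / s))| ^ 2 = s / 2 := by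
    have : ∀ c ∈ Finset.range s, |Real.cos (Real.pi * (z + c / s))| ^ 2 =
        1 / 2 + Real.cos (2 * Real.pi * z + 2 * Real.pi * (c / s)) / 2 := by
      intro c _
      rw [sq_abs, Real.cos_sq]
      congr 3
      ring
    rw [Finset.sum_congr rfl this, Finset.sum_add_distrib,
      ← Finset.sum_div _ (fun c : ℕ => Real.cos (2 * Real.pi * z + 2 * Real.pi * (c / s))),
      sum_cos_add_two_pi_mul_div s hs]
    simp
    ring
  rw [h2] at h1
  have hs' : (0 : ℝ) ≤ s := by positivity
  refine abs_le_of_sq_le_sq' ?_ (by positivity) |>.2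
  nlinarith

/-- A bound for `|cos (π y / s^k)|` on `u ≤ y < u + 1`. -/
noncomputable def cosMajorant (s k u : ℕ) : ℝ :=
  min 1 (|Real.cos (Real.pi * u / s ^ k)| + Real.pi / s ^ k)

theorem cosMajorant_nonneg (s k u : ℕ) : 0 ≤ cosMajorant s k u :=
  le_min zero_le_one (by positivity)

theorem cosMajorant_le_one (s k u : ℕ) : cosMajorant s k u ≤ 1 := min_le_left _ _

theorem abs_cos_le_cosMajorant (s k : ℕ) {y : ℝ} (hy : 0 ≤ y) :
    |Real.cos (Real.pi * y / s ^ k)| ≤ cosMajorant s k ⌊y⌋₊ := by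
  refine le_min (Real.abs_cos_le_one _) ?_
  have h1 := Nat.floor_le hy
  have h2 := Nat.lt_floor_add_one y
  have h3 := Real.abs_cos_sub_cos_le (Real.pi * y / s ^ k) (Real.pi * ⌊y⌋₊ / s ^ k)
  have h4 : |Real.pi * y / s ^ k - Real.pi * ⌊y⌋₊ / s ^ k| ≤ Real.pi / s ^ k := by
    rw [← sub_div, ← mul_sub, abs_of_nonneg (by have := sub_nonneg.2 h1; positivity)]
    gcongr
    exact mul_le_of_le_one_right Real.pi_pos.le (by linarith)
  have h5 := abs_sub_abs_le_abs_sub (Real.cos (Real.pi * y / s ^ k))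
    (Real.cos (Real.pi * ⌊y⌋₊ / s ^ k))
  linarith

theorem abs_cos_add_nat_mul_pi (x : ℝ) (n : ℕ) : |Real.cos (x + n * Real.pi)| = |Real.cos x| := by
  rw [Real.cos_add_nat_mul_pi, abs_mul, abs_pow]
  simp

theorem cosMajorant_add_mul (s k u c : ℕ) (hs : s ≠ 0) :
    cosMajorant s k (u + s ^ k * c) = cosMajorant s k u := by
  unfold cosMajorant
  have : Real.pi * ((u + s ^ k * c : ℕ) : ℝ) / s ^ k = Real.pi * u / s ^ k + c * Real.pi := by
    have : (s : ℝ) ≠ 0 := by exact_mod_cast hs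
    push_cast
    field_simp
  rw [this, abs_cos_add_nat_mul_pi]

theorem cosMajorant_mod (s u : ℕ) {k J : ℕ} (hs : s ≠ 0) (hk : k ≤ J) :
    cosMajorant s k (u % s ^ J) = cosMajorant s k u := by
  conv_rhs => rw [← Nat.mod_add_div u (s ^ J), ← Nat.add_sub_cancel' hk, pow_add, mul_assoc]
  rw [cosMajorant_add_mul _ _ _ _ hs, ← pow_add, Nat.add_sub_cancel' hk]

theorem sum_range_mul_eq (f : ℕ → ℝ) (a b : ℕ) :
    ∑ u ∈ Finset.range (a * b), f u =
      ∑ u ∈ Finset.range a, ∑ c ∈ Finset.range b, f (u + a * c) := by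
  induction b with
  | zero => simp
  | succ b ih =>
    simp only [Finset.sum_range_succ, Finset.sum_add_distrib]
    rw [mul_add, mul_one, Finset.sum_range_add, ih]
    simp only [add_comm]

/-- Here `4/5 = 71/100 + 9/100`; the second part covers the error `π / s^(J+1)` of the majorant,
which is why `J ≥ 5` is needed. -/
theorem sum_cosMajorant_le (s : ℕ) (hs : 2 ≤ s) (J : ℕ) (hJ : 5 ≤ J) (u : ℕ) :
    ∑ c ∈ Finset.range s, cosMajorant s (J + 1) (u + s ^ J * c) ≤ s * (4 / 5) := by
  have hs0 : (0 : ℝ) < s := by positivity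
  have h1 : ∀ c ∈ Finset.range s, cosMajorant s (J + 1) (u + s ^ J * c) ≤
      |Real.cos (Real.pi * (u / (s : ℝ) ^ (J + 1) + c / s))| + 9 / 100 := by
    intro c _
    refine (min_le_right _ _).trans (add_le_add (le_of_eq ?_) ?_)
    · congr 2
      push_cast
      field_simp
      ring
    · rw [div_le_iff₀ (by positivity)]
      have h2 : (2 : ℝ) ^ (5 + 1) ≤ (s : ℝ) ^ (J + 1) := by
        calc (2 : ℝ) ^ (5 + 1) ≤ (2 : ℝ) ^ (J + 1) := by gcongr; norm_num
          _ ≤ _ := by gcongr; exact_mod_cast hs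
      have := Real.pi_lt_four
      norm_num at h2
      linarith
  refine (Finset.sum_le_sum h1).trans ?_
  rw [Finset.sum_add_distrib]
  have := sum_abs_cos_le s hs (u / (s : ℝ) ^ (J + 1))
  simp only [Finset.sum_const, Finset.card_range, nsmul_eq_mul]
  linarith

/-- Write a residue modulo `s^(J+1)` as `u + s^J c`: the first `J` factors depend on `u` only, and
the last one averages to at most 4/5 over the top digit `c`. The leading 4 makes the trivial bound
sufficient for `J ≤ 5`, since `4 (4/5)^5 > 1`. -/
theorem sum_prod_cosMajorant_le (s : ℕ) (hs : 2 ≤ s) (J : ℕ) :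
    ∑ u ∈ Finset.range (s ^ J), ∏ k ∈ Finset.range J, cosMajorant s (k + 1) u ≤
      4 * ((s : ℝ) * (4 / 5)) ^ J := by
  have hs0 : (0 : ℝ) < s := by positivity
  rcases lt_or_ge J 5 with hJ | hJ
  · calc _ ≤ ∑ u ∈ Finset.range (s ^ J), (1 : ℝ) := by
          refine Finset.sum_le_sum fun u _ => Finset.prod_le_one (fun k _ => cosMajorant_nonneg _ _ _)
            fun k _ => cosMajorant_le_one _ _ _
      _ = (s : ℝ) ^ J := by simp
      _ ≤ _ := by
        rw [mul_pow]
        have : (4 / 5 : ℝ) ^ 5 ≤ (4 / 5 : ℝ) ^ J := pow_le_pow_of_le_one (by norm_num) (by norm_num) hJ.le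
        have h2 : (0 : ℝ) < (s : ℝ) ^ J := by positivity
        norm_num at this
        nlinarith
  · induction J, hJ using Nat.le_induction with
    | base =>
      calc _ ≤ ∑ u ∈ Finset.range (s ^ 5), (1 : ℝ) := by
            refine Finset.sum_le_sum fun u _ => Finset.prod_le_one (fun k _ => cosMajorant_nonneg _ _ _)
              fun k _ => cosMajorant_le_one _ _ _
        _ = (s : ℝ) ^ 5 := by simp
        _ ≤ _ := by
          rw [mul_pow]
          have h2 : (0 : ℝ) < (s : ℝ) ^ 5 := by positivity
          nlinarith
    | succ J hJ ih =>
      rw [pow_succ s J, sum_range_mul_eq]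
      have hstep : ∀ u ∈ Finset.range (s ^ J), ∑ c ∈ Finset.range s,
          ∏ k ∈ Finset.range (J + 1), cosMajorant s (k + 1) (u + s ^ J * c) ≤
          (∏ k ∈ Finset.range J, cosMajorant s (k + 1) u) * (s * (4 / 5)) := by
        intro u _
        have : ∀ c ∈ Finset.range s,
            ∏ k ∈ Finset.range (J + 1), cosMajorant s (k + 1) (u + s ^ J * c) =
            (∏ k ∈ Finset.range J, cosMajorant s (k + 1) u) *
              cosMajorant s (J + 1) (u + s ^ J * c) := by
          intro c _
          rw [Finset.prod_range_succ]
          congr 1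
          refine Finset.prod_congr rfl fun k hk => ?_
          have hk' : k + 1 ≤ J := Finset.mem_range.1 hk
          rw [← cosMajorant_mod s _ (by omega) hk', Nat.add_mul_mod_self_left,
            cosMajorant_mod s _ (by omega) hk']
        rw [Finset.sum_congr rfl this, ← Finset.mul_sum]
        exact mul_le_mul_of_nonneg_left (sum_cosMajorant_le s hs J hJ u)
          (Finset.prod_nonneg fun k _ => cosMajorant_nonneg _ _ _)
      refine (Finset.sum_le_sum hstep).trans ?_
      rw [← Finset.sum_mul, pow_succ ((s : ℝ) * (4 / 5)), ← mul_assoc (4 : ℝ)]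
      exact mul_le_mul_of_nonneg_right ih (by positivity)

/-- Points whose integer parts are distinct modulo `s ^ J`. -/
theorem sum_prod_abs_cos_le (s : ℕ) (hs : 2 ≤ s) (J T : ℕ) (z : ℕ → ℝ) (hz : ∀ t, 0 ≤ z t)
    (hinj : ∀ t < T, ∀ t' < T, t ≠ t' → 1 ≤ |z t - z t'| ∧ |z t - z t'| + 1 ≤ (s : ℝ) ^ J) :
    ∑ t ∈ Finset.range T, ∏ k ∈ Finset.range J, |Real.cos (Real.pi * z t / s ^ (k + 1))| ≤
      4 * ((s : ℝ) * (4 / 5)) ^ J := by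
  refine le_trans ?_ (sum_prod_cosMajorant_le s hs J)
  have hs0 : s ≠ 0 := by omega
  -- Congruent integer parts would be equal, as they differ by less than `s^J`; but then the points
  -- would be less than 1 apart.
  have hI : Set.InjOn (fun t => ⌊z t⌋₊ % s ^ J) (Finset.range T : Set ℕ) := by
    intro t ht t' ht' h
    by_contra hne
    obtain ⟨h1, h2⟩ := hinj t (by simpa using ht) t' (by simpa using ht') hne
    have a1 := Nat.floor_le (hz t)
    have a2 := Nat.lt_floor_add_one (z t)
    have b1 := Nat.floor_le (hz t')
    have b2 := Nat.lt_floor_add_one (z t')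
    have hmod : (s : ℤ) ^ J ∣ (⌊z t⌋₊ : ℤ) - ⌊z t'⌋₊ := by
      have : ⌊z t'⌋₊ ≡ ⌊z t⌋₊ [MOD s ^ J] := h.symm
      have := (Nat.modEq_iff_dvd.1 this)
      exact_mod_cast this
    have hlt : |(⌊z t⌋₊ : ℤ) - ⌊z t'⌋₊| < (s : ℤ) ^ J := by
      have : |(⌊z t⌋₊ : ℝ) - ⌊z t'⌋₊| < (s : ℝ) ^ J := by
        rw [abs_lt]
        constructor <;> linarith [neg_abs_le (z t - z t'), le_abs_self (z t - z t')]
      exact_mod_cast this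
    have h0 := Int.eq_zero_of_abs_lt_dvd hmod hlt
    have h0' : (⌊z t⌋₊ : ℝ) = ⌊z t'⌋₊ := by
      have : (⌊z t⌋₊ : ℤ) = ⌊z t'⌋₊ := by linarith
      exact_mod_cast this
    have : |z t - z t'| < 1 := by
      rw [abs_lt]; constructor <;> linarith
    linarith
  calc _ ≤ ∑ t ∈ Finset.range T, ∏ k ∈ Finset.range J, cosMajorant s (k + 1) (⌊z t⌋₊ % s ^ J) := by
        refine Finset.sum_le_sum fun t _ => Finset.prod_le_prod (fun _ _ => abs_nonneg _) ?_
        intro k hk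
        rw [cosMajorant_mod s _ hs0 (Finset.mem_range.1 hk)]
        exact abs_cos_le_cosMajorant s (k + 1) (hz t)
    _ = ∑ u ∈ (Finset.range T).image (fun t => ⌊z t⌋₊ % s ^ J),
          ∏ k ∈ Finset.range J, cosMajorant s (k + 1) u :=
        (Finset.sum_image (f := fun u => ∏ k ∈ Finset.range J, cosMajorant s (k + 1) u) hI).symm
    _ ≤ _ := by
        refine Finset.sum_le_sum_of_subset_of_nonneg ?_ fun u _ _ =>
          Finset.prod_nonneg fun k _ => cosMajorant_nonneg _ _ _
        intro u hu
        obtain ⟨t, -, rfl⟩ := Finset.mem_image.1 hu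
        exact Finset.mem_range.2 (Nat.mod_lt _ (by positivity))

/-- The modulus of the Fourier transform at `x` of the distribution of `∑ c_k s^{-k}`, with
independent digits `c_k` uniform in `{0, 1}`. -/
noncomputable def cosProd (s : ℕ) (x : ℝ) : ℝ := ∏' k : ℕ, |Real.cos (Real.pi * x / s ^ (k + 1))|

theorem cosProd_le_one (s : ℕ) (x : ℝ) : cosProd s x ≤ 1 := by
  simpa [cosProd] using tprod_le_prod_of_mem_unit (f := fun k => |Real.cos (Real.pi * x / s ^ (k + 1))|)
    (fun _ => abs_nonneg _) (fun _ => Real.abs_cos_le_one _) ∅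

theorem cosProd_nonneg (s : ℕ) (x : ℝ) : 0 ≤ cosProd s x :=
  le_tprod_of_mem_unit (fun _ => abs_nonneg _) (fun _ => Real.abs_cos_le_one _)
    fun _ => Finset.prod_nonneg fun _ _ => abs_nonneg _

theorem cosProd_le_prod (s u J : ℕ) (x : ℝ) :
    cosProd s x ≤ ∏ k ∈ Finset.range J, |Real.cos (Real.pi * x / s ^ (u + k + 1))| := by
  have h := tprod_le_prod_of_mem_unit (f := fun k => |Real.cos (Real.pi * x / s ^ (k + 1))|)
    (fun _ => abs_nonneg _) (fun _ => Real.abs_cos_le_one _)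
    ((Finset.range J).map (addLeftEmbedding u))
  rwa [Finset.prod_map] at h

/-! ### Powers of `r` compared with powers of `s`. -/

theorem abs_exp_sub_exp_bounds {L u v : ℝ} (hu : |u| ≤ L) (hv : |v| ≤ L) :
    Real.exp (-L) * |u - v| ≤ |Real.exp u - Real.exp v| ∧
      |Real.exp u - Real.exp v| ≤ Real.exp L * |u - v| := by
  wlog h : u ≤ v generalizing u v
  · rw [abs_sub_comm u v, abs_sub_comm (Real.exp u)]
    exact this hv hu (le_of_not_ge h)
  rw [abs_sub_comm u v, abs_sub_comm (Real.exp u), abs_of_nonneg (sub_nonneg.2 h),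
    abs_of_nonneg (sub_nonneg.2 (Real.exp_le_exp.2 h))]
  have h1 : Real.exp v = Real.exp u * Real.exp (v - u) := by rw [← Real.exp_add]; ring_nf
  have h2 : Real.exp u = Real.exp v * Real.exp (-(v - u)) := by rw [← Real.exp_add]; ring_nf
  have h3 := Real.add_one_le_exp (v - u)
  have h4 := Real.add_one_le_exp (-(v - u))
  have h5 : Real.exp (-L) ≤ Real.exp u := Real.exp_le_exp.2 (abs_le.1 hu).1
  have h6 : Real.exp v ≤ Real.exp L := Real.exp_le_exp.2 (abs_le.1 hv).2
  constructor
  · calc Real.exp (-L) * (v - u) ≤ Real.exp u * (v - u) := by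
          apply mul_le_mul_of_nonneg_right h5; linarith
      _ ≤ Real.exp u * (Real.exp (v - u) - 1) :=
          mul_le_mul_of_nonneg_left (by linarith) (Real.exp_pos u).le
      _ = _ := by rw [mul_sub, ← h1]; ring
  · calc Real.exp v - Real.exp u = Real.exp v * (1 - Real.exp (-(v - u))) := by
          rw [mul_sub, ← h2]; ring
      _ ≤ Real.exp v * (v - u) := mul_le_mul_of_nonneg_left (by linarith) (Real.exp_pos v).le
      _ ≤ _ := by apply mul_le_mul_of_nonneg_right h6; linarith

/-- A power of `r` that is close to a power of `s`, by Dirichlet's theorem. -/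
theorem exists_pow_eq_pow_mul_exp (r s : ℕ) (hr : 2 ≤ r) (hs : 2 ≤ s) (h : ¬ MultDep r s)
    (T : ℕ) (hT : 1 ≤ T) :
    ∃ (d e : ℕ) (η : ℝ), 1 ≤ d ∧ d ≤ T ∧ (r : ℝ) ^ d = (s : ℝ) ^ e * Real.exp η ∧
      |η| * T ≤ Real.log s ∧ 1 ≤ |η| * (s * (r : ℝ) ^ d) := by
  have hr1 : (1 : ℝ) < r := by exact_mod_cast hr
  have hs1 : (1 : ℝ) < s := by exact_mod_cast hs
  have hlr := Real.log_pos hr1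
  have hls := Real.log_pos hs1
  obtain ⟨e, d, hd0, hdT, hde⟩ := Real.exists_int_int_abs_mul_sub_le
    (Real.log r / Real.log s) (n := T) (by omega)
  have hT' : (1 : ℝ) ≤ T := by exact_mod_cast hT
  have he : 0 ≤ e := by
    have h1 : (0 : ℝ) < d * (Real.log r / Real.log s) := by
      have : (0 : ℝ) < d := by exact_mod_cast hd0
      positivity
    have h2 : (1 : ℝ) / (T + 1) < 1 := by rw [div_lt_one (by positivity)]; linarith
    have h3 : (-1 : ℝ) < e := by linarith [(abs_le.1 hde).2]
    have : (-1 : ℤ) < e := by exact_mod_cast h3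
    omega
  lift e to ℕ using he
  lift d to ℕ using hd0.le
  have hd0' : 0 < d := by exact_mod_cast hd0
  set η := d * Real.log r - e * Real.log s with hη
  have hpow : (r : ℝ) ^ d = (s : ℝ) ^ e * Real.exp η := by
    rw [hη, Real.exp_sub, Real.exp_nat_mul, Real.exp_nat_mul, Real.exp_log (by positivity),
      Real.exp_log (by positivity)]
    field_simp
  have hηT : |η| * T ≤ Real.log s := by
    have h1 : η = (d * (Real.log r / Real.log s) - e) * Real.log s := by
      rw [hη]; field_simp
    rw [h1, abs_mul, abs_of_pos hls]
    push_cast at hde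
    rw [le_div_iff₀ (by positivity)] at hde
    have h2 : |d * (Real.log r / Real.log s) - e| * T ≤ 1 := by
      nlinarith [abs_nonneg (d * (Real.log r / Real.log s) - e)]
    nlinarith
  refine ⟨d, e, η, hd0', by exact_mod_cast hdT, hpow, hηT, ?_⟩
  have hηs : |η| ≤ Real.log s := by nlinarith [abs_nonneg η]
  have hrd : (0 : ℝ) < (r : ℝ) ^ d := by positivity
  have hse : (0 : ℝ) < (s : ℝ) ^ e := by positivity
  have hne : r ^ d ≠ s ^ e := by
    intro heq
    rcases Nat.eq_zero_or_pos e with rfl | he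
    · have : 1 < r ^ d := Nat.one_lt_pow (by omega) (by omega)
      simp at heq; omega
    · exact h ⟨d, e, hd0', he, heq⟩
  rcases lt_or_gt_of_ne hne with hlt | hlt
  · have h1 : (r : ℝ) ^ d + 1 ≤ (s : ℝ) ^ e := by exact_mod_cast hlt
    have h2 : (s : ℝ) ^ e ≤ s * (r : ℝ) ^ d := by
      have h3 : Real.exp (-η) ≤ s := by
        calc _ ≤ Real.exp (Real.log s) := Real.exp_le_exp.2 ((neg_le_abs η).trans hηs)
          _ = s := Real.exp_log (by positivity)
      have h4 : (s : ℝ) ^ e = (r : ℝ) ^ d * Real.exp (-η) := by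
        rw [hpow, mul_assoc, ← Real.exp_add]; simp
      rw [h4, mul_comm]; gcongr
    have h5 : (s : ℝ) ^ e * (1 - Real.exp η) ≥ 1 := by rw [mul_sub, ← hpow]; linarith
    have h6 := Real.add_one_le_exp η
    have h7 : 1 - Real.exp η ≤ |η| := by linarith [neg_le_abs η]
    nlinarith [abs_nonneg η]
  · have h1 : (s : ℝ) ^ e + 1 ≤ (r : ℝ) ^ d := by exact_mod_cast hlt
    have h4 : (s : ℝ) ^ e = (r : ℝ) ^ d * Real.exp (-η) := by
      rw [hpow, mul_assoc, ← Real.exp_add]; simp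
    have h5 : (r : ℝ) ^ d * (1 - Real.exp (-η)) ≥ 1 := by rw [mul_sub, ← h4]; linarith
    have h6 := Real.add_one_le_exp (-η)
    have h7 : 1 - Real.exp (-η) ≤ |η| := by linarith [le_abs_self η]
    have h8 : (r : ℝ) ^ d ≤ s * (r : ℝ) ^ d := by nlinarith
    nlinarith [abs_nonneg η]

/-- Since `r^(n+dt) x = s^(et) · Y exp(ηt)`, discarding the first `e t + i` cosines leaves the
product at `z t = Y exp(ηt) / s^i`. As `|η| t ≤ log s`, the map `t ↦ exp(ηt)` distorts distances by
a factor at most `s` either way, so the `z t` are nearly equally spaced. -/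
theorem exists_sum_cosProd_le (r s : ℕ) (hr : 2 ≤ r) (hs : 2 ≤ s) (h : ¬ MultDep r s) (j : ℕ) :
    ∃ d : ℕ, d ≤ s ^ j ∧ ∀ x : ℝ, 1 ≤ x → ∀ n : ℕ, s ^ j + 2 * s ≤ n →
      ∑ t ∈ Finset.range (s ^ j), cosProd s ((r : ℝ) ^ (n + d * t) * x) ≤
        4 * ((s : ℝ) * (4 / 5)) ^ (j + 4) := by
  have hr1 : (1 : ℝ) < r := by exact_mod_cast hr
  have hs1 : (1 : ℝ) < s := by exact_mod_cast hs
  have hs2 : (2 : ℝ) ≤ s := by exact_mod_cast hs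
  have hls := Real.log_pos hs1
  obtain ⟨d, e, η, hd, hdT, hpow, hηT, hη⟩ := exists_pow_eq_pow_mul_exp r s hr hs h (s ^ j)
    (Nat.one_le_pow _ _ (by omega))
  refine ⟨d, hdT, fun x hx n hn => ?_⟩
  set Y : ℝ := (r : ℝ) ^ n * x with hY
  have hYpos : 0 < Y := by positivity
  -- A lower bound for the spacing of the points `Y exp(ηt)`; the condition on `n` makes it at least
  -- 1.
  set δ : ℝ := Y * |η| / s with hδ
  have hδ1 : 1 ≤ δ := by
    rw [hδ, le_div_iff₀ (by positivity), one_mul]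
    have h1 : (s : ℝ) * s * (r : ℝ) ^ d ≤ Y := by
      have h2 : (s : ℝ) ≤ (r : ℝ) ^ s := by
        have : s < r ^ s := Nat.lt_pow_self (by omega)
        exact_mod_cast this.le
      calc (s : ℝ) * s * (r : ℝ) ^ d ≤ (r : ℝ) ^ s * (r : ℝ) ^ s * (r : ℝ) ^ d := by gcongr
        _ = (r : ℝ) ^ (s + s + d) := by rw [pow_add, pow_add]
        _ ≤ (r : ℝ) ^ n := pow_le_pow_right₀ hr1.le (by omega)
        _ ≤ Y := le_mul_of_one_le_right (by positivity) hx
    have h3 := abs_nonneg η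
    calc (s : ℝ) ≤ s * (|η| * (s * (r : ℝ) ^ d)) := le_mul_of_one_le_right (by positivity) hη
      _ = (s * s * (r : ℝ) ^ d) * |η| := by ring
      _ ≤ Y * |η| := by gcongr
  -- After division by `s^i` the spacing bound lies in `[1, s)`: the points stay 1 apart, yet their
  -- span is at most `s^(j+3)`.
  obtain ⟨i, hi1, hi2⟩ := exists_nat_pow_near hδ1 hs1
  have hsi : (0 : ℝ) < (s : ℝ) ^ i := by positivity
  set z : ℕ → ℝ := fun t => Y / (s : ℝ) ^ i * Real.exp (η * t) with hz
  have hle : ∀ t ∈ Finset.range (s ^ j), cosProd s ((r : ℝ) ^ (n + d * t) * x) ≤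
      ∏ k ∈ Finset.range (j + 4), |Real.cos (Real.pi * z t / s ^ (k + 1))| := by
    intro t _
    refine (cosProd_le_prod s (e * t + i) (j + 4) _).trans (le_of_eq ?_)
    refine Finset.prod_congr rfl fun k _ => ?_
    congr 2
    have : (r : ℝ) ^ (n + d * t) * x = Y * ((s : ℝ) ^ (e * t) * Real.exp (η * t)) := by
      rw [pow_add, pow_mul, hpow, mul_pow, ← pow_mul, ← Real.exp_nat_mul, hY, mul_comm (t : ℝ)]
      ring
    rw [this, hz]
    simp only [pow_add]
    field_simp
  refine (Finset.sum_le_sum hle).trans (sum_prod_abs_cos_le s hs (j + 4) (s ^ j) z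
    (fun t => by simp only [hz]; positivity) ?_)
  intro t ht t' ht' hne
  have hb : ∀ t : ℕ, t < s ^ j → |η * t| ≤ Real.log s := by
    intro t ht
    rw [abs_mul, Nat.abs_cast]
    have : (t : ℝ) ≤ (s ^ j : ℕ) := by exact_mod_cast ht.le
    exact (mul_le_mul_of_nonneg_left this (abs_nonneg _)).trans hηT
  obtain ⟨h1, h2⟩ := abs_exp_sub_exp_bounds (hb t ht) (hb t' ht')
  rw [Real.exp_neg, Real.exp_log (by positivity)] at h1
  rw [Real.exp_log (by positivity)] at h2
  have hzz : |z t - z t'| = Y / (s : ℝ) ^ i * |Real.exp (η * t) - Real.exp (η * t')| := by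
    simp only [hz]
    rw [← mul_sub, abs_mul, abs_of_pos (by positivity)]
  have htt : |η * t - η * t'| = |η| * |(t : ℝ) - t'| := by rw [← mul_sub, abs_mul]
  have htt1 : 1 ≤ |(t : ℝ) - t'| := by
    have : (t : ℤ) - t' ≠ 0 := by omega
    exact_mod_cast Int.one_le_abs this
  have htt2 : |(t : ℝ) - t'| ≤ (s : ℝ) ^ j := by
    have h3 : (t : ℝ) ≤ (s : ℝ) ^ j := by exact_mod_cast ht.le
    have h4 : (t' : ℝ) ≤ (s : ℝ) ^ j := by exact_mod_cast ht'.le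
    rw [abs_le]
    constructor <;> linarith [Nat.cast_nonneg (α := ℝ) t, Nat.cast_nonneg (α := ℝ) t']
  rw [hzz]
  rw [htt] at h1 h2
  constructor
  · calc (1 : ℝ) ≤ δ / (s : ℝ) ^ i * |(t : ℝ) - t'| :=
          one_le_mul_of_one_le_of_one_le ((one_le_div hsi).2 hi1) htt1
      _ = Y / (s : ℝ) ^ i * ((s : ℝ)⁻¹ * (|η| * |(t : ℝ) - t'|)) := by rw [hδ]; field_simp
      _ ≤ _ := by gcongr
  · have h5 : Y / (s : ℝ) ^ i * |Real.exp (η * t) - Real.exp (η * t')| ≤ (s : ℝ) ^ (j + 3) := by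
      calc _ ≤ Y / (s : ℝ) ^ i * (s * (|η| * |(t : ℝ) - t'|)) := by gcongr
        _ = δ / (s : ℝ) ^ i * (s * s * |(t : ℝ) - t'|) := by rw [hδ]; field_simp
        _ ≤ s * (s * s * (s : ℝ) ^ j) := by
          gcongr
          rw [div_le_iff₀ hsi, ← pow_succ']
          exact hi2.le
        _ = _ := by ring
    have h6 : (1 : ℝ) ≤ (s : ℝ) ^ (j + 3) := one_le_pow₀ hs1.le
    have h7 : (s : ℝ) ^ (j + 4) = s * (s : ℝ) ^ (j + 3) := by ring
    rw [h7]
    nlinarith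

/-! ### A power saving for sums of `cosProd`, and the existence of exponents. -/

theorem sum_range_le_of_shift (f : ℕ → ℝ) (h0 : ∀ n, 0 ≤ f n) (h1 : ∀ n, f n ≤ 1) (N D : ℕ) :
    ∑ n ∈ Finset.range N, f n ≤ D + ∑ n ∈ Finset.range N, f (n + D) := by
  calc ∑ n ∈ Finset.range N, f n ≤ ∑ n ∈ Finset.range (D + N), f n :=
        Finset.sum_le_sum_of_subset_of_nonneg (Finset.range_mono (by omega)) fun n _ _ => h0 n
    _ = ∑ n ∈ Finset.range D, f n + ∑ n ∈ Finset.range N, f (n + D) := by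
        rw [Finset.sum_range_add]; simp only [add_comm]
    _ ≤ _ := by
        gcongr
        refine (Finset.sum_le_sum fun n _ => h1 n).trans ?_
        simp

/-- Average over the `s^j` shifts `n ↦ n + d t`. Each shift costs at most `d t ≤ s^(2j)`; the
shifted sums together are estimated by `exists_sum_cosProd_le`, apart from the first `s^j + 2s`
values of `n`, which are bounded trivially. -/
theorem sum_cosProd_le (r s : ℕ) (hr : 2 ≤ r) (hs : 2 ≤ s) (h : ¬ MultDep r s) (j N : ℕ)
    (x : ℝ) (hx : 1 ≤ x) :
    ∑ n ∈ Finset.range N, cosProd s ((r : ℝ) ^ n * x) ≤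
      (s : ℝ) ^ (2 * j) + (s : ℝ) ^ j + 2 * s + N * (4 * (s : ℝ) ^ 4 * (4 / 5) ^ j) := by
  obtain ⟨d, hd, hsum⟩ := exists_sum_cosProd_le r s hr hs h j
  set T := s ^ j with hT
  have hTpos : 0 < T := Nat.pow_pos (by omega)
  have hT0 : (0 : ℝ) < T := by exact_mod_cast hTpos
  have hTs : (T : ℝ) = (s : ℝ) ^ j := by rw [hT]; push_cast; rfl
  set S := ∑ n ∈ Finset.range N, cosProd s ((r : ℝ) ^ n * x) with hS
  have hshift : ∀ t ∈ Finset.range T, S ≤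
      (T * T : ℝ) + ∑ n ∈ Finset.range N, cosProd s ((r : ℝ) ^ (n + d * t) * x) := by
    intro t ht
    refine (sum_range_le_of_shift (fun n => cosProd s ((r : ℝ) ^ n * x))
      (fun n => cosProd_nonneg _ _) (fun n => cosProd_le_one _ _) N (d * t)).trans ?_
    have : d * t ≤ T * T := Nat.mul_le_mul hd (Finset.mem_range.1 ht).le
    gcongr
    exact_mod_cast this
  have h1 := Finset.sum_le_sum hshift
  rw [Finset.sum_const, Finset.sum_add_distrib, Finset.sum_const, Finset.card_range,
    nsmul_eq_mul, nsmul_eq_mul, Finset.sum_comm] at h1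
  set ε : ℝ := 4 * ((s : ℝ) * (4 / 5)) ^ (j + 4) with hε
  have h2 : ∑ n ∈ Finset.range N, ∑ t ∈ Finset.range T, cosProd s ((r : ℝ) ^ (n + d * t) * x) ≤
      (T + 2 * s) * T + N * ε := by
    calc _ ≤ ∑ n ∈ Finset.range N, ((if n < T + 2 * s then (T : ℝ) else 0) + ε) := by
          refine Finset.sum_le_sum fun n _ => ?_
          split_ifs with hn
          · have : ∑ t ∈ Finset.range T, cosProd s ((r : ℝ) ^ (n + d * t) * x) ≤ T := by
              refine (Finset.sum_le_sum fun t _ => cosProd_le_one _ _).trans ?_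
              simp
            have : 0 ≤ ε := by positivity
            linarith
          · rw [zero_add]
            exact hsum x hx n (by omega)
      _ ≤ _ := by
          rw [Finset.sum_add_distrib, ← Finset.sum_filter, Finset.sum_const, Finset.sum_const,
            Finset.card_range, nsmul_eq_mul, nsmul_eq_mul]
          gcongr
          have : (Finset.filter (fun n => n < T + 2 * s) (Finset.range N)).card ≤ T + 2 * s := by
            refine (Finset.card_le_card (t := Finset.range (T + 2 * s)) ?_).trans (by simp)
            intro n hn
            simp at hn ⊢
            exact hn.2
          exact_mod_cast this
  have h3 : ε ≤ T * (4 * (s : ℝ) ^ 4 * (4 / 5) ^ j) := by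
    rw [hε, hTs, mul_pow, pow_add, pow_add]
    have : (0 : ℝ) < (s : ℝ) ^ j * (s : ℝ) ^ 4 * (4 / 5) ^ j := by positivity
    have h4 : ((4 : ℝ) / 5) ^ 4 ≤ 1 := by norm_num
    nlinarith
  have h4 : (T : ℝ) * S ≤
      T * (T * T + (T + 2 * s) + N * (4 * (s : ℝ) ^ 4 * (4 / 5) ^ j)) := by
    have : (N : ℝ) * ε ≤ N * (T * (4 * (s : ℝ) ^ 4 * (4 / 5) ^ j)) := by gcongr
    linarith
  have h5 := le_of_mul_le_mul_left h4 hT0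
  rw [hTs] at h5
  rw [two_mul, pow_add]
  linarith

/-- The sums of `cosProd` save a power of `N`, uniformly in `x ≥ 1`. -/
theorem exists_sum_cosProd_le_rpow (r s : ℕ) (hr : 2 ≤ r) (hs : 2 ≤ s) (h : ¬ MultDep r s) :
    ∃ a : ℝ, 0 < a ∧ a < 1 / 2 ∧ ∀ N : ℕ, 1 ≤ N → ∀ x : ℝ, 1 ≤ x →
      ∑ n ∈ Finset.range N, cosProd s ((r : ℝ) ^ n * x) ≤ 2 * (N : ℝ) ^ (1 - a) := by
  have hs1 : (1 : ℝ) < s := by exact_mod_cast hs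
  have hs2 : (2 : ℝ) ≤ s := by exact_mod_cast hs
  have hls := Real.log_pos hs1
  -- the exponent `κ` with `(s ^ 3) ^ κ = 5 / 4`
  set κ : ℝ := Real.log (5 / 4) / (3 * Real.log s) with hκ
  have hκ0 : 0 < κ := by
    have := Real.log_pos (show (1 : ℝ) < 5 / 4 by norm_num)
    positivity
  have hκs : ((s : ℝ) ^ 3) ^ κ = 5 / 4 := by
    rw [Real.rpow_def_of_pos (by positivity), Real.log_pow, hκ]
    push_cast
    rw [mul_div_cancel₀ _ (by positivity), Real.exp_log (by norm_num)]
  set C : ℝ := 2 + 2 * s + 4 * (s : ℝ) ^ 4 with hC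
  have hC2 : 2 ≤ C := by rw [hC]; nlinarith [pow_pos (show (0 : ℝ) < s by linarith) 4]
  have main : ∀ N : ℕ, 1 ≤ N → ∀ x : ℝ, 1 ≤ x →
      ∑ n ∈ Finset.range N, cosProd s ((r : ℝ) ^ n * x) ≤ 5 / 4 * C * (N : ℝ) ^ (1 - κ) := by
    intro N hN x hx
    have hN' : (1 : ℝ) ≤ N := by exact_mod_cast hN
    -- With `s^(3j) ≤ N` the shift cost is `s^(2j) ≤ N s^(-j) ≤ N (4/5)^j`, the same size as the
    -- main term; `N < s^(3(j+1))` turns `(4/5)^j` into a power of `N`.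
    obtain ⟨j, hj1, hj2⟩ := exists_nat_pow_near hN' (one_lt_pow₀ hs1 (show 3 ≠ 0 by norm_num))
    refine (sum_cosProd_le r s hr hs h j N x hx).trans ?_
    have hq : ((4 : ℝ) / 5) ^ j ≤ 5 / 4 * (N : ℝ) ^ (-κ) := by
      have h1 : (N : ℝ) ^ κ ≤ (5 / 4) ^ (j + 1) := by
        calc (N : ℝ) ^ κ ≤ (((s : ℝ) ^ 3) ^ (j + 1)) ^ κ :=
              Real.rpow_le_rpow (by positivity) hj2.le hκ0.le
          _ = _ := by rw [← Real.rpow_natCast, ← Real.rpow_mul (by positivity), mul_comm,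
                Real.rpow_mul (by positivity), hκs, Real.rpow_natCast]
      rw [Real.rpow_neg (by positivity)]
      have h2 : (0 : ℝ) < (N : ℝ) ^ κ := by positivity
      rw [← div_eq_mul_inv, le_div_iff₀ h2]
      calc ((4 : ℝ) / 5) ^ j * (N : ℝ) ^ κ ≤ (4 / 5) ^ j * (5 / 4) ^ (j + 1) := by gcongr
        _ = 5 / 4 := by rw [pow_succ, ← mul_assoc, ← mul_pow]; norm_num
    have hsj : (1 : ℝ) ≤ (s : ℝ) ^ j := one_le_pow₀ hs1.le
    have hq1 : 1 ≤ (s : ℝ) ^ j * (4 / 5) ^ j := by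
      rw [← mul_pow]; exact one_le_pow₀ (by linarith)
    have hN3 : (s : ℝ) ^ (2 * j) * (s : ℝ) ^ j ≤ N := by
      rw [← pow_add, ← add_one_mul 2 j, pow_mul]; exact hj1
    have hA : (s : ℝ) ^ (2 * j) ≤ N * (4 / 5) ^ j := by
      calc (s : ℝ) ^ (2 * j) ≤ (s : ℝ) ^ (2 * j) * ((s : ℝ) ^ j * (4 / 5) ^ j) :=
            le_mul_of_one_le_right (by positivity) hq1
        _ = ((s : ℝ) ^ (2 * j) * (s : ℝ) ^ j) * (4 / 5) ^ j := by ring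
        _ ≤ _ := by gcongr
    have hB : (s : ℝ) ^ j ≤ (s : ℝ) ^ (2 * j) := pow_le_pow_right₀ hs1.le (by omega)
    have hD : (1 : ℝ) ≤ N * (4 / 5) ^ j := by linarith
    have hsum : (s : ℝ) ^ (2 * j) + (s : ℝ) ^ j + 2 * s + N * (4 * (s : ℝ) ^ 4 * (4 / 5) ^ j) ≤
        C * (N * (4 / 5) ^ j) := by
      rw [hC]; nlinarith
    refine hsum.trans ?_
    rw [sub_eq_add_neg, Real.rpow_add (by positivity), Real.rpow_one]
    calc C * (N * (4 / 5) ^ j) ≤ C * (N * (5 / 4 * (N : ℝ) ^ (-κ))) := by gcongr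
      _ = _ := by ring
  -- shrink the exponent to improve the constant
  set B : ℝ := 5 / 4 * C with hB
  have hB2 : 2 < B := by rw [hB]; linarith
  set a : ℝ := min (1 / 4) (min (κ / 2) (κ / 2 * (Real.log 2 / Real.log (B / 2)))) with ha
  have hlB : 0 < Real.log (B / 2) := Real.log_pos (by linarith)
  have hl2 : 0 < Real.log 2 := Real.log_pos (by norm_num)
  have ha0 : 0 < a := by
    rw [ha]; refine lt_min (by norm_num) (lt_min (by positivity) (by positivity))
  refine ⟨a, ha0, (min_le_left _ _).trans_lt (by norm_num), fun N hN x hx => ?_⟩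
  have hN' : (1 : ℝ) ≤ N := by exact_mod_cast hN
  have hN0 : (0 : ℝ) < N := by linarith
  -- While `N^a ≤ 2` the trivial bound `N` suffices. Afterwards the last entry of the minimum
  -- defining `a` gives `N^(κ/2) ≥ B/2`, which absorbs the constant.
  by_cases hcase : (N : ℝ) ^ a ≤ 2
  · calc ∑ n ∈ Finset.range N, cosProd s ((r : ℝ) ^ n * x) ≤ N := by
          refine (Finset.sum_le_sum fun n _ => cosProd_le_one _ _).trans ?_
          simp
      _ = (N : ℝ) ^ a * (N : ℝ) ^ (1 - a) := by
          rw [← Real.rpow_add hN0]; simp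
      _ ≤ _ := by gcongr
  · push Not at hcase
    refine (main N hN x hx).trans ?_
    have h1 : (N : ℝ) ^ (1 - κ) = (N : ℝ) ^ (1 - a) * (N : ℝ) ^ (-(κ - a)) := by
      rw [← Real.rpow_add hN0]; ring_nf
    have hak : a ≤ κ / 2 := (min_le_right _ _).trans (min_le_left _ _)
    have h2 : B / 2 ≤ (N : ℝ) ^ (κ - a) := by
      have h3 : (N : ℝ) ^ (κ / 2) ≤ (N : ℝ) ^ (κ - a) :=
        Real.rpow_le_rpow_of_exponent_le hN' (by linarith)
      refine le_trans ?_ h3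
      have h4 : Real.log 2 < a * Real.log N := by
        have := Real.log_lt_log (by norm_num) hcase
        rwa [Real.log_rpow hN0] at this
      have h5 : a ≤ κ / 2 * (Real.log 2 / Real.log (B / 2)) :=
        (min_le_right _ _).trans (min_le_right _ _)
      have hlN : 0 ≤ Real.log N := Real.log_nonneg hN'
      have h6 : Real.log 2 < κ / 2 * (Real.log 2 / Real.log (B / 2)) * Real.log N :=
        h4.trans_le (mul_le_mul_of_nonneg_right h5 hlN)
      have h7 : Real.log (B / 2) < Real.log N * (κ / 2) := by
        have h8 : κ / 2 * (Real.log 2 / Real.log (B / 2)) * Real.log N =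
          Real.log 2 * (Real.log N * (κ / 2)) / Real.log (B / 2) := by ring
        rw [h8, lt_div_iff₀ hlB] at h6
        exact lt_of_mul_lt_mul_left h6 hl2.le
      rw [Real.rpow_def_of_pos hN0, ← Real.exp_log (show 0 < B / 2 by linarith)]
      exact Real.exp_le_exp.2 h7.le
    rw [h1, Real.rpow_neg hN0.le]
    have h9 : (0 : ℝ) < (N : ℝ) ^ (κ - a) := by positivity
    have h10 : B * ((N : ℝ) ^ (κ - a))⁻¹ ≤ 2 := by
      rw [← div_eq_mul_inv, div_le_iff₀ h9]; linarith
    have h11 : (0 : ℝ) < (N : ℝ) ^ (1 - a) := by positivity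
    calc B * ((N : ℝ) ^ (1 - a) * ((N : ℝ) ^ (κ - a))⁻¹) =
          (B * ((N : ℝ) ^ (κ - a))⁻¹) * (N : ℝ) ^ (1 - a) := by ring
      _ ≤ _ := by gcongr

theorem tprod_abs_cos_eq_cosProd (r s n K l : ℕ) (hs : s ≠ 0) :
    ∏' k : ℕ, |Real.cos (Real.pi * (r : ℝ) ^ n * l / (s : ℝ) ^ (K + 1 + k))| =
      cosProd s ((r : ℝ) ^ n * (l / (s : ℝ) ^ K)) := by
  have hs0 : (s : ℝ) ≠ 0 := by exact_mod_cast hs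
  refine tprod_congr fun k => ?_
  congr 2
  rw [show K + 1 + k = K + (k + 1) by ring, pow_add]
  field_simp

theorem exists_isCosExponent (r s : ℕ) (hr : 1 < r) (hs : 1 < s) : ∃ a, IsCosExponent r s a := by
  by_cases h : MultDep r s
  · exact ⟨1 / 4, by norm_num, by norm_num, fun h' => absurd h h'⟩
  · obtain ⟨a, h0, h1, ha⟩ := exists_sum_cosProd_le_rpow r s hr hs h
    refine ⟨a, h0, h1, fun _ N K l hN _ _ hl => ?_⟩
    simp only [tprod_abs_cos_eq_cosProd r s _ K l (by omega)]
    refine ha N hN _ ?_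
    rw [one_le_div (by positivity)]
    exact_mod_cast hl

theorem exists_cosExponents :
    ∃ a : ℕ → ℕ → ℝ, ∀ r s : ℕ, 1 < r → 1 < s → IsCosExponent r s (a r s) := by
  classical
  refine ⟨fun r s => if h : 1 < r ∧ 1 < s then (exists_isCosExponent r s h.1 h.2).choose else 0,
    fun r s hr hs => ?_⟩
  simp only [hr, hs, and_self, dite_true]
  exact (exists_isCosExponent r s hr hs).choose_spec

/-! ### Exponential sums and discrepancy -/

theorem norm_expo (x : ℝ) : ‖expo x‖ = 1 := by
  rw [expo, show 2 * (Real.pi : ℂ) * Complex.I * x = ((2 * Real.pi * x : ℝ) : ℂ) * Complex.I by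
    push_cast; ring]
  exact Complex.norm_exp_ofReal_mul_I _

theorem expo_add (x y : ℝ) : expo (x + y) = expo x * expo y := by
  rw [expo, expo, expo, ← Complex.exp_add]; push_cast; ring_nf

theorem expo_re (x : ℝ) : (expo x).re = Real.cos (2 * Real.pi * x) := by
  rw [expo, show 2 * (Real.pi : ℂ) * Complex.I * x = ((2 * Real.pi * x : ℝ) : ℂ) * Complex.I by
    push_cast; ring]
  exact Complex.exp_ofReal_mul_I_re _

/-- The periodic second Bernoulli polynomial. -/
noncomputable def bernoulliTwo (x : ℝ) : ℝ := Int.fract x ^ 2 - Int.fract x + 1 / 6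

theorem hasSum_cos_div_sq (x : ℝ) :
    HasSum (fun t : ℕ => 1 / (t : ℝ) ^ 2 * Real.cos (2 * Real.pi * t * x))
      (Real.pi ^ 2 * bernoulliTwo x) := by
  have h := hasSum_one_div_nat_pow_mul_cos (k := 1) one_ne_zero (x := Int.fract x)
    ⟨Int.fract_nonneg x, (Int.fract_lt_one x).le⟩
  convert! h using 1
  · ext t
    rw [mul_one]
    congr 1
    rw [← Real.cos_sub_int_mul_two_pi _ (t * ⌊x⌋)]
    congr 1
    rw [Int.fract]
    push_cast
    ring
  · simp [Polynomial.bernoulli, Finset.sum_range_succ, bernoulliTwo, Nat.choose, bernoulli]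
    ring

/-- The sawtooth `fract x - 1/2` is half the derivative of `bernoulliTwo`. Equality holds unless `x
+ δ` passes an integer, where the periodic function lies below the continued parabola. Forward
differences thus bound the sawtooth from below; the backward differences of `le_bernoulliTwo_sub`
bound it from above. -/
theorem bernoulliTwo_add_sub_le {x δ : ℝ} (h0 : 0 ≤ δ) (h1 : δ ≤ 1) :
    bernoulliTwo (x + δ) - bernoulliTwo x ≤ 2 * δ * (Int.fract x - 1 / 2) + δ ^ 2 := by
  have hf0 := Int.fract_nonneg x
  have hf1 := Int.fract_lt_one x
  have hx := Int.self_sub_floor x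
  unfold bernoulliTwo
  rcases lt_or_ge (Int.fract x + δ) 1 with h | h
  · have : Int.fract (x + δ) = Int.fract x + δ := by
      rw [Int.fract_eq_iff]
      exact ⟨by linarith, h, ⌊x⌋, by linarith⟩
    rw [this]; nlinarith
  · have : Int.fract (x + δ) = Int.fract x + δ - 1 := by
      rw [Int.fract_eq_iff]
      exact ⟨by linarith, by linarith, ⌊x⌋ + 1, by push_cast; linarith⟩
    rw [this]; nlinarith

theorem le_bernoulliTwo_sub {x δ : ℝ} (h0 : 0 ≤ δ) (h1 : δ ≤ 1) :
    2 * δ * (Int.fract x - 1 / 2) - δ ^ 2 ≤ bernoulliTwo x - bernoulliTwo (x - δ) := by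
  have hf0 := Int.fract_nonneg x
  have hf1 := Int.fract_lt_one x
  have hx := Int.self_sub_floor x
  unfold bernoulliTwo
  rcases le_or_gt δ (Int.fract x) with h | h
  · have : Int.fract (x - δ) = Int.fract x - δ := by
      rw [Int.fract_eq_iff]
      exact ⟨by linarith, by linarith, ⌊x⌋, by linarith⟩
    rw [this]; nlinarith
  · have : Int.fract (x - δ) = Int.fract x - δ + 1 := by
      rw [Int.fract_eq_iff]
      exact ⟨by linarith, by linarith, ⌊x⌋ - 1, by push_cast; linarith⟩
    rw [this]; nlinarith

section

variable {S : Finset ℕ} {x : ℕ → ℝ} {T : ℕ} {E : ℝ}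

theorem abs_sum_cos_le (t : ℕ) (α : ℝ) :
    |∑ n ∈ S, Real.cos (2 * Real.pi * t * (x n + α))| ≤ ‖∑ n ∈ S, expo (t * x n)‖ := by
  have : ∑ n ∈ S, Real.cos (2 * Real.pi * t * (x n + α)) =
      ((∑ n ∈ S, expo (t * x n)) * expo (t * α)).re := by
    rw [Finset.sum_mul, Complex.re_sum]
    refine Finset.sum_congr rfl fun n _ => ?_
    rw [← expo_add, expo_re]
    congr 1
    ring
  rw [this]
  refine (Complex.abs_re_le_norm _).trans ?_
  rw [norm_mul, norm_expo, mul_one]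

/-- The Fourier coefficients `1/t²` are summable: frequencies up to `T` contribute at most `2E`, the
others at most `card / T`, and division by `π²` absorbs the 2. The translation `α` only rotates each
exponential sum. -/
theorem abs_sum_bernoulliTwo_le (hT : 1 ≤ T) (hE0 : 0 ≤ E)
    (hE : ∀ t : ℕ, 1 ≤ t → t ≤ T → ‖∑ n ∈ S, expo (t * x n)‖ ≤ E) (α : ℝ) :
    |∑ n ∈ S, bernoulliTwo (x n + α)| ≤ E + S.card / T := by
  have hsum : HasSum (fun t : ℕ => 1 / (t : ℝ) ^ 2 *
      ∑ n ∈ S, Real.cos (2 * Real.pi * t * (x n + α)))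
      (Real.pi ^ 2 * ∑ n ∈ S, bernoulliTwo (x n + α)) := by
    rw [Finset.mul_sum]
    simp_rw [Finset.mul_sum]
    exact hasSum_sum fun n _ => hasSum_cos_div_sq (x n + α)
  have hT0 : (0 : ℝ) < T := by exact_mod_cast hT
  have hbound : ∀ M : ℕ, |∑ t ∈ Finset.range M, 1 / (t : ℝ) ^ 2 *
      ∑ n ∈ S, Real.cos (2 * Real.pi * t * (x n + α))| ≤ 2 * E + S.card / T := by
    intro M
    have hterm : ∀ t : ℕ, |1 / (t : ℝ) ^ 2 * ∑ n ∈ S, Real.cos (2 * Real.pi * t * (x n + α))| ≤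
        (if 1 ≤ t ∧ t ≤ T then ((t : ℝ) ^ 2)⁻¹ * E else 0) +
          (if T < t then ((t : ℝ) ^ 2)⁻¹ * S.card else 0) := by
      intro t
      rw [abs_mul, abs_of_nonneg (by positivity), one_div]
      rcases Nat.eq_zero_or_pos t with rfl | ht
      · simp
      rcases le_or_gt t T with h | h
      · rw [if_pos ⟨ht, h⟩, if_neg (by omega), add_zero]
        gcongr
        exact (abs_sum_cos_le t α).trans (hE t ht h)
      · rw [if_neg (by omega), if_pos h, zero_add]
        gcongr
        refine (Finset.abs_sum_le_sum_abs _ _).trans ?_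
        refine (Finset.sum_le_sum fun n _ => Real.abs_cos_le_one _).trans ?_
        simp
    refine (Finset.abs_sum_le_sum_abs _ _).trans ((Finset.sum_le_sum fun t _ => hterm t).trans ?_)
    rw [Finset.sum_add_distrib, ← Finset.sum_filter, ← Finset.sum_filter, ← Finset.sum_mul,
      ← Finset.sum_mul]
    have h1 : ∑ t ∈ Finset.range M with 1 ≤ t ∧ t ≤ T, ((t : ℝ) ^ 2)⁻¹ ≤ 2 := by
      calc _ ≤ ∑ t ∈ Finset.Icc 1 T, ((t : ℝ) ^ 2)⁻¹ := by
            refine Finset.sum_le_sum_of_subset_of_nonneg ?_ fun _ _ _ => by positivity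
            intro t ht
            simp at ht ⊢
            exact ht.2
        _ = 1 + ∑ t ∈ Finset.Ioc 1 T, ((t : ℝ) ^ 2)⁻¹ := by
            rw [← Finset.add_sum_Ioc_eq_sum_Icc hT]; simp
        _ ≤ 1 + ((1 : ℕ) : ℝ)⁻¹ := by
            gcongr
            refine (sum_Ioc_inv_sq_le_sub one_ne_zero hT).trans ?_
            have : (0 : ℝ) ≤ (T : ℝ)⁻¹ := by positivity
            linarith
        _ = 2 := by norm_num
    have h2 : ∑ t ∈ Finset.range M with T < t, ((t : ℝ) ^ 2)⁻¹ ≤ (T : ℝ)⁻¹ := by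
      calc _ ≤ ∑ t ∈ Finset.Ioc T (max M T), ((t : ℝ) ^ 2)⁻¹ := by
            refine Finset.sum_le_sum_of_subset_of_nonneg ?_ fun _ _ _ => by positivity
            intro t ht
            simp at ht ⊢
            omega
        _ ≤ _ := by
            refine (sum_Ioc_inv_sq_le_sub (by omega) (le_max_right _ _)).trans ?_
            have : (0 : ℝ) ≤ ((max M T : ℕ) : ℝ)⁻¹ := by positivity
            linarith
    rw [div_eq_inv_mul]
    gcongr
  have hlim := le_of_tendsto (hsum.tendsto_sum_nat.abs) (Eventually.of_forall hbound)
  rw [abs_mul, abs_of_pos (by positivity)] at hlim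
  have hpi : (2 : ℝ) ≤ Real.pi ^ 2 := by nlinarith [Real.pi_gt_three]
  have hN : 0 ≤ (S.card : ℝ) / T := by positivity
  have habs := abs_nonneg (∑ n ∈ S, bernoulliTwo (x n + α))
  nlinarith

/-- Difference quotients of `bernoulliTwo` with step `δ`: the discretization costs order `δ` per
point, and the bound on `bernoulliTwo` is divided by `δ`. -/
theorem abs_sum_fract_le (hT : 1 ≤ T) (hE0 : 0 ≤ E)
    (hE : ∀ t : ℕ, 1 ≤ t → t ≤ T → ‖∑ n ∈ S, expo (t * x n)‖ ≤ E) {δ : ℝ} (hδ0 : 0 < δ)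
    (hδ1 : δ ≤ 1) (α : ℝ) :
    |∑ n ∈ S, (Int.fract (x n + α) - 1 / 2)| ≤ S.card * δ / 2 + (E + S.card / T) / δ := by
  have hb := abs_sum_bernoulliTwo_le hT hE0 hE
  have h1 : ∑ n ∈ S, (bernoulliTwo (x n + (α + δ)) - bernoulliTwo (x n + α)) ≤
      ∑ n ∈ S, (2 * δ * (Int.fract (x n + α) - 1 / 2) + δ ^ 2) :=
    Finset.sum_le_sum fun n _ => by
      rw [← add_assoc]; exact bernoulliTwo_add_sub_le hδ0.le hδ1
  have h2 : ∑ n ∈ S, (2 * δ * (Int.fract (x n + α) - 1 / 2) - δ ^ 2) ≤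
      ∑ n ∈ S, (bernoulliTwo (x n + α) - bernoulliTwo (x n + (α - δ))) :=
    Finset.sum_le_sum fun n _ => by
      rw [← add_sub_assoc]; exact le_bernoulliTwo_sub hδ0.le hδ1
  rw [Finset.sum_sub_distrib, Finset.sum_add_distrib, ← Finset.mul_sum, Finset.sum_const,
    nsmul_eq_mul] at h1
  rw [Finset.sum_sub_distrib, Finset.sum_sub_distrib, ← Finset.mul_sum, Finset.sum_const,
    nsmul_eq_mul] at h2
  have b0 := abs_le.1 (hb α)
  have b1 := abs_le.1 (hb (α + δ))
  have b2 := abs_le.1 (hb (α - δ))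
  set Z := ∑ n ∈ S, (Int.fract (x n + α) - 1 / 2)
  set F := E + S.card / T
  have h3 : |Z| * (2 * δ) ≤ S.card * δ ^ 2 + 2 * F := by
    rw [← abs_of_pos (show 0 < 2 * δ by positivity), ← abs_mul, abs_le]
    constructor <;> linarith
  have h4 : (S.card * δ / 2 + F / δ) * (2 * δ) = S.card * δ ^ 2 + 2 * F := by
    field_simp
  rw [← h4] at h3
  exact le_of_mul_le_mul_right h3 (by positivity)

/-- The indicator of `fract x < c`, minus `c`, is the difference of the sawtooths at `x - c` and at
`x`. -/
theorem abs_card_fract_lt_sub_le (hT : 1 ≤ T) (hE0 : 0 ≤ E)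
    (hE : ∀ t : ℕ, 1 ≤ t → t ≤ T → ‖∑ n ∈ S, expo (t * x n)‖ ≤ E) {δ : ℝ} (hδ0 : 0 < δ)
    (hδ1 : δ ≤ 1) {c : ℝ} (hc0 : 0 ≤ c) (hc1 : c ≤ 1) :
    |((S.filter fun n => Int.fract (x n) < c).card : ℝ) - c * S.card| ≤
      S.card * δ + 2 * ((E + S.card / T) / δ) := by
  rcases hc1.eq_or_lt with rfl | hc1
  · have : (S.filter fun n => Int.fract (x n) < 1) = S :=
      Finset.filter_true_of_mem fun n _ => Int.fract_lt_one _
    rw [this, one_mul, sub_self, abs_zero]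
    positivity
  have h1 := abs_sum_fract_le hT hE0 hE hδ0 hδ1 (-c)
  have h2 := abs_sum_fract_le hT hE0 hE hδ0 hδ1 0
  have h3 : ((S.filter fun n => Int.fract (x n) < c).card : ℝ) - c * S.card =
      ∑ n ∈ S, (Int.fract (x n + -c) - 1 / 2) - ∑ n ∈ S, (Int.fract (x n + 0) - 1 / 2) := by
    rw [← Finset.sum_sub_distrib, Finset.card_filter, Nat.cast_sum, sub_eq_iff_eq_add,
      mul_comm c, ← nsmul_eq_mul, ← Finset.sum_const, ← Finset.sum_add_distrib]
    refine Finset.sum_congr rfl fun n _ => ?_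
    have hf0 := Int.fract_nonneg (x n)
    have hf1 := Int.fract_lt_one (x n)
    have hx := Int.self_sub_floor (x n)
    rw [add_zero]
    split_ifs with h
    · have : Int.fract (x n + -c) = Int.fract (x n) - c + 1 := by
        rw [Int.fract_eq_iff]
        exact ⟨by linarith, by linarith, ⌊x n⌋ - 1, by push_cast; linarith⟩
      rw [this]; push_cast; ring
    · have : Int.fract (x n + -c) = Int.fract (x n) - c := by
        rw [Int.fract_eq_iff]
        exact ⟨by linarith, by linarith, ⌊x n⌋, by linarith⟩
      rw [this]; push_cast; ring
  rw [h3]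
  refine (abs_sub _ _).trans ?_
  linarith

open Classical in
/-- A form of the Erdős–Turán inequality. -/
theorem abs_card_fract_mem_sub_le (hT : 1 ≤ T) (hE0 : 0 ≤ E)
    (hE : ∀ t : ℕ, 1 ≤ t → t ≤ T → ‖∑ n ∈ S, expo (t * x n)‖ ≤ E) {δ : ℝ} (hδ0 : 0 < δ)
    (hδ1 : δ ≤ 1) {I : Set ℝ} (hI : I ⊆ Set.Ico 0 1) (hc : I.OrdConnected) :
    |((S.filter fun n => Int.fract (x n) ∈ I).card : ℝ) -
        S.card * (MeasureTheory.volume I).toReal| ≤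
      3 * (S.card * δ) + 4 * ((E + S.card / T) / δ) := by
  have hB : 0 ≤ S.card * δ + 2 * ((E + S.card / T) / δ) := by positivity
  have hSδ : 0 ≤ S.card * δ := by positivity
  rcases I.eq_empty_or_nonempty with rfl | hne
  · simp only [Set.mem_empty_iff_false, Finset.filter_false, Finset.card_empty,
      MeasureTheory.measure_empty]
    simp
    linarith
  have hbb : BddBelow I := ⟨0, fun y hy => (hI hy).1⟩
  have hba : BddAbove I := ⟨1, fun y hy => (hI hy).2.le⟩
  set a := sInf I with ha
  set b := sSup I with hb
  have ha0 : 0 ≤ a := le_csInf hne fun y hy => (hI hy).1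
  have hb1 : b ≤ 1 := csSup_le hne fun y hy => (hI hy).2.le
  have hab : a ≤ b := csInf_le_csSup hne hbb hba
  have hsub1 : I ⊆ Set.Icc a b := fun y hy => ⟨csInf_le hbb hy, le_csSup hba hy⟩
  have hsub2 : Set.Ioo a b ⊆ I := by
    intro y hy
    obtain ⟨u, hu, huy⟩ := exists_lt_of_csInf_lt hne hy.1
    obtain ⟨v, hv, hyv⟩ := exists_lt_of_lt_csSup hne hy.2
    exact hc.out hu hv ⟨huy.le, hyv.le⟩
  have hvol : (MeasureTheory.volume I).toReal = b - a := by
    have h1 := MeasureTheory.measure_mono (μ := MeasureTheory.volume) hsub1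
    have h2 := MeasureTheory.measure_mono (μ := MeasureTheory.volume) hsub2
    rw [Real.volume_Icc] at h1
    rw [Real.volume_Ioo] at h2
    rw [le_antisymm h1 h2, ENNReal.toReal_ofReal (by linarith)]
  rw [hvol]
  have hcount := fun {c : ℝ} => abs_card_fract_lt_sub_le (c := c) hT hE0 hE hδ0 hδ1
  have hN : (0 : ℝ) ≤ S.card := by positivity
  rw [abs_le]
  constructor
  · rcases hab.eq_or_lt with h | h
    · rw [h, sub_self, mul_zero, sub_zero]
      have : (0 : ℝ) ≤ ((S.filter fun n => Int.fract (x n) ∈ I).card : ℝ) := by positivity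
      linarith
    -- The endpoint `a` need not belong to `I`, so everything below a cut slightly to its right is
    -- given up, at a cost of `δ`; the minimum with `b` keeps the cut within `[0,1]`.
    · have hmin : min b (a + δ) ≤ a + δ := min_le_right _ _
      have hmin' : a < min b (a + δ) := lt_min h (by linarith)
      have h1 := (abs_le.1 (hcount (c := b) (by linarith) hb1)).1
      have h2 := (abs_le.1 (hcount (c := min b (a + δ)) (by linarith)
        ((min_le_left _ _).trans hb1))).2
      have h3 : (S.filter fun n => Int.fract (x n) < b).card ≤
          (S.filter fun n => Int.fract (x n) ∈ I).card +
            (S.filter fun n => Int.fract (x n) < min b (a + δ)).card := by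
        rw [← Nat.cast_id (Finset.card _ + _)]
        refine (Finset.card_le_card (fun n hn => ?_)).trans (Finset.card_union_le _ _)
        rw [Finset.mem_union, Finset.mem_filter, Finset.mem_filter]
        obtain ⟨hnS, hn⟩ := Finset.mem_filter.1 hn
        rcases lt_or_ge (Int.fract (x n)) (min b (a + δ)) with h' | h'
        · exact Or.inr ⟨hnS, h'⟩
        · exact Or.inl ⟨hnS, hsub2 ⟨by linarith, hn⟩⟩
      have h3' : ((S.filter fun n => Int.fract (x n) < b).card : ℝ) ≤
          (S.filter fun n => Int.fract (x n) ∈ I).card +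
            (S.filter fun n => Int.fract (x n) < min b (a + δ)).card := by exact_mod_cast h3
      have h4 : min b (a + δ) * S.card ≤ (a + δ) * S.card :=
        mul_le_mul_of_nonneg_right hmin hN
      linarith
  -- If `b ∈ I`, a strict inequality at `b` would miss it, hence the cut slightly to its right.
  · have hb' : min 1 (b + δ) ≤ b + δ := min_le_right _ _
    have hb'' : b ≤ min 1 (b + δ) := le_min hb1 (by linarith)
    have h1 := (abs_le.1 (hcount (c := a) ha0 (by linarith))).1
    have h2 := (abs_le.1 (hcount (c := min 1 (b + δ)) (by linarith) (min_le_left _ _))).2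
    have h3 : (S.filter fun n => Int.fract (x n) ∈ I).card +
        (S.filter fun n => Int.fract (x n) < a).card ≤
          (S.filter fun n => Int.fract (x n) < min 1 (b + δ)).card := by
      rw [← Finset.card_union_of_disjoint]
      · refine Finset.card_le_card fun n hn => ?_
        rw [Finset.mem_union, Finset.mem_filter, Finset.mem_filter] at hn
        rw [Finset.mem_filter]
        rcases hn with ⟨hnS, hn⟩ | ⟨hnS, hn⟩
        · exact ⟨hnS, lt_min (hI hn).2 (by linarith [(hsub1 hn).2])⟩
        · exact ⟨hnS, by linarith⟩
      · rw [Finset.disjoint_filter]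
        intro n _ hn hlt
        linarith [(hsub1 hn).1]
    have h3' : ((S.filter fun n => Int.fract (x n) ∈ I).card : ℝ) +
        (S.filter fun n => Int.fract (x n) < a).card ≤
          (S.filter fun n => Int.fract (x n) < min 1 (b + δ)).card := by exact_mod_cast h3
    have h4 : min 1 (b + δ) * S.card ≤ (b + δ) * S.card :=
      mul_le_mul_of_nonneg_right hb' hN
    linarith

end

open Classical in
theorem ncard_fract_mem (x : ℕ → ℝ) (N : ℕ) (I : Set ℝ) :
    {n : ℕ | 1 ≤ n ∧ n ≤ N ∧ Int.fract (x n) ∈ I}.ncard =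
      ((Finset.Icc 1 N).filter fun n => Int.fract (x n) ∈ I).card := by
  rw [← Set.ncard_coe_finset]
  congr 1
  ext n
  simp [and_assoc]

/-- The discrepancy at `N`, from exponential sums up to `N' ≤ N`. -/
theorem discrepancy_le (x : ℕ → ℝ) {N' N T : ℕ} (hN : 1 ≤ N) (hN' : N' ≤ N) (hT : 1 ≤ T) {E : ℝ}
    (hE0 : 0 ≤ E)
    (hE : ∀ t : ℕ, 1 ≤ t → t ≤ T → ‖∑ n ∈ Finset.Icc 1 N', expo (t * x n)‖ ≤ E) {δ : ℝ}
    (hδ0 : 0 < δ) (hδ1 : δ ≤ 1) :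
    discrepancy x N ≤ 3 * δ + 4 * (E / N + 1 / T) / δ + ((N : ℝ) - N') / N := by
  classical
  have hNpos : (0 : ℝ) < N := by exact_mod_cast hN
  have hTpos : (0 : ℝ) < T := by exact_mod_cast hT
  have hNN : (N' : ℝ) ≤ N := by exact_mod_cast hN'
  refine csSup_le ⟨_, ∅, by simp, Set.ordConnected_empty, rfl⟩ ?_
  rintro _ ⟨I, hI, hc, rfl⟩
  rw [ncard_fract_mem]
  have h1 := abs_card_fract_mem_sub_le hT hE0 hE hδ0 hδ1 hI hc
  rw [Nat.card_Icc, Nat.add_sub_cancel] at h1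
  set v := (MeasureTheory.volume I).toReal
  have hv0 : 0 ≤ v := ENNReal.toReal_nonneg
  have hv1 : v ≤ 1 := by
    have := MeasureTheory.measure_mono (μ := MeasureTheory.volume) hI
    rw [Real.volume_Ico] at this
    have := ENNReal.toReal_mono (by simp) this
    simpa using this
  set A := ((Finset.Icc 1 N).filter fun n => Int.fract (x n) ∈ I).card
  set A' := ((Finset.Icc 1 N').filter fun n => Int.fract (x n) ∈ I).card
  have hAA : A' ≤ A := Finset.card_le_card
    (Finset.filter_subset_filter _ (Finset.Icc_subset_Icc_right hN'))
  have hAA' : A ≤ A' + (N - N') := by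
    have h2 : Finset.Icc 1 N ⊆ Finset.Icc 1 N' ∪ Finset.Ioc N' N := by
      intro n hn
      simp at hn ⊢
      omega
    have h3 := Finset.card_le_card (Finset.filter_subset_filter (fun n => Int.fract (x n) ∈ I) h2)
    rw [Finset.filter_union] at h3
    have h4 := Finset.card_filter_le (Finset.Ioc N' N) (fun n => Int.fract (x n) ∈ I)
    rw [Nat.card_Ioc] at h4
    exact h3.trans ((Finset.card_union_le _ _).trans (by omega))
  have a1 : (A' : ℝ) ≤ A := by exact_mod_cast hAA
  have a2 : (A : ℝ) ≤ A' + (N - N') := by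
    rw [← Nat.cast_sub hN']; exact_mod_cast hAA'
  have h5 : |(A : ℝ) - N * v| ≤ 3 * (N' * δ) + 4 * ((E + N' / T) / δ) + (N - N') := by
    have h6 := abs_le.1 h1
    have h7 : 0 ≤ (N - N' : ℝ) * v := mul_nonneg (by linarith) hv0
    have h8 : (N - N' : ℝ) * v ≤ N - N' := mul_le_of_le_one_right (by linarith) hv1
    rw [abs_le]
    constructor <;> linarith
  have h6 : |(A : ℝ) / N - v| = |(A : ℝ) - N * v| / N := by
    rw [← abs_of_pos hNpos, ← abs_div, abs_of_pos hNpos]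
    congr 1
    field_simp
  rw [h6, div_le_iff₀ hNpos]
  refine h5.trans ?_
  have h7 : (3 * δ + 4 * (E / N + 1 / T) / δ + ((N : ℝ) - N') / N) * N =
      3 * (N * δ) + 4 * ((E + N / T) / δ) + (N - N') := by
    field_simp
  rw [h7]
  gcongr

theorem abs_ncard_div_sub_le_discrepancy (x : ℕ → ℝ) (N : ℕ) {I : Set ℝ} (hI : I ⊆ Set.Ico 0 1)
    (hc : I.OrdConnected) :
    |(({n : ℕ | 1 ≤ n ∧ n ≤ N ∧ Int.fract (x n) ∈ I}.ncard : ℝ) / N) -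
      (MeasureTheory.volume I).toReal| ≤ discrepancy x N := by
  classical
  refine le_csSup ⟨1, ?_⟩ ⟨I, hI, hc, rfl⟩
  rintro _ ⟨J, hJ, -, rfl⟩
  rw [ncard_fract_mem]
  have hv0 : 0 ≤ (MeasureTheory.volume J).toReal := ENNReal.toReal_nonneg
  have hv1 : (MeasureTheory.volume J).toReal ≤ 1 := by
    have := MeasureTheory.measure_mono (μ := MeasureTheory.volume) hJ
    rw [Real.volume_Ico] at this
    have := ENNReal.toReal_mono (by simp) this
    simpa using this
  have h1 : (((Finset.Icc 1 N).filter fun n => Int.fract (x n) ∈ J).card : ℝ) / N ≤ 1 := by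
    refine div_le_one_of_le₀ ?_ (by positivity)
    have := Finset.card_filter_le (Finset.Icc 1 N) (fun n => Int.fract (x n) ∈ J)
    rw [Nat.card_Icc, Nat.add_sub_cancel] at this
    exact_mod_cast this
  have h2 : 0 ≤ (((Finset.Icc 1 N).filter fun n => Int.fract (x n) ∈ J).card : ℝ) / N := by
    positivity
  rw [abs_le]
  constructor <;> linarith

/-! ### Normality -/

/-- The first `k` digits of `z` determine `⌊b^k z⌋` modulo `b^k`. -/
theorem exists_digits_iff (b : ℕ) (hb : 2 ≤ b) (k : ℕ) (w : Fin k → ℕ) (hw : ∀ i, w i < b) :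
    ∃ W : ℕ, W < b ^ k ∧ ∀ z : ℝ,
      (∀ i : Fin k, ⌊(b : ℝ) ^ ((i : ℕ) + 1) * z⌋ % (b : ℤ) = w i) ↔
        ⌊(b : ℝ) ^ k * z⌋ % ((b : ℤ) ^ k) = W := by
  induction k with
  | zero => exact ⟨0, by simp, fun z => by simp⟩
  | succ k ih =>
    obtain ⟨W, hW, h⟩ := ih (fun i => w i.castSucc) fun i => hw _
    have hbz : (0 : ℤ) < b := by omega
    refine ⟨b * W + w (Fin.last k), ?_, fun z => ?_⟩
    · have := hw (Fin.last k)
      rw [pow_succ]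
      nlinarith
    · rw [Fin.forall_fin_succ']
      simp only [Fin.val_castSucc, Fin.val_last]
      rw [h z]
      set q := ⌊(b : ℝ) ^ (k + 1) * z⌋ with hq
      have hq' : ⌊(b : ℝ) ^ k * z⌋ = q / b := by
        rw [hq, ← Int.floor_div_natCast]
        congr 1
        have : (b : ℝ) ≠ 0 := by positivity
        field_simp
        ring
      rw [hq']
      have h1 : q % (b : ℤ) ^ (k + 1) = b * ((q / b) % (b : ℤ) ^ k) + q % b := by
        have hB : (0 : ℤ) < (b : ℤ) ^ k := by positivity
        have e1 := Int.mul_ediv_add_emod q b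
        have e2 := Int.mul_ediv_add_emod (q / b) ((b : ℤ) ^ k)
        have e3 := Int.emod_nonneg (q / b) hB.ne'
        have e4 := Int.emod_lt_of_pos (q / b) hB
        have e5 := Int.emod_nonneg q hbz.ne'
        have e6 := Int.emod_lt_of_pos q hbz
        have e7 : q = b * ((q / b) % (b : ℤ) ^ k) + q % b +
            (b : ℤ) ^ (k + 1) * (q / b / (b : ℤ) ^ k) := by
          rw [pow_succ']
          linear_combination -e1 - b * e2
        conv_lhs => rw [e7]
        rw [Int.add_mul_emod_self_left, Int.emod_eq_of_lt (by positivity)]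
        rw [pow_succ']
        nlinarith
      rw [h1]
      push_cast
      have h2 := Int.emod_nonneg q hbz.ne'
      have h3 := Int.emod_lt_of_pos q hbz
      have h4 : ((w (Fin.last k) : ℕ) : ℤ) < b := by exact_mod_cast hw (Fin.last k)
      constructor
      · rintro ⟨h5, h6⟩
        rw [h5, h6]
      · intro h5
        have h7 : (q / b) % (b : ℤ) ^ k = W := by
          have e1 := congrArg (· / (b : ℤ)) h5
          simp only [Int.add_comm ((b : ℤ) * _)] at e1
          rw [Int.add_mul_ediv_left _ _ hbz.ne', Int.add_mul_ediv_left _ _ hbz.ne',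
            Int.ediv_eq_zero_of_lt h2 h3, Int.ediv_eq_zero_of_lt (by positivity) h4] at e1
          linarith
        exact ⟨h7, by rw [h7] at h5; linarith⟩

theorem floor_pow_mul_emod_eq_iff (m W : ℕ) (hm : 0 < m) (z : ℝ) :
    ⌊(m : ℝ) * z⌋ % (m : ℤ) = W ↔
      Int.fract z ∈ Set.Ico ((W : ℝ) / m) ((W + 1 : ℝ) / m) := by
  have hm0 : (0 : ℝ) < m := by exact_mod_cast hm
  have h1 : ⌊(m : ℝ) * z⌋ = ⌊(m : ℝ) * Int.fract z⌋ + m * ⌊z⌋ := by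
    rw [← Int.floor_add_intCast]
    congr 1
    push_cast
    rw [← mul_add, Int.fract_add_floor]
  have h2 : 0 ≤ ⌊(m : ℝ) * Int.fract z⌋ :=
    Int.floor_nonneg.2 (by have := Int.fract_nonneg z; positivity)
  have h3 : ⌊(m : ℝ) * Int.fract z⌋ < m := by
    rw [Int.floor_lt]
    push_cast
    have := Int.fract_lt_one z
    nlinarith
  rw [h1, Int.add_mul_emod_self_left, Int.emod_eq_of_lt h2 h3, Int.floor_eq_iff, Set.mem_Ico,
    div_le_iff₀ hm0, lt_div_iff₀ hm0, mul_comm]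
  push_cast
  rfl

/-- A digit block of length `k` occurs at position `n` exactly when `fract (b^n ξ)` lies in one
fixed `b`-adic interval of length `b^(-k)`. -/
theorem isNormalTo_of_tendsto_discrepancy (b : ℕ) (hb : 2 ≤ b) (ξ : ℝ)
    (h : Tendsto (fun N => discrepancy (fun n => (b : ℝ) ^ n * ξ) N) atTop (𝓝 0)) :
    IsNormalTo b ξ := by
  classical
  intro k hk w hw
  obtain ⟨W, hW, hiff⟩ := exists_digits_iff b hb k w hw
  have hbk : (0 : ℝ) < (b : ℝ) ^ k := by positivity
  set I : Set ℝ := Set.Ico ((W : ℝ) / (b : ℝ) ^ k) ((W + 1 : ℝ) / (b : ℝ) ^ k) with hIdef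
  have hdig : ∀ n : ℕ, (∀ i : Fin k, baseDigit b ξ (n + i) = (w i : ℤ)) ↔
      Int.fract ((b : ℝ) ^ n * ξ) ∈ I := by
    intro n
    have h1 := floor_pow_mul_emod_eq_iff (b ^ k) W (by positivity) ((b : ℝ) ^ n * ξ)
    push_cast at h1
    rw [hIdef, ← h1, ← hiff]
    refine forall_congr' fun i => ?_
    rw [baseDigit, ← mul_assoc, ← pow_add, show n + (i : ℕ) + 1 = i + 1 + n by ring]
  have hI : I ⊆ Set.Ico 0 1 := by
    refine Set.Ico_subset_Ico (by positivity) ?_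
    rw [div_le_one hbk]
    exact_mod_cast hW
  have hvol : (MeasureTheory.volume I).toReal = 1 / (b : ℝ) ^ k := by
    rw [hIdef, Real.volume_Ico, ENNReal.toReal_ofReal] <;> rw [← sub_div] <;> ring_nf
    positivity
  simp only [hdig]
  set A : ℕ → ℝ := fun N =>
    ({n : ℕ | 1 ≤ n ∧ n ≤ N ∧ Int.fract ((b : ℝ) ^ n * ξ) ∈ I}.ncard : ℝ) with hA
  have h1 : Tendsto (fun N => A N / N) atTop (𝓝 (1 / (b : ℝ) ^ k)) := by
    rw [tendsto_iff_norm_sub_tendsto_zero]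
    refine squeeze_zero (fun _ => norm_nonneg _) (fun N => ?_) h
    rw [Real.norm_eq_abs, ← hvol]
    exact abs_ncard_div_sub_le_discrepancy (fun n => (b : ℝ) ^ n * ξ) N hI Set.ordConnected_Ico
  -- Digit positions start at 0 while the discrepancy counts `1 ≤ n ≤ N`; the two counts differ by
  -- at most 1.
  have h2 : Tendsto (fun N : ℕ => (({n : ℕ | n < N ∧ Int.fract ((b : ℝ) ^ n * ξ) ∈ I}.ncard : ℝ)
      - A N) / N) atTop (𝓝 0) := by
    refine squeeze_zero_norm (a := fun N : ℕ => 1 / (N : ℝ)) (fun N => ?_)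
      tendsto_one_div_atTop_nhds_zero_nat
    rw [Real.norm_eq_abs, abs_div, Nat.abs_cast]
    gcongr
    have hfin1 : {n : ℕ | n < N ∧ Int.fract ((b : ℝ) ^ n * ξ) ∈ I}.Finite :=
      (Set.finite_lt_nat N).subset fun n hn => hn.1
    have hfin2 : {n : ℕ | 1 ≤ n ∧ n ≤ N ∧ Int.fract ((b : ℝ) ^ n * ξ) ∈ I}.Finite :=
      (Set.finite_le_nat N).subset fun n hn => hn.2.1
    have c1 : {n : ℕ | n < N ∧ Int.fract ((b : ℝ) ^ n * ξ) ∈ I}.ncard ≤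
        {n : ℕ | 1 ≤ n ∧ n ≤ N ∧ Int.fract ((b : ℝ) ^ n * ξ) ∈ I}.ncard + 1 := by
      refine (Set.ncard_le_ncard ?_ (hfin2.insert 0)).trans (Set.ncard_insert_le 0 _)
      rintro n ⟨hn, hn'⟩
      rcases Nat.eq_zero_or_pos n with rfl | h0
      · exact Or.inl rfl
      · exact Or.inr ⟨h0, hn.le, hn'⟩
    have c2 : {n : ℕ | 1 ≤ n ∧ n ≤ N ∧ Int.fract ((b : ℝ) ^ n * ξ) ∈ I}.ncard ≤
        {n : ℕ | n < N ∧ Int.fract ((b : ℝ) ^ n * ξ) ∈ I}.ncard + 1 := by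
      refine (Set.ncard_le_ncard ?_ (hfin1.insert N)).trans (Set.ncard_insert_le N _)
      rintro n ⟨-, hn, hn'⟩
      rcases hn.eq_or_lt with rfl | h0
      · exact Or.inl rfl
      · exact Or.inr ⟨h0, hn'⟩
    have c1' : ({n : ℕ | n < N ∧ Int.fract ((b : ℝ) ^ n * ξ) ∈ I}.ncard : ℝ) ≤ A N + 1 := by
      have := (Nat.cast_le (α := ℝ)).2 c1
      rwa [Nat.cast_add, Nat.cast_one] at this
    have c2' : A N ≤ ({n : ℕ | n < N ∧ Int.fract ((b : ℝ) ^ n * ξ) ∈ I}.ncard : ℝ) + 1 := by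
      have := (Nat.cast_le (α := ℝ)).2 c2
      rwa [Nat.cast_add, Nat.cast_one] at this
    rw [abs_le]
    constructor <;> linarith
  have h3 := h1.add h2
  rw [add_zero] at h3
  refine h3.congr fun N => ?_
  ring

/-! ### Averages over the candidates -/

theorem norm_one_add_expo (w : ℝ) : ‖1 + expo w‖ = 2 * |Real.cos (Real.pi * w)| := by
  have h : (1 : ℂ) + expo w = expo (w / 2) * ((2 * Real.cos (Real.pi * w) : ℝ) : ℂ) := by
    rw [expo, expo]
    push_cast
    rw [Complex.two_cos, mul_add, ← Complex.exp_add, ← Complex.exp_add]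
    rw [add_comm]
    congr 1
    · congr 1; ring
    · rw [← Complex.exp_zero]; congr 1; ring
  rw [h, norm_mul, norm_expo, one_mul, Complex.norm_real, Real.norm_eq_abs, abs_mul, abs_two]

theorem expo_zero : expo 0 = 1 := by simp [expo]

theorem expo_sum {ι : Type*} (T : Finset ι) (f : ι → ℝ) :
    expo (∑ k ∈ T, f k) = ∏ k ∈ T, expo (f k) := by
  classical
  induction T using Finset.induction_on with
  | empty => simp [expo_zero]
  | insert k T hk ih => rw [Finset.sum_insert hk, Finset.prod_insert hk, expo_add, ih]

/-- A candidate is encoded by the set of positions where its digit is 1, so the sum over candidates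
factors as `∏ (1 + e(x/s^k))`. -/
theorem norm_sum_powerset_expo (A : Finset ℕ) (s : ℕ) (η x : ℝ) :
    ‖∑ T ∈ A.powerset, expo (x * (η + ∑ k ∈ T, 1 / (s : ℝ) ^ k))‖ =
      2 ^ A.card * ∏ k ∈ A, |Real.cos (Real.pi * x / s ^ k)| := by
  have h : ∀ T ∈ A.powerset, expo (x * (η + ∑ k ∈ T, 1 / (s : ℝ) ^ k)) =
      expo (x * η) * ∏ k ∈ T, expo (x / s ^ k) := by
    intro T _
    rw [mul_add, expo_add, Finset.mul_sum, expo_sum]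
    simp only [mul_one_div]
  rw [Finset.sum_congr rfl h, ← Finset.mul_sum, ← Finset.prod_one_add, norm_mul, norm_expo,
    one_mul, norm_prod, ← Finset.prod_const, ← Finset.prod_mul_distrib]
  refine Finset.prod_congr rfl fun k _ => ?_
  rw [norm_one_add_expo, mul_div_assoc]

theorem conj_expo (x : ℝ) : (starRingEnd ℂ) (expo x) = expo (-x) := by
  rw [expo, expo, ← Complex.exp_conj]
  simp [Complex.conj_ofNat]

theorem norm_sq_sum_expo (B : Finset ℕ) (f : ℕ → ℝ) (y : ℝ) :
    ‖∑ j ∈ B, expo (f j * y)‖ ^ 2 = ∑ j ∈ B, ∑ g ∈ B, (expo ((f j - f g) * y)).re := by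
  have h : ((‖∑ j ∈ B, expo (f j * y)‖ ^ 2 : ℝ) : ℂ) =
      ∑ j ∈ B, ∑ g ∈ B, expo ((f j - f g) * y) := by
    push_cast
    rw [← Complex.mul_conj', map_sum, Finset.sum_mul_sum]
    refine Finset.sum_congr rfl fun j _ => Finset.sum_congr rfl fun g _ => ?_
    rw [conj_expo, ← expo_add]
    congr 1
    ring
  rw [← Complex.ofReal_re (‖∑ j ∈ B, expo (f j * y)‖ ^ 2), h]
  simp only [Complex.re_sum]

theorem sum_powerset_norm_sq_le (A B : Finset ℕ) (s : ℕ) (η : ℝ) (f : ℕ → ℝ) :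
    ∑ T ∈ A.powerset, ‖∑ j ∈ B, expo (f j * (η + ∑ k ∈ T, 1 / (s : ℝ) ^ k))‖ ^ 2 ≤
      2 ^ A.card * ∑ j ∈ B, ∑ g ∈ B, ∏ k ∈ A, |Real.cos (Real.pi * (f j - f g) / s ^ k)| := by
  simp only [norm_sq_sum_expo]
  rw [Finset.sum_comm, Finset.mul_sum]
  refine Finset.sum_le_sum fun j _ => ?_
  rw [Finset.sum_comm, Finset.mul_sum]
  refine Finset.sum_le_sum fun g _ => ?_
  rw [← norm_sum_powerset_expo A s η, ← Complex.re_sum]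
  exact Complex.re_le_norm _

/-- The positions of the free digits at step `m`. -/
noncomputable def digitRange (σ : ℕ → ℕ) (m : ℕ) : Finset ℕ :=
  Finset.Icc (angb σ m (σ m) + 1) (angb σ (m + 1) (σ m) - 2)

theorem add_sum_mem_candidates (σ : ℕ → ℕ) (m : ℕ) (x : ℝ) {T : Finset ℕ}
    (hT : T ⊆ digitRange σ m) :
    eta σ m x + ∑ k ∈ T, 1 / (σ m : ℝ) ^ k ∈ candidates σ m x := by
  classical
  refine ⟨fun k => if k ∈ T then 1 else 0, fun k => by by_cases h : k ∈ T <;> simp [h], ?_⟩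
  change _ = eta σ m x + ∑ k ∈ digitRange σ m, _
  rw [← Finset.sum_subset hT]
  · congr 1
    refine Finset.sum_congr rfl fun k hk => by simp [hk]
  · intro k _ hk
    simp [hk]

/-- The minimum is at most the mean over all `2^|A|` digit choices, and `sum_powerset_norm_sq_le`
bounds that mean. -/
theorem weylSum_xi_le (ρ σ m₀ : ℕ → ℕ) (m : ℕ) :
    weylSum ρ σ m₀ (m + 1) (xi ρ σ m₀ (m + 1)) ≤
      ∑ t ∈ (Finset.Icc (-((m + 1 : ℕ) : ℤ)) (m + 1 : ℕ)).erase 0,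
        ∑ i ∈ (Finset.Icc 1 (m + 1)).filter (fun i => m₀ (ρ i) ≤ m + 1),
          ∑ j ∈ Finset.Ioc (angb σ (m + 1) (ρ i)) (angb σ (m + 2) (ρ i)),
            ∑ g ∈ Finset.Ioc (angb σ (m + 1) (ρ i)) (angb σ (m + 2) (ρ i)),
              ∏ k ∈ digitRange σ (m + 1),
                |Real.cos (Real.pi * ((ρ i : ℝ) ^ j * t - (ρ i : ℝ) ^ g * t) /
                  (σ (m + 1) : ℝ) ^ k)| := by
  set A := digitRange σ (m + 1) with hA
  set ξ₀ := xi ρ σ m₀ m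
  set W := weylSum ρ σ m₀ (m + 1)
  have hmin := (isLeast_xi ρ σ m₀ m).1.2
  have h1 : (2 : ℝ) ^ A.card * W (xi ρ σ m₀ (m + 1)) ≤
      ∑ T ∈ A.powerset, W (eta σ (m + 1) ξ₀ + ∑ k ∈ T, 1 / (σ (m + 1) : ℝ) ^ k) := by
    calc (2 : ℝ) ^ A.card * W (xi ρ σ m₀ (m + 1)) =
        ∑ T ∈ A.powerset, W (xi ρ σ m₀ (m + 1)) := by simp
      _ ≤ _ := Finset.sum_le_sum fun T hT =>
        hmin _ (add_sum_mem_candidates σ (m + 1) ξ₀ (Finset.mem_powerset.1 hT))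
  refine le_of_mul_le_mul_left (h1.trans ?_) (show (0 : ℝ) < 2 ^ A.card by positivity)
  simp only [W, weylSum]
  rw [Finset.sum_comm, Finset.mul_sum]
  refine Finset.sum_le_sum fun t _ => ?_
  rw [Finset.sum_comm, Finset.mul_sum]
  refine Finset.sum_le_sum fun i _ => ?_
  exact sum_powerset_norm_sq_le A _ (σ (m + 1)) _ fun j => (ρ i : ℝ) ^ j * t

/-! ### Bounding the averages -/

theorem cosProd_neg (s : ℕ) (x : ℝ) : cosProd s (-x) = cosProd s x := by
  refine tprod_congr fun k => ?_
  rw [mul_neg, neg_div, Real.cos_neg]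

theorem half_le_prod_abs_cos (s : ℕ) (hs : 3 ≤ s) (v : ℕ → ℝ)
    (hv : ∀ k, |v k| * 4 * (s : ℝ) ^ k ≤ Real.pi) (n : ℕ) :
    1 / 2 ≤ ∏ k ∈ Finset.range n, |Real.cos (v k)| := by
  -- The losses `v k ^ 2 / 2 ≤ (5/16) 9^(-k)` form a geometric series of sum below 2/5; the
  -- strengthened form carries its partial sums through the induction.
  have key : 1 - 2 / 5 * (1 - 1 / (9 : ℝ) ^ n) ≤ ∏ k ∈ Finset.range n, |Real.cos (v k)| := by
    induction n with
    | zero => simp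
    | succ n ih =>
      rw [Finset.prod_range_succ]
      set P := ∏ k ∈ Finset.range n, |Real.cos (v k)|
      have hP0 : 0 ≤ P := Finset.prod_nonneg fun _ _ => abs_nonneg _
      have hP1 : P ≤ 1 := Finset.prod_le_one (fun _ _ => abs_nonneg _) fun _ _ =>
        Real.abs_cos_le_one _
      have h1 : 1 - v n ^ 2 / 2 ≤ |Real.cos (v n)| :=
        (Real.one_sub_sq_div_two_le_cos).trans (le_abs_self _)
      have hs9 : (9 : ℝ) ^ n ≤ ((s : ℝ) ^ n) ^ 2 := by
        rw [← pow_mul, mul_comm, pow_mul]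
        have : (3 : ℝ) ≤ s := by exact_mod_cast hs
        gcongr
        nlinarith
      have h9 : (0 : ℝ) < 9 ^ n := by positivity
      have h2 : v n ^ 2 * 16 * 9 ^ n ≤ 10 := by
        have hpi : Real.pi ^ 2 ≤ 10 := by nlinarith [Real.pi_lt_d2, Real.pi_pos]
        have h3 : (|v n| * 4 * (s : ℝ) ^ n) ^ 2 ≤ Real.pi ^ 2 :=
          pow_le_pow_left₀ (by positivity) (hv n) 2
        rw [mul_pow, mul_pow, sq_abs] at h3
        nlinarith [sq_nonneg (v n)]
      have h4 : v n ^ 2 / 2 ≤ 5 / 16 * (1 / 9 ^ n) := by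
        rw [mul_one_div, le_div_iff₀ h9]
        linarith
      have h5 : (1 : ℝ) / 9 ^ (n + 1) = 1 / 9 * (1 / 9 ^ n) := by rw [pow_succ]; field_simp
      have h6 : (0 : ℝ) < 1 / 9 ^ n := by positivity
      rw [h5]
      have h7 : P - v n ^ 2 / 2 ≤ P * |Real.cos (v n)| := by nlinarith [sq_nonneg (v n)]
      linarith
  have : (0 : ℝ) < 1 / 9 ^ n := by positivity
  linarith

/-- The infinite product has extra factors only at positions `k ≥ b - 1`. By the size condition on
`x` their angles start at no more than `π/4` and decay geometrically, so together they are at least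
1/2. -/
theorem prod_le_two_mul_cosProd (s : ℕ) (hs : 3 ≤ s) (a b : ℕ) (x : ℝ)
    (hx : 4 * |x| ≤ (s : ℝ) ^ (b - 1)) :
    ∏ k ∈ Finset.Icc (a + 1) (b - 2), |Real.cos (Real.pi * x / s ^ k)| ≤
      2 * cosProd s (x / (s : ℝ) ^ a) := by
  have hs0 : (0 : ℝ) < s := by positivity
  have hs1 : (1 : ℝ) ≤ s := by exact_mod_cast (by omega : 1 ≤ s)
  set M := b - 2 - a with hM
  have hA : ∏ k ∈ Finset.Icc (a + 1) (b - 2), |Real.cos (Real.pi * x / s ^ k)| =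
      ∏ k ∈ Finset.range M, |Real.cos (Real.pi * x / s ^ (a + k + 1))| := by
    rw [← Finset.Ico_succ_right_eq_Icc, Finset.prod_Ico_eq_prod_range]
    have : Order.succ (b - 2) - (a + 1) = M := by
      rw [Nat.succ_eq_succ]
      omega
    rw [this]
    refine Finset.prod_congr rfl fun k _ => ?_
    rw [show a + 1 + k = a + k + 1 by ring]
  have hterm : ∀ k : ℕ, Real.pi * (x / (s : ℝ) ^ a) / s ^ (k + 1) =
      Real.pi * x / s ^ (a + k + 1) := by
    intro k
    rw [pow_succ, pow_succ, pow_add]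
    field_simp
  have hlow : (1 / 2) * ∏ k ∈ Finset.range M, |Real.cos (Real.pi * x / s ^ (a + k + 1))| ≤
      cosProd s (x / (s : ℝ) ^ a) := by
    rw [cosProd]
    simp only [hterm]
    refine le_tprod_of_mem_unit (fun _ => abs_nonneg _) (fun _ => Real.abs_cos_le_one _) fun n => ?_
    refine le_trans ?_ (antitone_prod_of_mem_unit
      (f := fun k => |Real.cos (Real.pi * x / s ^ (a + k + 1))|)
      (fun _ => abs_nonneg _) (fun _ => Real.abs_cos_le_one _)
      (Finset.range_mono (show n ≤ M + n by omega)))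
    simp only
    rw [Finset.prod_range_add, mul_comm]
    refine mul_le_mul_of_nonneg_left ?_ (Finset.prod_nonneg fun _ _ => abs_nonneg _)
    refine half_le_prod_abs_cos s hs (fun k => Real.pi * x / s ^ (a + (M + k) + 1)) (fun k => ?_) n
    rw [abs_div, abs_mul, abs_of_pos Real.pi_pos, abs_of_pos (show (0 : ℝ) < s ^ (a + (M + k) + 1) by
      positivity), div_mul_eq_mul_div, div_mul_eq_mul_div, div_le_iff₀ (by positivity)]
    have h1 : (s : ℝ) ^ (b - 1) * (s : ℝ) ^ k ≤ (s : ℝ) ^ (a + (M + k) + 1) := by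
      rw [← pow_add]
      exact pow_le_pow_right₀ hs1 (by omega)
    have h2 : (4 * |x|) * (s : ℝ) ^ k ≤ (s : ℝ) ^ (b - 1) * (s : ℝ) ^ k := by gcongr
    have := Real.pi_pos
    nlinarith
  rw [hA]
  linarith

/-- Diagonal plus twice one triangle, the triangle being summed along the lines `j - g = h`. -/
theorem sum_Ioc_symm_le (u : ℕ → ℕ → ℝ) (hsymm : ∀ j g, u j g = u g j)
    (h1 : ∀ j g, u j g ≤ 1) (J₀ J₁ : ℕ) {R : ℝ}
    (hR : ∀ h, 1 ≤ h → ∑ g ∈ Finset.range (J₁ - J₀),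
      (if g + h < J₁ - J₀ then u (J₀ + 1 + g + h) (J₀ + 1 + g) else 0) ≤ R) :
    ∑ j ∈ Finset.Ioc J₀ J₁, ∑ g ∈ Finset.Ioc J₀ J₁, u j g ≤
      ((J₁ - J₀ : ℕ) : ℝ) + 2 * ((J₁ - J₀ : ℕ) * R) := by
  set n := J₁ - J₀ with hn
  have hIoc : ∀ f : ℕ → ℝ, ∑ j ∈ Finset.Ioc J₀ J₁, f j = ∑ i ∈ Finset.range n, f (J₀ + 1 + i) := by
    intro f
    have : Finset.Ioc J₀ J₁ = Finset.Ico (J₀ + 1) (J₁ + 1) := by ext; simp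
    rw [this, Finset.sum_Ico_eq_sum_range]
    congr 2
    omega
  simp only [hIoc]
  set v : ℕ → ℕ → ℝ := fun a b => u (J₀ + 1 + a) (J₀ + 1 + b) with hv
  have hsplit : ∀ a b, v a b ≤ (if a = b then 1 else 0) + (if b < a then v a b else 0) +
      (if a < b then v b a else 0) := by
    intro a b
    rcases lt_trichotomy a b with h | rfl | h
    · rw [if_neg h.ne, if_neg h.not_gt, if_pos h, hv]
      simp only
      rw [hsymm]; simp
    · simp [hv, h1]
    · rw [if_neg h.ne', if_pos h, if_neg h.not_gt]; simp
  have hlow : ∑ b ∈ Finset.range n, ∑ a ∈ Finset.range n, (if b < a then v a b else 0) ≤ n * R := by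
    have hinner : ∀ b ∈ Finset.range n, ∑ a ∈ Finset.range n, (if b < a then v a b else 0) ≤
        ∑ i ∈ Finset.range n, (if b + (i + 1) < n then v (b + (i + 1)) b else 0) := by
      intro b _
      rw [← Finset.sum_filter]
      have : Finset.filter (fun a => b < a) (Finset.range n) = Finset.Ico (b + 1) n := by
        ext; simp; omega
      rw [this, Finset.sum_Ico_eq_sum_range, ← Finset.sum_filter]
      have h2 : Finset.range (n - (b + 1)) =
          Finset.filter (fun i => b + (i + 1) < n) (Finset.range n) := by
        ext; simp; omega
      rw [h2]
      refine le_of_eq (Finset.sum_congr rfl fun i _ => ?_)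
      rw [show b + 1 + i = b + (i + 1) by ring]
    refine (Finset.sum_le_sum hinner).trans ?_
    rw [Finset.sum_comm]
    refine (Finset.sum_le_sum fun i _ => ?_).trans (by simp : ∑ i ∈ Finset.range n, R ≤ n * R)
    refine le_trans (le_of_eq ?_) (hR (i + 1) (by omega))
    refine Finset.sum_congr rfl fun b _ => ?_
    simp only [hv]
    rw [show J₀ + 1 + (b + (i + 1)) = J₀ + 1 + b + (i + 1) by ring]
  calc ∑ a ∈ Finset.range n, ∑ b ∈ Finset.range n, v a b
      ≤ ∑ a ∈ Finset.range n, ∑ b ∈ Finset.range n, ((if a = b then 1 else 0) +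
          (if b < a then v a b else 0) + (if a < b then v b a else 0)) :=
        Finset.sum_le_sum fun a _ => Finset.sum_le_sum fun b _ => hsplit a b
    _ = ∑ a ∈ Finset.range n, ∑ b ∈ Finset.range n, (if a = b then (1 : ℝ) else 0) +
        ∑ b ∈ Finset.range n, ∑ a ∈ Finset.range n, (if b < a then v a b else 0) +
        ∑ a ∈ Finset.range n, ∑ b ∈ Finset.range n, (if a < b then v b a else 0) := by
      simp only [Finset.sum_add_distrib]
      congr 2
      exact Finset.sum_comm
    _ ≤ n + n * R + n * R := by
      refine add_le_add (add_le_add ?_ hlow) hlow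
      refine (Finset.sum_le_sum (g := fun _ => (1 : ℝ)) fun a _ => ?_).trans (by simp)
      rw [Finset.sum_ite_eq]
      split_ifs
      all_goals norm_num
    _ = _ := by ring

/-- For a fixed difference `h` the arguments are `± r^g l` with a single integer `l`, which is the
shape of the sum in `IsCosExponent` with `K = a`. The last `L` indices, where the tail of the
product is not under control, are counted trivially. -/
theorem sum_prod_abs_cos_le_of_exponent {r s : ℕ} (hr : 2 ≤ r) (hs : 3 ≤ s) {α : ℝ}
    (hα : IsCosExponent r s α) (hrs : ¬ MultDep r s) (t : ℤ) (ht : t ≠ 0) (a b J₀ J₁ L : ℕ)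
    (ha : 1 ≤ a) (hJ₀ : s ^ a ≤ r ^ (J₀ + 1))
    (hL : ∀ j, j + L ≤ J₁ → 4 * ((r : ℝ) ^ j * |(t : ℝ)|) ≤ (s : ℝ) ^ (b - 1)) :
    ∑ j ∈ Finset.Ioc J₀ J₁, ∑ g ∈ Finset.Ioc J₀ J₁,
        ∏ k ∈ Finset.Icc (a + 1) (b - 2),
          |Real.cos (Real.pi * ((r : ℝ) ^ j * t - (r : ℝ) ^ g * t) / (s : ℝ) ^ k)| ≤
      ((J₁ - J₀ : ℕ) : ℝ) + 2 * ((J₁ - J₀ : ℕ) * (L + 4 * ((J₁ - J₀ : ℕ) : ℝ) ^ (1 - α))) := by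
  have hr0 : (0 : ℝ) < r := by positivity
  have hr1 : (1 : ℝ) ≤ r := by exact_mod_cast (by omega : 1 ≤ r)
  have hs0 : (0 : ℝ) < s := by positivity
  refine sum_Ioc_symm_le (fun j g => ∏ k ∈ Finset.Icc (a + 1) (b - 2),
          |Real.cos (Real.pi * ((r : ℝ) ^ j * t - (r : ℝ) ^ g * t) / (s : ℝ) ^ k)|) ?_ ?_ J₀ J₁ ?_
  · intro j g
    refine Finset.prod_congr rfl fun k _ => ?_
    rw [← Real.cos_neg]
    congr 2
    ring
  · exact fun j g => Finset.prod_le_one (fun _ _ => abs_nonneg _) fun _ _ => Real.abs_cos_le_one _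
  intro h hh
  set n := J₁ - J₀ with hn
  rcases Nat.eq_zero_or_pos n with hn0 | hnpos
  · rw [hn0]
    simp only [Finset.range_zero, Finset.sum_empty]
    positivity
  set l : ℕ := r ^ (J₀ + 1) * (r ^ h - 1) * t.natAbs with hl
  have hrh : 1 < r ^ h := Nat.one_lt_pow (by omega) (by omega)
  have hl' : r ^ (J₀ + 1) ≤ l := by
    rw [hl, mul_assoc]
    exact Nat.le_mul_of_pos_right _ (Nat.mul_pos (by omega) (Int.natAbs_pos.2 ht))
  have hcos := hα.2.2 hrs n a l hnpos ha (le_trans (Nat.one_le_pow _ _ (by omega)) hl')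
    (hJ₀.trans hl')
  have hlr : (l : ℝ) = (r : ℝ) ^ (J₀ + 1) * ((r : ℝ) ^ h - 1) * |(t : ℝ)| := by
    rw [hl]
    push_cast [Nat.cast_sub hrh.le]
    rw [Nat.cast_natAbs, Int.cast_abs]
  have hterm : ∀ g ∈ Finset.range n, (if g + h < n then ∏ k ∈ Finset.Icc (a + 1) (b - 2),
        |Real.cos (Real.pi * ((r : ℝ) ^ (J₀ + 1 + g + h) * t - (r : ℝ) ^ (J₀ + 1 + g) * t) /
          (s : ℝ) ^ k)| else 0) ≤
      (if n ≤ g + h + L ∧ g + h < n then (1 : ℝ) else 0) +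
        2 * ∏' k : ℕ, |Real.cos (Real.pi * (r : ℝ) ^ g * l / (s : ℝ) ^ (a + 1 + k))| := by
    intro g _
    rw [tprod_abs_cos_eq_cosProd r s g a l (by omega)]
    have hnn := cosProd_nonneg s ((r : ℝ) ^ g * (l / (s : ℝ) ^ a))
    split_ifs with h1 h2 h2
    · have : ∏ k ∈ Finset.Icc (a + 1) (b - 2),
        |Real.cos (Real.pi * ((r : ℝ) ^ (J₀ + 1 + g + h) * t - (r : ℝ) ^ (J₀ + 1 + g) * t) /
          (s : ℝ) ^ k)| ≤ 1 :=
        Finset.prod_le_one (fun _ _ => abs_nonneg _) fun _ _ => Real.abs_cos_le_one _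
      linarith
    · rw [zero_add]
      have hle : J₀ + 1 + g + h + L ≤ J₁ := by
        by_contra hcon
        exact h2 ⟨by omega, h1⟩
      set x : ℝ := (r : ℝ) ^ (J₀ + 1 + g + h) * t - (r : ℝ) ^ (J₀ + 1 + g) * t with hx
      have hx' : x = (r : ℝ) ^ g * ((r : ℝ) ^ (J₀ + 1) * ((r : ℝ) ^ h - 1)) * t := by
        rw [hx, pow_add, pow_add _ (J₀ + 1) g]; ring
      have hrh' : (1 : ℝ) < (r : ℝ) ^ h := by exact_mod_cast hrh
      have hc0 : 0 ≤ (r : ℝ) ^ g * ((r : ℝ) ^ (J₀ + 1) * ((r : ℝ) ^ h - 1)) := by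
        have : 0 ≤ (r : ℝ) ^ h - 1 := by linarith
        positivity
      have hxabs : |x| = (r : ℝ) ^ g * l := by
        rw [hx', abs_mul, abs_of_nonneg hc0, hlr]; ring
      have hxle : |x| ≤ (r : ℝ) ^ (J₀ + 1 + g + h) * |(t : ℝ)| := by
        rw [hx', abs_mul, abs_of_nonneg hc0]
        gcongr
        have : (r : ℝ) ^ (J₀ + 1 + g + h) = (r : ℝ) ^ g * ((r : ℝ) ^ (J₀ + 1) * (r : ℝ) ^ h) := by
          rw [pow_add, pow_add]; ring
        rw [this]
        gcongr
        linarith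
      have := prod_le_two_mul_cosProd s hs a b x
        ((mul_le_mul_of_nonneg_left hxle (by norm_num)).trans (hL _ hle))
      refine this.trans (le_of_eq ?_)
      rw [← mul_div_assoc, ← hxabs]
      rcases abs_choice x with h' | h'
      · rw [h']
      rw [h', neg_div, cosProd_neg]
    · exact absurd h2.2 h1
    · linarith
  refine (Finset.sum_le_sum hterm).trans ?_
  rw [Finset.sum_add_distrib, ← Finset.mul_sum, ← Finset.sum_filter, Finset.sum_const]
  have hcard : (Finset.filter (fun g => n ≤ g + h + L ∧ g + h < n) (Finset.range n)).card ≤ L := by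
    refine (Finset.card_le_card (t := Finset.Ico (n - h - L) (n - h)) ?_).trans ?_
    · intro g hg
      simp at hg ⊢
      omega
    · rw [Nat.card_Ico]; omega
  have hcard' : ((Finset.filter (fun g => n ≤ g + h + L ∧ g + h < n) (Finset.range n)).card : ℝ) ≤
    L := by exact_mod_cast hcard
  rw [nsmul_eq_mul, mul_one]
  linarith

/-! ### The repetition function -/

section

variable {a : ℕ → ℕ → ℝ} {s : ℕ → ℕ}

theorem gamma_one (hs : IsBaseSequence s) : gamma s 1 = s 1 := by
  have := hs.1 1 le_rfl
  simp [gamma, baseR]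
  omega

theorem beta_le {i j k : ℕ} (hi : 1 ≤ i) (hik : i ≤ k) (hj : 1 ≤ j) (hjk : j ≤ k) :
    beta a s k ≤ a (baseR i) (s j) :=
  csInf_le (((Set.finite_Icc 1 k).prod (Set.finite_Icc 1 k)).image _).bddBelow
    ⟨(i, j), ⟨⟨hi, hik⟩, ⟨hj, hjk⟩⟩, rfl⟩

theorem beta_pos (ha : ∀ r s : ℕ, 1 < r → 1 < s → IsCosExponent r s (a r s))
    (hs : IsBaseSequence s) {k : ℕ} (hk : 1 ≤ k) : 0 < beta a s k := by
  have hne : ((fun p : ℕ × ℕ => a (baseR p.1) (s p.2)) ''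
      (Set.Icc 1 k ×ˢ Set.Icc 1 k)).Nonempty :=
    ⟨_, (1, 1), ⟨⟨le_rfl, hk⟩, ⟨le_rfl, hk⟩⟩, rfl⟩
  obtain ⟨⟨i, j⟩, ⟨hi, hj⟩, h⟩ := hne.csInf_mem
    (((Set.finite_Icc 1 k).prod (Set.finite_Icc 1 k)).image _)
  rw [beta, ← h]
  refine (ha _ _ ?_ ?_).1
  · have := hi.1
    simp only [baseR] at *
    omega
  · have := hs.1 j hj.1
    simp only at *
    omega

theorem phi_spec (ha : ∀ r s : ℕ, 1 < r → 1 < s → IsCosExponent r s (a r s))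
    (hs : IsBaseSequence s) (k : ℕ) :
    (beta a s 1 / ((k + 1 : ℕ) : ℝ) ^ (1 / 4 : ℝ) ≤ beta a s (phi a s (k + 1)) ∧
      gamma s (phi a s (k + 1)) ≤ gamma s 1 * (k + 1)) ∧ 1 ≤ phi a s (k + 1) ∧
      phi a s (k + 1) ≤ phi a s (k + 2) ∧ phi a s (k + 2) ≤ phi a s (k + 1) + 1 := by
  classical
  have hβ := beta_pos ha hs (le_refl 1)
  -- Both bounds loosen as `k` grows, so the previous value stays admissible; hence `phi` never
  -- decreases.
  have step : ∀ k : ℕ, (beta a s 1 / ((k + 1 : ℕ) : ℝ) ^ (1 / 4 : ℝ) ≤ beta a s (phi a s (k + 1)) ∧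
      gamma s (phi a s (k + 1)) ≤ gamma s 1 * (k + 1)) →
      (beta a s 1 / ((k + 2 : ℕ) : ℝ) ^ (1 / 4 : ℝ) ≤ beta a s (phi a s (k + 1)) ∧
      gamma s (phi a s (k + 1)) ≤ gamma s 1 * (k + 2)) := by
    rintro k ⟨h1, h2⟩
    refine ⟨le_trans ?_ h1, h2.trans (Nat.mul_le_mul_left _ (by omega))⟩
    gcongr
    norm_num
  have hspec : ∀ k : ℕ, (beta a s 1 / ((k + 1 : ℕ) : ℝ) ^ (1 / 4 : ℝ) ≤
      beta a s (phi a s (k + 1)) ∧ gamma s (phi a s (k + 1)) ≤ gamma s 1 * (k + 1)) ∧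
      1 ≤ phi a s (k + 1) := by
    intro k
    induction k with
    | zero => simp [phi]
    | succ k ih =>
      have hP := step k ih.1
      refine ⟨?_, ?_⟩
      · have := Nat.findGreatest_spec (P := fun p => beta a s 1 / ((k + 2 : ℕ) : ℝ) ^ (1 / 4 : ℝ) ≤
          beta a s p ∧ gamma s p ≤ gamma s 1 * (k + 2)) (Nat.le_succ (phi a s (k + 1))) hP
        rw [phi]
        convert this
      · refine ih.2.trans ?_
        rw [phi]
        exact Nat.le_findGreatest (Nat.le_succ _) hP
  refine ⟨(hspec k).1, (hspec k).2, ?_, ?_⟩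
  · rw [phi.eq_3]
    exact Nat.le_findGreatest (Nat.le_succ _) (step k (hspec k).1)
  · rw [phi.eq_3]
    exact Nat.findGreatest_le _

theorem phi_mono (ha : ∀ r s : ℕ, 1 < r → 1 < s → IsCosExponent r s (a r s))
    (hs : IsBaseSequence s) {i m : ℕ} (hi : 1 ≤ i) (him : i ≤ m) : phi a s i ≤ phi a s m := by
  induction m, him using Nat.le_induction with
  | base => exact le_rfl
  | succ m hm ih =>
    obtain ⟨k, rfl⟩ : ∃ k, m = k + 1 := ⟨m - 1, by omega⟩
    exact ih.trans (phi_spec ha hs k).2.2.1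

theorem one_le_phi (ha : ∀ r s : ℕ, 1 < r → 1 < s → IsCosExponent r s (a r s))
    (hs : IsBaseSequence s) {m : ℕ} (hm : 1 ≤ m) : 1 ≤ phi a s m := by
  obtain ⟨k, rfl⟩ : ∃ k, m = k + 1 := ⟨m - 1, by omega⟩
  exact (phi_spec ha hs k).2.1

/-- If `p` is attained and `p + 1` never is, `phi` stays at `p` forever; but `β_(p+1) > 0`, so `p +
1` eventually meets both constraints. -/
theorem exists_phi_eq (ha : ∀ r s : ℕ, 1 < r → 1 < s → IsCosExponent r s (a r s))
    (hs : IsBaseSequence s) {p : ℕ} (hp : 1 ≤ p) : ∃ k, 1 ≤ k ∧ phi a s k = p := by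
  classical
  induction p, hp using Nat.le_induction with
  | base => exact ⟨1, le_rfl, rfl⟩
  | succ p hp ih =>
    obtain ⟨k, hk, hkp⟩ := ih
    by_contra hcon
    push Not at hcon
    have hconst : ∀ K, k ≤ K → phi a s K = p := by
      intro K hK
      induction K, hK using Nat.le_induction with
      | base => exact hkp
      | succ K hK ih =>
        obtain ⟨K, rfl⟩ : ∃ k, K = k + 1 := ⟨K - 1, by omega⟩
        have h1 := (phi_spec ha hs K).2.2
        have h2 := hcon (K + 1 + 1) (by omega)
        rw [ih] at h1
        have h3 : K + 2 = K + 1 + 1 := rfl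
        rw [h3] at h1
        omega
    have hβ := beta_pos ha hs (k := p + 1) (by omega)
    have hlim : Tendsto (fun K : ℕ => beta a s 1 / ((K + 2 : ℕ) : ℝ) ^ (1 / 4 : ℝ)) atTop (𝓝 0) := by
      refine Tendsto.div_atTop tendsto_const_nhds ?_
      refine (tendsto_rpow_atTop (by norm_num)).comp ?_
      exact tendsto_natCast_atTop_atTop.comp (tendsto_add_atTop_nat 2)
    obtain ⟨K, hK1, hK2, hK3⟩ := ((hlim.eventually_le_const hβ).and
      ((eventually_ge_atTop k).and (eventually_ge_atTop (gamma s (p + 1))))).exists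
    have h1 : p + 1 ≤ phi a s (K + 2) := by
      rw [phi.eq_3, hconst (K + 1) (by omega)]
      refine Nat.le_findGreatest le_rfl ⟨hK1, ?_⟩
      have : 2 < gamma s 1 := by rw [gamma_one hs]; exact hs.1 1 le_rfl
      nlinarith
    rw [hconst (K + 2) (by omega)] at h1
    omega

theorem three_le_repS (ha : ∀ r s : ℕ, 1 < r → 1 < s → IsCosExponent r s (a r s))
    (hs : IsBaseSequence s) {m : ℕ} (hm : 1 ≤ m) : 3 ≤ repS a s m :=
  hs.1 _ (one_le_phi ha hs hm)

theorem repS_le (ha : ∀ r s : ℕ, 1 < r → 1 < s → IsCosExponent r s (a r s))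
    (hs : IsBaseSequence s) {m : ℕ} (hm : 1 ≤ m) : repS a s m ≤ repS a s 1 * m := by
  obtain ⟨k, rfl⟩ : ∃ k, m = k + 1 := ⟨m - 1, by omega⟩
  obtain ⟨⟨-, h1⟩, h2, -⟩ := phi_spec ha hs k
  rw [gamma_one hs] at h1
  refine le_trans ?_ h1
  refine le_trans (le_max_right (baseR (phi a s (k + 1))) _) ?_
  exact Finset.le_sup (f := fun i => max (baseR i) (s i)) (Finset.mem_Icc.2 ⟨h2, le_rfl⟩)

theorem two_le_repR (ha : ∀ r s : ℕ, 1 < r → 1 < s → IsCosExponent r s (a r s))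
    (hs : IsBaseSequence s) {m : ℕ} (hm : 1 ≤ m) : 2 ≤ repR a s m := by
  have := one_le_phi ha hs hm
  simp only [repR, baseR]
  omega

theorem exists_repR_eq (ha : ∀ r s : ℕ, 1 < r → 1 < s → IsCosExponent r s (a r s))
    (hs : IsBaseSequence s) {r : ℕ} (hr : 2 ≤ r) : ∃ i, 1 ≤ i ∧ repR a s i = r := by
  obtain ⟨i, hi, h⟩ := exists_phi_eq ha hs (p := r - 1) (by omega)
  exact ⟨i, hi, by simp only [repR, baseR]; omega⟩

/-- By monotonicity of `phi` the pair `(φ i, φ m)` lies in the square over which `β_(φ m)` is the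
minimum. -/
theorem le_exponent_rep (ha : ∀ r s : ℕ, 1 < r → 1 < s → IsCosExponent r s (a r s))
    (hs : IsBaseSequence s) {i m : ℕ} (hi : 1 ≤ i) (him : i ≤ m) :
    beta a s 1 / (m : ℝ) ^ (1 / 4 : ℝ) ≤ a (repR a s i) (repS a s m) := by
  obtain ⟨k, rfl⟩ : ∃ k, m = k + 1 := ⟨m - 1, by omega⟩
  exact (phi_spec ha hs k).1.1.trans
    (beta_le (one_le_phi ha hs hi) (phi_mono ha hs hi him) (phi_spec ha hs k).2.1 le_rfl)

end

/-! ### Growth of the block boundaries -/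

section

variable {σ : ℕ → ℕ}

/-- With `exp_ang_lt` this places the block boundaries of all bases at the same scale `e^⟨m⟩`, up to
one factor of the base. -/
theorem pow_angb_le (m : ℕ) {x : ℕ} (hx : 2 ≤ x) : (x : ℝ) ^ angb σ m x ≤ Real.exp (ang σ m) := by
  have hx1 : (1 : ℝ) < x := by exact_mod_cast hx
  have hl := Real.log_pos hx1
  have h : (angb σ m x : ℝ) ≤ ang σ m / Real.log x := Nat.floor_le (by positivity)
  rw [le_div_iff₀ hl] at h
  calc (x : ℝ) ^ angb σ m x = Real.exp (angb σ m x * Real.log x) := by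
        rw [Real.exp_nat_mul, Real.exp_log (by linarith)]
    _ ≤ _ := Real.exp_le_exp.2 h

theorem exp_ang_lt (m : ℕ) {x : ℕ} (hx : 2 ≤ x) :
    Real.exp (ang σ m) < (x : ℝ) ^ (angb σ m x + 1) := by
  have hx1 : (1 : ℝ) < x := by exact_mod_cast hx
  have hl := Real.log_pos hx1
  have h : (ang σ m : ℝ) / Real.log x < angb σ m x + 1 := Nat.lt_floor_add_one _
  rw [div_lt_iff₀ hl] at h
  calc Real.exp (ang σ m) < Real.exp ((angb σ m x + 1 : ℕ) * Real.log x) := by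
        refine Real.exp_lt_exp.2 ?_
        push_cast
        exact h
    _ = _ := by rw [Real.exp_nat_mul, Real.exp_log (by linarith)]

theorem ang_mono : Monotone (ang σ) := by
  intro m m' h
  have : (m : ℝ) ≤ m' := by exact_mod_cast h
  refine Nat.floor_le_floor ?_
  gcongr

theorem angb_mono (x : ℕ) : Monotone fun m => angb σ m x := by
  intro m m' h
  have : (ang σ m : ℝ) ≤ ang σ m' := by exact_mod_cast ang_mono h
  refine Nat.floor_le_floor ?_
  have := Real.log_natCast_nonneg x
  gcongr

theorem ang_le (m : ℕ) : (ang σ m : ℝ) ≤ Real.exp (Real.sqrt m) + 2 * (σ 1 : ℝ) * (m : ℝ) ^ 3 :=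
  Nat.floor_le (by positivity)

theorem lt_ang_add_one (m : ℕ) :
    Real.exp (Real.sqrt m) + 2 * (σ 1 : ℝ) * (m : ℝ) ^ 3 < ang σ m + 1 :=
  Nat.lt_floor_add_one _

theorem exp_sqrt_le_ang (h1 : 1 ≤ σ 1) {m : ℕ} (hm : 1 ≤ m) :
    Real.exp (Real.sqrt m) ≤ ang σ m := by
  have h := lt_ang_add_one (σ := σ) m
  have h2 : (1 : ℝ) ≤ σ 1 := by exact_mod_cast h1
  have h3 : (1 : ℝ) ≤ (m : ℝ) ^ 3 := one_le_pow₀ (by exact_mod_cast hm)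
  nlinarith

theorem half_le_log {x : ℕ} (hx : 2 ≤ x) : 1 / 2 ≤ Real.log x := by
  have h := Real.log_two_gt_d9
  have : Real.log 2 ≤ Real.log x := Real.log_le_log (by norm_num) (by exact_mod_cast hx)
  linarith

theorem angb_le (m : ℕ) {x : ℕ} (hx : 2 ≤ x) :
    (angb σ m x : ℝ) ≤ 2 * (Real.exp (Real.sqrt m) + 2 * (σ 1 : ℝ) * (m : ℝ) ^ 3) := by
  have hl := half_le_log hx
  have h : (angb σ m x : ℝ) ≤ ang σ m / Real.log x := Nat.floor_le (by positivity)
  have h2 := ang_le (σ := σ) m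
  refine h.trans ?_
  rw [div_le_iff₀ (by linarith)]
  nlinarith [Nat.cast_nonneg (α := ℝ) (ang σ m)]

theorem le_angb_add_one (h1 : 1 ≤ σ 1) {m : ℕ} (hm : 1 ≤ m) {x : ℕ} (hx : 2 ≤ x) :
    Real.exp (Real.sqrt m) / Real.log x ≤ angb σ m x + 1 := by
  have hl := half_le_log hx
  refine le_trans ?_ (Nat.lt_floor_add_one ((ang σ m : ℝ) / Real.log x)).le
  have := exp_sqrt_le_ang h1 hm
  gcongr

/-- The cubic term alone supplies the increase; `e^√m` grows too slowly at first. -/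
theorem two_le_ang_succ_sub (h1 : 1 ≤ σ 1) (m : ℕ) (hm : 1 ≤ m) : ang σ m + 2 ≤ ang σ (m + 1) := by
  have a1 := ang_le (σ := σ) m
  have a2 := lt_ang_add_one (σ := σ) (m + 1)
  have h2 : (1 : ℝ) ≤ σ 1 := by exact_mod_cast h1
  have h3 : (1 : ℝ) ≤ m := by exact_mod_cast hm
  have h4 : Real.exp (Real.sqrt m) ≤ Real.exp (Real.sqrt (m + 1 : ℕ)) := by
    gcongr
    linarith
  push_cast at *
  have h6 : (3 : ℝ) ≤ 2 * (σ 1 : ℝ) * ((m + 1) ^ 3 - m ^ 3) := by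
    have h7 : (3 : ℝ) ≤ ((m : ℝ) + 1) ^ 3 - m ^ 3 := by nlinarith
    nlinarith
  have h5 : (ang σ m : ℝ) + 2 < ang σ (m + 1) + 1 := by linarith
  have : (ang σ m : ℝ) + 1 < ang σ (m + 1) := by linarith
  exact_mod_cast this

/-- The length of a block. -/
theorem angb_succ_sub_le (m : ℕ) (hm : 1 ≤ m) {x : ℕ} (hx : 2 ≤ x) :
    (angb σ (m + 1) x : ℝ) - angb σ m x ≤
      (3400 * σ 1 + 5) * (Real.exp (Real.sqrt m) / Real.sqrt m) := by
  have hl := half_le_log hx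
  have h3 : (1 : ℝ) ≤ m := by exact_mod_cast hm
  set y := Real.sqrt m with hy
  have hy1 : 1 ≤ y := by rw [hy, Real.one_le_sqrt]; exact h3
  have hy2 : y ^ 2 = m := Real.sq_sqrt (by linarith)
  set X := Real.exp y / y with hX
  have hX1 : 1 ≤ X := by
    rw [hX, one_le_div (by linarith)]
    linarith [Real.add_one_le_exp y]
  -- From the Taylor term `y^5 / 5! ≤ e^y` and `m² = y⁴`; this absorbs the increment of the cubic
  -- term.
  have hXm : (m : ℝ) ^ 2 ≤ 120 * X := by
    have h := Real.pow_div_factorial_le_exp y (by linarith) 5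
    have h5 : (Nat.factorial 5 : ℝ) = 120 := by norm_num [Nat.factorial]
    rw [h5, div_le_iff₀ (by norm_num)] at h
    rw [hX, ← mul_div_assoc, le_div_iff₀ (by linarith), ← hy2]
    nlinarith
  -- `√(m+1) ≤ y + 1/(2y)`, and `e^u ≤ 1 + 2u` for `0 ≤ u ≤ 1/2`.
  have hexp : Real.exp (Real.sqrt (m + 1 : ℕ)) ≤ Real.exp y + X := by
    have h1 : Real.sqrt (m + 1 : ℕ) ≤ y + 1 / (2 * y) := by
      rw [Real.sqrt_le_left (by positivity)]
      push_cast
      have : (y + 1 / (2 * y)) ^ 2 = y ^ 2 + 1 + (1 / (2 * y)) ^ 2 := by field_simp; ring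
      rw [this, hy2]
      linarith [sq_nonneg (1 / (2 * y))]
    have hu0 : 0 < 1 / (2 * y) := by positivity
    have hu1 : 1 / (2 * y) ≤ 1 / 2 := by
      rw [div_le_div_iff₀ (by positivity) (by norm_num)]; linarith
    have h2 : Real.exp (1 / (2 * y)) ≤ 1 + 2 * (1 / (2 * y)) := by
      have h := Real.exp_bound_div_one_sub_of_interval hu0.le (by linarith)
      refine h.trans ?_
      rw [div_le_iff₀ (by linarith)]
      nlinarith
    calc Real.exp (Real.sqrt (m + 1 : ℕ)) ≤ Real.exp (y + 1 / (2 * y)) := Real.exp_le_exp.2 h1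
      _ = Real.exp y * Real.exp (1 / (2 * y)) := Real.exp_add _ _
      _ ≤ Real.exp y * (1 + 2 * (1 / (2 * y))) := by gcongr
      _ = _ := by rw [hX]; field_simp
  have a1 := ang_le (σ := σ) (m + 1)
  have a2 := lt_ang_add_one (σ := σ) m
  have hσ0 : (0 : ℝ) ≤ σ 1 := by positivity
  have hang : (ang σ (m + 1) : ℝ) - ang σ m ≤ (1680 * σ 1 + 2) * X := by
    push_cast at a1 hexp
    have h6 : ((m : ℝ) + 1) ^ 3 - m ^ 3 ≤ 7 * m ^ 2 := by nlinarith
    have h7 : 2 * (σ 1 : ℝ) * (((m : ℝ) + 1) ^ 3 - m ^ 3) ≤ 2 * σ 1 * (7 * (120 * X)) := by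
      gcongr
      linarith
    nlinarith
  have hang0 : (0 : ℝ) ≤ (ang σ (m + 1) : ℝ) - ang σ m := by
    have : (ang σ m : ℝ) ≤ ang σ (m + 1) := by exact_mod_cast ang_mono (Nat.le_succ m)
    linarith
  have b1 : (angb σ (m + 1) x : ℝ) ≤ ang σ (m + 1) / Real.log x := Nat.floor_le (by positivity)
  have b2 : (ang σ m : ℝ) / Real.log x < angb σ m x + 1 := Nat.lt_floor_add_one _
  have b3 : ((ang σ (m + 1) : ℝ) - ang σ m) / Real.log x ≤ 2 * ((ang σ (m + 1) : ℝ) - ang σ m) := by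
    rw [div_le_iff₀ (by linarith)]
    nlinarith
  rw [sub_div] at b3
  nlinarith

end

/-! ### Convergence -/

theorem sum_digits_le {s : ℕ} (hs : 2 ≤ s) (c : ℕ → ℕ) (hc : ∀ k, c k = 0 ∨ c k = 1) (a b : ℕ) :
    ∑ k ∈ Finset.Icc (a + 1) b, (c k : ℝ) / (s : ℝ) ^ k ≤ 1 / (s : ℝ) ^ a := by
  have hs2 : (2 : ℝ) ≤ s := by exact_mod_cast hs
  have key : ∀ n : ℕ, ∑ k ∈ Finset.Ico (a + 1) (a + 1 + n), (c k : ℝ) / (s : ℝ) ^ k ≤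
      1 / (s : ℝ) ^ a - 1 / (s : ℝ) ^ (a + n) := by
    intro n
    induction n with
    | zero => simp
    | succ n ih =>
      rw [← add_assoc, Finset.sum_Ico_succ_top (by omega)]
      have h1 : (c (a + 1 + n) : ℝ) ≤ 1 := by
        rcases hc (a + 1 + n) with h | h <;> simp [h]
      have h2 : (c (a + 1 + n) : ℝ) / (s : ℝ) ^ (a + 1 + n) ≤ 1 / (s : ℝ) ^ (a + 1 + n) := by
        gcongr
      have h3 : 2 * (1 / (s : ℝ) ^ (a + 1 + n)) ≤ 1 / (s : ℝ) ^ (a + n) := by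
        rw [show a + 1 + n = a + n + 1 by ring, pow_succ, mul_one_div, div_le_div_iff₀
          (by positivity) (by positivity)]
        have : (0 : ℝ) < (s : ℝ) ^ (a + n) := by positivity
        nlinarith
      rw [show a + (n + 1) = a + 1 + n by ring]
      linarith
  have h1 : Finset.Icc (a + 1) b ⊆ Finset.Ico (a + 1) (a + 1 + b) := by
    intro k hk
    simp at hk ⊢
    omega
  refine (Finset.sum_le_sum_of_subset_of_nonneg h1 fun k _ _ => by positivity).trans
    ((key b).trans ?_)
  have : (0 : ℝ) < 1 / (s : ℝ) ^ (a + b) := by positivity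
  linarith

section

variable {ρ σ m₀ : ℕ → ℕ}

/-- Rounding up and the free digits each add at most `s^(-A)`, and `s^(-A) ≤ s · e^(-⟨m+1⟩)`. -/
theorem xi_succ_bounds (hσ : ∀ m, 1 ≤ m → 3 ≤ σ m) (hσ' : ∀ m, 1 ≤ m → σ m ≤ σ 1 * m) (m : ℕ) :
    xi ρ σ m₀ m ≤ xi ρ σ m₀ (m + 1) ∧ xi ρ σ m₀ (m + 1) ≤ xi ρ σ m₀ m +
      2 * (σ 1 * (m + 1 : ℕ)) * Real.exp (-(ang σ (m + 1) : ℝ)) := by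
  have hmem := (isLeast_xi ρ σ m₀ m).1.1
  obtain ⟨c, hc, h⟩ := hmem
  have hs := hσ (m + 1) (by omega)
  set s := σ (m + 1)
  set A := angb σ (m + 1) s
  have hsA : (0 : ℝ) < (s : ℝ) ^ A := by positivity
  have h1 : xi ρ σ m₀ m ≤ eta σ (m + 1) (xi ρ σ m₀ m) := by
    rw [eta, le_div_iff₀ hsA]
    exact Int.le_ceil _
  have h2 : eta σ (m + 1) (xi ρ σ m₀ m) ≤ xi ρ σ m₀ m + 1 / (s : ℝ) ^ A := by
    rw [eta, div_le_iff₀ hsA, add_mul, one_div, inv_mul_cancel₀ hsA.ne']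
    exact (Int.ceil_lt_add_one _).le
  have h3 := sum_digits_le (s := s) (by omega) c hc A (angb σ (m + 1 + 1) s - 2)
  have h4 : 0 ≤ ∑ k ∈ Finset.Icc (A + 1) (angb σ (m + 1 + 1) s - 2), (c k : ℝ) / (s : ℝ) ^ k :=
    Finset.sum_nonneg fun k _ => by positivity
  have h5 : 1 / (s : ℝ) ^ A ≤ (σ 1 * (m + 1 : ℕ)) * Real.exp (-(ang σ (m + 1) : ℝ)) := by
    have h6 := exp_ang_lt (σ := σ) (m + 1) (x := s) (by omega)
    have h7 : (s : ℝ) ≤ σ 1 * (m + 1 : ℕ) := by exact_mod_cast hσ' (m + 1) (by omega)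
    rw [Real.exp_neg, ← div_eq_mul_inv, div_le_div_iff₀ hsA (Real.exp_pos _), one_mul]
    rw [pow_succ, mul_comm] at h6
    exact h6.le.trans (by gcongr)
  rw [h]
  constructor <;> linarith

theorem exists_tendsto_xi (hσ : ∀ m, 1 ≤ m → 3 ≤ σ m) (hσ' : ∀ m, 1 ≤ m → σ m ≤ σ 1 * m) :
    ∃ ξ : ℝ, Tendsto (xi ρ σ m₀) atTop (𝓝 ξ) ∧ ∀ m, xi ρ σ m₀ m ≤ ξ ∧
      ξ ≤ xi ρ σ m₀ m + 4 * (σ 1 * (m + 1 : ℕ)) * Real.exp (-(ang σ (m + 1) : ℝ)) := by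
  have hb := xi_succ_bounds (ρ := ρ) (m₀ := m₀) hσ hσ'
  set x := xi ρ σ m₀
  have hσ1 : 1 ≤ σ 1 := by have := hσ 1 le_rfl; omega
  set d : ℕ → ℝ := fun m => 2 * (σ 1 * (m : ℝ)) * Real.exp (-(ang σ m : ℝ)) with hd
  have hd2 : ∀ m, 1 ≤ m → 2 * d (m + 1) ≤ d m := by
    intro m hm
    have h1 : (ang σ m : ℝ) + 2 ≤ ang σ (m + 1) := by exact_mod_cast two_le_ang_succ_sub hσ1 m hm
    have h2 : Real.exp (-(ang σ (m + 1) : ℝ)) ≤ Real.exp (-(ang σ m : ℝ)) * (1 / 4) := by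
      calc Real.exp (-(ang σ (m + 1) : ℝ)) ≤ Real.exp (-(ang σ m : ℝ) + -2) :=
            Real.exp_le_exp.2 (by linarith)
        _ = Real.exp (-(ang σ m : ℝ)) * Real.exp (-2) := Real.exp_add _ _
        _ ≤ _ := by
          gcongr
          rw [Real.exp_neg, ← one_div]
          have h3 : (4 : ℝ) ≤ Real.exp 2 := by
            have := Real.add_one_le_exp (1 : ℝ)
            have h4 : Real.exp 2 = Real.exp 1 * Real.exp 1 := by rw [← Real.exp_add]; norm_num
            rw [h4]; nlinarith
          exact one_div_le_one_div_of_le (by norm_num) h3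
    have h3 : ((m + 1 : ℕ) : ℝ) ≤ 2 * m := by
      have : (1 : ℝ) ≤ m := by exact_mod_cast hm
      push_cast; linarith
    have h5 := Real.exp_pos (-(ang σ m : ℝ))
    calc 2 * d (m + 1) ≤ 2 * (2 * (σ 1 * (2 * m)) * (Real.exp (-(ang σ m : ℝ)) * (1 / 4))) := by
          simp only [hd]; gcongr
      _ = d m := by simp only [hd]; ring
  have hmono : Monotone x := monotone_nat_of_le_succ fun m => (hb m).1
  -- Since `d` at least halves at each step, `x m + 2 d (m+1)` is nonincreasing and bounds all later
  -- terms.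
  have hupper : ∀ m k, x (m + k) + 2 * d (m + k + 1) ≤ x m + 2 * d (m + 1) := by
    intro m k
    induction k with
    | zero => simp
    | succ k ih =>
      have h1 := (hb (m + k)).2
      have h2 := hd2 (m + k + 1) (by omega)
      have h3 : x (m + k + 1) ≤ x (m + k) + d (m + k + 1) := h1
      rw [← add_assoc]
      linarith
  have hupper' : ∀ m n, x n ≤ x m + 2 * d (m + 1) := by
    intro m n
    have hd0 : ∀ m, 0 ≤ d m := fun m => by simp only [hd]; positivity
    rcases le_total n m with h | h
    · linarith [hmono h, hd0 (m + 1)]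
    · obtain ⟨k, rfl⟩ := Nat.exists_eq_add_of_le h
      linarith [hupper m k, hd0 (m + k + 1)]
  have hbdd : BddAbove (Set.range x) := ⟨_, by rintro _ ⟨n, rfl⟩; exact hupper' 0 n⟩
  refine ⟨⨆ n, x n, tendsto_atTop_ciSup hmono hbdd, fun m => ⟨le_ciSup hbdd m, ?_⟩⟩
  refine ciSup_le fun n => (hupper' m n).trans (le_of_eq ?_)
  simp only [hd]
  ring

end

/-! ### Exponential sums over a block -/

section

variable {ρ σ m₀ : ℕ → ℕ} {a : ℕ → ℕ → ℝ} {β : ℝ}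

theorem one_le_angb (hσ : ∀ m, 1 ≤ m → 3 ≤ σ m) (hσ' : ∀ m, 1 ≤ m → σ m ≤ σ 1 * m) {m : ℕ}
    (hm : 1 ≤ m) {b : ℕ} (hb : m ≤ b) : 1 ≤ angb σ b (σ m) := by
  refine le_trans ?_ (angb_mono (σ := σ) (σ m) hb)
  have hs := hσ m hm
  have hσ1 : (1 : ℝ) ≤ σ 1 := by exact_mod_cast (by have := hσ 1 le_rfl; omega : 1 ≤ σ 1)
  have hm1 : (1 : ℝ) ≤ m := by exact_mod_cast hm
  have hl := half_le_log (x := σ m) (by omega)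
  refine Nat.le_floor ?_
  rw [Nat.cast_one, one_le_div (by linarith)]
  have h1 : Real.log (σ m) ≤ σ m := Real.log_le_self (by positivity)
  have h2 : (σ m : ℝ) ≤ σ 1 * m := by exact_mod_cast hσ' m hm
  have h3 := lt_ang_add_one (σ := σ) m
  have h4 := Real.one_le_exp (Real.sqrt_nonneg m)
  have h5 : (m : ℝ) ≤ m ^ 3 := le_self_pow₀ hm1 (by norm_num)
  have h6 : (σ 1 : ℝ) * m ≤ σ 1 * (m : ℝ) ^ 3 := by gcongr
  have h7 : 0 ≤ (σ 1 : ℝ) * (m : ℝ) ^ 3 := by positivity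
  linarith

/-- The exponent may shrink like `m^(-1/4)` because `√m` leaves another `m^(1/4)` for the saving. -/
theorem exp_sqrt_rpow_neg (m : ℕ) (hm : 1 ≤ m) :
    Real.exp (Real.sqrt m) ^ (-(β / (m : ℝ) ^ (1 / 4 : ℝ))) =
      Real.exp (-(β * (m : ℝ) ^ (1 / 4 : ℝ))) := by
  have hm0 : (0 : ℝ) < m := by exact_mod_cast hm
  rw [← Real.exp_mul]
  congr 1
  have h : Real.sqrt m = (m : ℝ) ^ (1 / 4 : ℝ) * (m : ℝ) ^ (1 / 4 : ℝ) := by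
    rw [← Real.rpow_add hm0, Real.sqrt_eq_rpow]; norm_num
  have h2 : (0 : ℝ) < (m : ℝ) ^ (1 / 4 : ℝ) := by positivity
  rw [h]
  field_simp

theorem weylSum_xi_le_explicit (hσ : ∀ m, 1 ≤ m → 3 ≤ σ m) (hσ' : ∀ m, 1 ≤ m → σ m ≤ σ 1 * m)
    (hρ : ∀ i, 1 ≤ i → 2 ≤ ρ i) (hm₀ : IsThreshold σ m₀)
    (ha : ∀ r s : ℕ, 1 < r → 1 < s → IsCosExponent r s (a r s))
    (hβ0 : 0 < β) (hβ : ∀ i m : ℕ, 1 ≤ i → i ≤ m → β / (m : ℝ) ^ (1 / 4 : ℝ) ≤ a (ρ i) (σ m))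
    (m : ℕ) (hm : 1 ≤ m) :
    weylSum ρ σ m₀ m (xi ρ σ m₀ m) ≤ 2 * m ^ 2 * ((3400 * σ 1 + 5) * Real.exp (Real.sqrt m) *
      (1 + 2 * (4 * (σ 1 : ℝ) ^ 2 * m ^ 3 + 4 * ((3400 * σ 1 + 5) * Real.exp (Real.sqrt m) *
        Real.exp (-(β * (m : ℝ) ^ (1 / 4 : ℝ))))))) := by
  set C : ℝ := 3400 * σ 1 + 5 with hC
  set H : ℝ := Real.exp (Real.sqrt m) with hH
  set ε : ℝ := Real.exp (-(β * (m : ℝ) ^ (1 / 4 : ℝ))) with hε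
  -- Chosen so that `r^L ≥ L ≥ 4 |t| s²`: giving up `L` indices pays for the frequency and for the
  -- gap between `s^(b+1)` and `s^(b-1)`.
  set L : ℕ := 4 * (σ 1) ^ 2 * m ^ 3 with hL
  have hm1 : (1 : ℝ) ≤ m := by exact_mod_cast hm
  have hC1 : 1 ≤ C := by
    have : (0 : ℝ) ≤ σ 1 := by positivity
    linarith
  have hH1 : 1 ≤ H := Real.one_le_exp (Real.sqrt_nonneg m)
  have hs := hσ m hm
  set s := σ m with hsdef
  set R : ℝ := C * H * (1 + 2 * (4 * (σ 1 : ℝ) ^ 2 * m ^ 3 + 4 * (C * H * ε))) with hR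
  have hR0 : 0 ≤ R := by positivity
  -- a single frequency and a single base
  have hsingle : ∀ t : ℤ, t ≠ 0 → |t| ≤ m → ∀ i, 1 ≤ i → i ≤ m → m₀ (ρ i) ≤ m →
      ∑ j ∈ Finset.Ioc (angb σ m (ρ i)) (angb σ (m + 1) (ρ i)),
        ∑ g ∈ Finset.Ioc (angb σ m (ρ i)) (angb σ (m + 1) (ρ i)),
          ∏ k ∈ Finset.Icc (angb σ m s + 1) (angb σ (m + 1) s - 2),
            |Real.cos (Real.pi * ((ρ i : ℝ) ^ j * t - (ρ i : ℝ) ^ g * t) / (s : ℝ) ^ k)| ≤ R := by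
    intro t ht htm i hi him hthr
    have hr := hρ i hi
    have hrs := hm₀ (ρ i) hr m hm hthr
    set r := ρ i with hrdef
    have hα := ha r s (by omega) (by omega)
    have hαβ : β / (m : ℝ) ^ (1 / 4 : ℝ) ≤ a r s := hβ i m hi him
    set J₀ := angb σ m r
    set J₁ := angb σ (m + 1) r
    set b := angb σ (m + 1) s with hb
    have hb1 : 1 ≤ b := one_le_angb hσ hσ' hm (Nat.le_succ m)
    have hJ₀ : s ^ angb σ m s ≤ r ^ (J₀ + 1) := by
      have h1 := (pow_angb_le (σ := σ) m (x := s) (by omega)).trans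
        (exp_ang_lt (σ := σ) m (x := r) hr).le
      exact_mod_cast h1
    have hLcond : ∀ j, j + L ≤ J₁ → 4 * ((r : ℝ) ^ j * |(t : ℝ)|) ≤ (s : ℝ) ^ (b - 1) := by
      intro j hj
      have h1 : (r : ℝ) ^ (j + L) ≤ (s : ℝ) ^ (b + 1) := by
        calc (r : ℝ) ^ (j + L) ≤ (r : ℝ) ^ J₁ :=
              pow_le_pow_right₀ (by exact_mod_cast (by omega : 1 ≤ r)) hj
          _ ≤ Real.exp (ang σ (m + 1)) := pow_angb_le (m + 1) hr
          _ ≤ _ := (exp_ang_lt (m + 1) (by omega)).le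
      have h2 : (L : ℝ) ≤ (r : ℝ) ^ L := by
        have : L < r ^ L := Nat.lt_pow_self (by omega)
        exact_mod_cast this.le
      have h3 : (s : ℝ) ≤ σ 1 * m := by exact_mod_cast hσ' m hm
      have h4 : |(t : ℝ)| ≤ m := by exact_mod_cast htm
      have h5 : 4 * |(t : ℝ)| * (s : ℝ) ^ 2 ≤ L := by
        calc 4 * |(t : ℝ)| * (s : ℝ) ^ 2 ≤ 4 * m * (σ 1 * m) ^ 2 := by gcongr
          _ = (L : ℝ) := by rw [hL]; push_cast; ring
      have h6 : (s : ℝ) ^ (b + 1) = (s : ℝ) ^ (b - 1) * (s : ℝ) ^ 2 := by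
        rw [← pow_add]; congr 1; omega
      have h7 : (0 : ℝ) < (s : ℝ) ^ 2 := by positivity
      refine le_of_mul_le_mul_right ?_ h7
      rw [← h6]
      calc 4 * ((r : ℝ) ^ j * |(t : ℝ)|) * (s : ℝ) ^ 2 = (r : ℝ) ^ j * (4 * |(t : ℝ)| * (s : ℝ) ^ 2) := by
            ring
        _ ≤ (r : ℝ) ^ j * (r : ℝ) ^ L := by gcongr; exact h5.trans h2
        _ ≤ _ := by rw [← pow_add]; exact h1
    have hmain := sum_prod_abs_cos_le_of_exponent hr hs hα hrs t ht (angb σ m s) b J₀ J₁ L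
      (one_le_angb hσ hσ' hm le_rfl) hJ₀ hLcond
    refine hmain.trans ?_
    set n := J₁ - J₀ with hn
    have hnCH : (n : ℝ) ≤ C * H := by
      have h1 := angb_succ_sub_le (σ := σ) m hm hr
      have h2 : (n : ℝ) = (J₁ : ℝ) - J₀ := by
        rw [hn, Nat.cast_sub]
        exact angb_mono (σ := σ) r (Nat.le_succ m)
      rw [h2]
      refine h1.trans ?_
      gcongr
      exact div_le_self (by positivity) (by rw [Real.one_le_sqrt]; exact hm1)
    have hCH1 : 1 ≤ C * H := one_le_mul_of_one_le_of_one_le hC1 hH1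
    have hpow : (n : ℝ) ^ (1 - a r s) ≤ C * H * ε := by
      have h1 : 0 ≤ 1 - a r s := by linarith [hα.2.1]
      calc (n : ℝ) ^ (1 - a r s) ≤ (C * H) ^ (1 - a r s) :=
            Real.rpow_le_rpow (by positivity) hnCH h1
        _ ≤ (C * H) ^ (1 + -(β / (m : ℝ) ^ (1 / 4 : ℝ))) :=
            Real.rpow_le_rpow_of_exponent_le hCH1 (by linarith)
        _ = C * H * (C * H) ^ (-(β / (m : ℝ) ^ (1 / 4 : ℝ))) := by
            rw [Real.rpow_add (by positivity), Real.rpow_one]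
        _ ≤ C * H * H ^ (-(β / (m : ℝ) ^ (1 / 4 : ℝ))) := by
            refine mul_le_mul_of_nonneg_left (Real.rpow_le_rpow_of_nonpos (by positivity)
              (le_mul_of_one_le_left (by positivity) hC1) (neg_nonpos.2 ?_)) (by positivity)
            positivity
        _ = C * H * ε := by rw [hH, exp_sqrt_rpow_neg m hm]
    have hLr : (L : ℝ) = 4 * (σ 1 : ℝ) ^ 2 * m ^ 3 := by rw [hL]; push_cast; ring
    rw [hR, ← hLr]
    calc (n : ℝ) + 2 * (n * (L + 4 * (n : ℝ) ^ (1 - a r s)))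
        ≤ C * H + 2 * (C * H * (L + 4 * (C * H * ε))) := by gcongr
      _ = _ := by ring
  obtain ⟨m', rfl⟩ : ∃ k, m = k + 1 := ⟨m - 1, by omega⟩
  refine (weylSum_xi_le ρ σ m₀ m').trans ?_
  have hcardT : ((Finset.Icc (-((m' + 1 : ℕ) : ℤ)) (m' + 1 : ℕ)).erase 0).card = 2 * (m' + 1) := by
    rw [Finset.card_erase_of_mem (by simp; omega), Int.card_Icc]
    omega
  calc _ ≤ ∑ t ∈ (Finset.Icc (-((m' + 1 : ℕ) : ℤ)) (m' + 1 : ℕ)).erase 0, ((m' + 1 : ℕ) : ℝ) * R := by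
        refine Finset.sum_le_sum fun t ht => ?_
        rw [Finset.mem_erase, Finset.mem_Icc] at ht
        refine (Finset.sum_le_card_nsmul _ _ R fun i hi => ?_).trans ?_
        · rw [Finset.mem_filter, Finset.mem_Icc] at hi
          exact hsingle t ht.1 (abs_le.2 ht.2) i hi.1.1 hi.1.2 hi.2
        · rw [nsmul_eq_mul]
          have := Finset.card_filter_le (Finset.Icc 1 (m' + 1)) (fun i => m₀ (ρ i) ≤ m' + 1)
          rw [Nat.card_Icc, Nat.add_sub_cancel] at this
          gcongr
    _ = _ := by
        rw [Finset.sum_const, hcardT, nsmul_eq_mul]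
        push_cast
        ring

theorem norm_sq_le_weylSum {m : ℕ} {t : ℤ} (ht : t ≠ 0) (htm : |t| ≤ m) {i : ℕ} (hi : 1 ≤ i)
    (him : i ≤ m) (hthr : m₀ (ρ i) ≤ m) (x : ℝ) :
    ‖∑ j ∈ Finset.Ioc (angb σ m (ρ i)) (angb σ (m + 1) (ρ i)), expo ((ρ i : ℝ) ^ j * t * x)‖ ^ 2 ≤
      weylSum ρ σ m₀ m x := by
  have h1 : i ∈ (Finset.Icc 1 m).filter (fun i => m₀ (ρ i) ≤ m) :=
    Finset.mem_filter.2 ⟨Finset.mem_Icc.2 ⟨hi, him⟩, hthr⟩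
  have h2 : t ∈ (Finset.Icc (-(m : ℤ)) m).erase 0 :=
    Finset.mem_erase.2 ⟨ht, Finset.mem_Icc.2 (abs_le.1 htm)⟩
  refine le_trans ?_ (Finset.single_le_sum (f := fun t : ℤ => ∑ i ∈ (Finset.Icc 1 m).filter
    (fun i => m₀ (ρ i) ≤ m), ‖∑ j ∈ Finset.Ioc (angb σ m (ρ i)) (angb σ (m + 1) (ρ i)),
          expo ((ρ i : ℝ) ^ j * t * x)‖ ^ 2)
    (fun t _ => Finset.sum_nonneg fun i _ => by positivity) h2)
  exact Finset.single_le_sum (f := fun i => ‖∑ j ∈ Finset.Ioc (angb σ m (ρ i))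
    (angb σ (m + 1) (ρ i)), expo ((ρ i : ℝ) ^ j * t * x)‖ ^ 2) (fun i _ => by positivity) h1

/-! ### From `ξ_m` to the limit. -/

theorem norm_expo_sub_le (x y : ℝ) : ‖expo x - expo y‖ ≤ 2 * Real.pi * |x - y| := by
  have h : expo x - expo y = expo y * (expo (x - y) - 1) := by
    rw [mul_sub, ← expo_add]; ring_nf
  rw [h, norm_mul, norm_expo, one_mul, expo, show 2 * (Real.pi : ℂ) * Complex.I * ((x - y : ℝ) : ℂ) =
    Complex.I * ((2 * Real.pi * (x - y) : ℝ) : ℂ) by push_cast; ring]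
  refine (Real.norm_exp_I_mul_ofReal_sub_one_le).trans (le_of_eq ?_)
  rw [Real.norm_eq_abs, abs_mul, abs_of_pos Real.two_pi_pos]

theorem sum_Ioc_pow_le {r : ℕ} (hr : 2 ≤ r) (J₀ J₁ : ℕ) :
    ∑ j ∈ Finset.Ioc J₀ J₁, (r : ℝ) ^ j ≤ 2 * (r : ℝ) ^ J₁ := by
  have hr2 : (2 : ℝ) ≤ r := by exact_mod_cast hr
  have key : ∀ n : ℕ, ∑ j ∈ Finset.range (n + 1), (r : ℝ) ^ j ≤ 2 * (r : ℝ) ^ n := by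
    intro n
    induction n with
    | zero => simp
    | succ n ih =>
      rw [Finset.sum_range_succ]
      have : 2 * (r : ℝ) ^ n ≤ (r : ℝ) ^ (n + 1) := by
        rw [pow_succ, mul_comm]; gcongr
      linarith
  refine (Finset.sum_le_sum_of_subset_of_nonneg ?_ fun _ _ _ => by positivity).trans (key J₁)
  intro j hj
  simp at hj ⊢
  omega

/-- Passing from `ξ_m` to the limit changes a block sum only by a polynomial amount. -/
theorem norm_sum_expo_sub_le {r : ℕ} (hr : 2 ≤ r) (m : ℕ) {t : ℕ} (htm : t ≤ m) {ξ x : ℝ}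
    (hle : x ≤ ξ) (hξ : ξ ≤ x + 4 * (σ 1 * (m + 1 : ℕ)) * Real.exp (-(ang σ (m + 1) : ℝ))) :
    ‖∑ j ∈ Finset.Ioc (angb σ m r) (angb σ (m + 1) r), expo ((r : ℝ) ^ j * t * ξ) -
        ∑ j ∈ Finset.Ioc (angb σ m r) (angb σ (m + 1) r), expo ((r : ℝ) ^ j * t * x)‖ ≤
      64 * σ 1 * (m + 1 : ℕ) ^ 2 := by
  rw [← Finset.sum_sub_distrib]
  set D : ℝ := 4 * (σ 1 * (m + 1 : ℕ)) with hD
  set e := Real.exp (ang σ (m + 1)) with he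
  have he0 : 0 < e := Real.exp_pos _
  rw [Real.exp_neg, ← he] at hξ
  have habs : |ξ - x| ≤ D * e⁻¹ := by rw [abs_of_nonneg (by linarith)]; linarith
  have ht : (t : ℝ) ≤ (m + 1 : ℕ) := by exact_mod_cast htm.trans (Nat.le_succ m)
  have hpi := Real.pi_lt_four
  have hpi0 := Real.pi_pos
  calc _ ≤ ∑ j ∈ Finset.Ioc (angb σ m r) (angb σ (m + 1) r),
        (8 * (m + 1 : ℕ) * (D * e⁻¹)) * (r : ℝ) ^ j := by
        refine norm_sum_le_of_le _ fun j _ => (norm_expo_sub_le _ _).trans ?_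
        rw [← mul_sub, abs_mul, abs_of_nonneg (by positivity)]
        calc 2 * Real.pi * ((r : ℝ) ^ j * t * |ξ - x|) ≤
            2 * 4 * ((r : ℝ) ^ j * (m + 1 : ℕ) * (D * e⁻¹)) := by gcongr
          _ = _ := by ring
    _ = (8 * (m + 1 : ℕ) * (D * e⁻¹)) *
        ∑ j ∈ Finset.Ioc (angb σ m r) (angb σ (m + 1) r), (r : ℝ) ^ j := by rw [Finset.mul_sum]
    _ ≤ (8 * (m + 1 : ℕ) * (D * e⁻¹)) * (2 * e) := by
        gcongr
        refine (sum_Ioc_pow_le hr _ _).trans ?_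
        have := pow_angb_le (σ := σ) (m + 1) hr
        gcongr
    _ = _ := by rw [hD]; field_simp; ring

theorem tendsto_pow_mul_exp_neg_sqrt (k : ℕ) {c : ℝ} (hc : 0 < c) :
    Tendsto (fun m : ℕ => (m : ℝ) ^ k * Real.exp (-(c * Real.sqrt m))) atTop (𝓝 0) := by
  have h1 : Tendsto (fun m : ℕ => c * Real.sqrt m) atTop atTop :=
    (Real.tendsto_sqrt_atTop.comp tendsto_natCast_atTop_atTop).const_mul_atTop hc
  have h2 := ((Real.tendsto_pow_mul_exp_neg_atTop_nhds_zero (2 * k)).comp h1).const_mul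
    ((c ^ (2 * k))⁻¹)
  rw [mul_zero] at h2
  refine h2.congr fun m => ?_
  simp only [Function.comp]
  rw [mul_pow, pow_mul (Real.sqrt m), Real.sq_sqrt (by positivity)]
  field_simp

theorem tendsto_pow_mul_exp_neg_rpow (k : ℕ) {c : ℝ} (hc : 0 < c) :
    Tendsto (fun m : ℕ => (m : ℝ) ^ k * Real.exp (-(c * (m : ℝ) ^ (1 / 4 : ℝ)))) atTop (𝓝 0) := by
  have h1 : Tendsto (fun m : ℕ => c * (m : ℝ) ^ (1 / 4 : ℝ)) atTop atTop :=
    ((tendsto_rpow_atTop (by norm_num)).comp tendsto_natCast_atTop_atTop).const_mul_atTop hc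
  have h2 := ((Real.tendsto_pow_mul_exp_neg_atTop_nhds_zero (4 * k)).comp h1).const_mul
    ((c ^ (4 * k))⁻¹)
  rw [mul_zero] at h2
  refine h2.congr fun m => ?_
  simp only [Function.comp]
  have h3 : ((m : ℝ) ^ (1 / 4 : ℝ)) ^ 4 = m := by
    rw [← Real.rpow_natCast, ← Real.rpow_mul (by positivity)]; norm_num
  rw [mul_pow, pow_mul ((m : ℝ) ^ (1 / 4 : ℝ)), h3]
  field_simp

/-- Block sums save an arbitrary power of `m`; here `m ^ 2`. -/
theorem eventually_norm_block_sum_le (hσ : ∀ m, 1 ≤ m → 3 ≤ σ m)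
    (hσ' : ∀ m, 1 ≤ m → σ m ≤ σ 1 * m)
    (hρ : ∀ i, 1 ≤ i → 2 ≤ ρ i) (hm₀ : IsThreshold σ m₀)
    (ha : ∀ r s : ℕ, 1 < r → 1 < s → IsCosExponent r s (a r s))
    (hβ0 : 0 < β) (hβ : ∀ i m : ℕ, 1 ≤ i → i ≤ m → β / (m : ℝ) ^ (1 / 4 : ℝ) ≤ a (ρ i) (σ m))
    {ξ : ℝ} (hξ : ∀ m, xi ρ σ m₀ m ≤ ξ ∧
      ξ ≤ xi ρ σ m₀ m + 4 * (σ 1 * (m + 1 : ℕ)) * Real.exp (-(ang σ (m + 1) : ℝ)))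
    {i : ℕ} (hi : 1 ≤ i) :
    ∀ᶠ m : ℕ in atTop, ∀ t : ℕ, 1 ≤ t → t ≤ m →
      ‖∑ j ∈ Finset.Ioc (angb σ m (ρ i)) (angb σ (m + 1) (ρ i)), expo ((ρ i : ℝ) ^ j * t * ξ)‖ ≤
        2 * (Real.exp (Real.sqrt m) / m ^ 2) := by
  set C : ℝ := 3400 * σ 1 + 5 with hC
  have hC0 : 0 < C := by positivity
  -- `e1` and `e2` are the two halves of `weylSum · m⁴ ≤ H²`: the terms linear in `H` (diagonal and
  -- exceptional indices), and the term `H² ε` from the exponents. `e3` absorbs the passage from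
  -- `ξ_m` to `ξ`.
  have e1 : ∀ᶠ m : ℕ in atTop, 2 * C * (1 + 8 * (σ 1 : ℝ) ^ 2) *
      ((m : ℝ) ^ 9 * Real.exp (-(1 * Real.sqrt m))) ≤ 1 / 2 := by
    have h := (tendsto_pow_mul_exp_neg_sqrt 9 one_pos).const_mul (2 * C * (1 + 8 * (σ 1 : ℝ) ^ 2))
    rw [mul_zero] at h
    exact h.eventually_le_const (by norm_num)
  have e2 : ∀ᶠ m : ℕ in atTop, 16 * C ^ 2 *
      ((m : ℝ) ^ 6 * Real.exp (-(β * (m : ℝ) ^ (1 / 4 : ℝ)))) ≤ 1 / 2 := by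
    have h := (tendsto_pow_mul_exp_neg_rpow 6 hβ0).const_mul (16 * C ^ 2)
    rw [mul_zero] at h
    exact h.eventually_le_const (by norm_num)
  have e3 : ∀ᶠ m : ℕ in atTop, 256 * (σ 1 : ℝ) *
      ((m : ℝ) ^ 4 * Real.exp (-(1 * Real.sqrt m))) ≤ 1 := by
    have h := (tendsto_pow_mul_exp_neg_sqrt 4 one_pos).const_mul (256 * (σ 1 : ℝ))
    rw [mul_zero] at h
    exact h.eventually_le_const (by norm_num)
  filter_upwards [e1, e2, e3, eventually_ge_atTop 1, eventually_ge_atTop i,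
    eventually_ge_atTop (m₀ (ρ i))] with m h1 h2 h3 hm him hthr t ht htm
  have hm1 : (1 : ℝ) ≤ m := by exact_mod_cast hm
  set H := Real.exp (Real.sqrt m) with hH
  have hH0 : 0 < H := Real.exp_pos _
  rw [one_mul, Real.exp_neg, ← hH] at h1 h3
  set ε := Real.exp (-(β * (m : ℝ) ^ (1 / 4 : ℝ)))
  have hW := weylSum_xi_le_explicit hσ hσ' hρ hm₀ ha hβ0 hβ m hm
  have hsq := norm_sq_le_weylSum (ρ := ρ) (σ := σ) (m₀ := m₀) (m := m) (t := (t : ℤ)) (by omega)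
    (by rw [Nat.abs_cast]; exact_mod_cast htm) hi him hthr (xi ρ σ m₀ m)
  have hdiff := norm_sum_expo_sub_le (σ := σ) (hρ i hi) m htm (hξ m).1 (hξ m).2
  rw [Int.cast_natCast] at hsq
  set S := ∑ j ∈ Finset.Ioc (angb σ m (ρ i)) (angb σ (m + 1) (ρ i)), expo ((ρ i : ℝ) ^ j * t * ξ)
  set S' := ∑ j ∈ Finset.Ioc (angb σ m (ρ i)) (angb σ (m + 1) (ρ i)),
    expo ((ρ i : ℝ) ^ j * t * xi ρ σ m₀ m)
  have hS' : ‖S'‖ ≤ H / m ^ 2 := by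
    refine abs_le_of_sq_le_sq' ?_ (by positivity) |>.2
    refine hsq.trans (hW.trans ?_)
    rw [div_pow, le_div_iff₀ (by positivity)]
    have g1 : 2 * C * (1 + 8 * (σ 1 : ℝ) ^ 2) * (m : ℝ) ^ 9 ≤ 1 / 2 * H := by
      have := mul_le_mul_of_nonneg_right h1 hH0.le
      calc _ = 2 * C * (1 + 8 * (σ 1 : ℝ) ^ 2) * ((m : ℝ) ^ 9 * H⁻¹) * H := by field_simp
        _ ≤ _ := this
    have g2 : (m : ℝ) ^ 6 ≤ (m : ℝ) ^ 9 := pow_le_pow_right₀ hm1 (by norm_num)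
    calc 2 * (m : ℝ) ^ 2 * (C * H * (1 + 2 * (4 * (σ 1 : ℝ) ^ 2 * m ^ 3 + 4 * (C * H * ε)))) *
          ((m : ℝ) ^ 2) ^ 2
        = H * (2 * C * ((m : ℝ) ^ 6 + 8 * (σ 1 : ℝ) ^ 2 * m ^ 9)) +
            H ^ 2 * (16 * C ^ 2 * ((m : ℝ) ^ 6 * ε)) := by ring
      _ ≤ H * (2 * C * ((m : ℝ) ^ 9 + 8 * (σ 1 : ℝ) ^ 2 * m ^ 9)) + H ^ 2 * (1 / 2) := by gcongr
      _ = H * (2 * C * (1 + 8 * (σ 1 : ℝ) ^ 2) * (m : ℝ) ^ 9) + H ^ 2 * (1 / 2) := by ring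
      _ ≤ H * (1 / 2 * H) + H ^ 2 * (1 / 2) := by gcongr
      _ = H ^ 2 := by ring
  have hS : ‖S‖ ≤ ‖S'‖ + ‖S - S'‖ := by
    have := norm_add_le S' (S - S')
    rwa [add_sub_cancel] at this
  have hpoly : 64 * (σ 1 : ℝ) * (m + 1 : ℕ) ^ 2 ≤ H / m ^ 2 := by
    rw [le_div_iff₀ (by positivity)]
    have g3 : ((m + 1 : ℕ) : ℝ) ≤ 2 * m := by push_cast; linarith
    calc 64 * (σ 1 : ℝ) * (m + 1 : ℕ) ^ 2 * (m : ℝ) ^ 2 ≤ 64 * σ 1 * (2 * m) ^ 2 * (m : ℝ) ^ 2 := by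
          gcongr
      _ = 256 * (σ 1 : ℝ) * ((m : ℝ) ^ 4 * H⁻¹) * H := by field_simp; ring
      _ ≤ 1 * H := by gcongr
      _ = H := one_mul H
  linarith

end

/-! ### The discrepancy of the limit -/

section

variable {σ : ℕ → ℕ}

theorem norm_sum_le_of_blocks {r : ℕ} {ξ : ℝ} {t T : ℕ}
    (hblock : ∀ m, T ≤ m →
      ‖∑ j ∈ Finset.Ioc (angb σ m r) (angb σ (m + 1) r), expo ((r : ℝ) ^ j * t * ξ)‖ ≤
        2 * (Real.exp (Real.sqrt m) / m ^ 2)) {M : ℕ} (hM : T ≤ M) :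
    ‖∑ n ∈ Finset.Icc 1 (angb σ M r), expo (t * ((r : ℝ) ^ n * ξ))‖ ≤
      angb σ T r + ∑ m ∈ Finset.Ico T M, 2 * (Real.exp (Real.sqrt m) / m ^ 2) := by
  induction M, hM using Nat.le_induction with
  | base =>
    rw [Finset.Ico_self, Finset.sum_empty, add_zero]
    refine (norm_sum_le _ _).trans ?_
    simp [norm_expo]
  | succ M hM ih =>
    have hsplit : Finset.Icc 1 (angb σ (M + 1) r) =
        Finset.Icc 1 (angb σ M r) ∪ Finset.Ioc (angb σ M r) (angb σ (M + 1) r) := by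
      have : angb σ M r ≤ angb σ (M + 1) r := angb_mono (σ := σ) r (Nat.le_succ M)
      ext n
      simp
      omega
    have hdisj : Disjoint (Finset.Icc 1 (angb σ M r))
        (Finset.Ioc (angb σ M r) (angb σ (M + 1) r)) := by
      rw [Finset.disjoint_left]
      intro n h1 h2
      simp at h1 h2
      omega
    rw [hsplit, Finset.sum_union hdisj, Finset.sum_Ico_succ_top hM, ← add_assoc]
    refine (norm_add_le _ _).trans (add_le_add ih ?_)
    refine le_trans (le_of_eq ?_) (hblock M hM)
    congr 1
    refine Finset.sum_congr rfl fun j _ => ?_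
    congr 1
    ring

/-- Every `m ≥ T ≥ M/3` has `1/m² ≤ 9/M²`, and there are at most `M` terms. -/
theorem sum_block_bounds_le {T M : ℕ} (hT : 1 ≤ T) (hTM : M ≤ 3 * T) (hM : 1 ≤ M) :
    ∑ m ∈ Finset.Ico T M, 2 * (Real.exp (Real.sqrt m) / (m : ℝ) ^ 2) ≤
      18 * (Real.exp (Real.sqrt M) / M) := by
  have hM0 : (0 : ℝ) < M := by exact_mod_cast hM
  have hT0 : (0 : ℝ) < T := by exact_mod_cast hT
  have hTM' : (M : ℝ) ≤ 3 * T := by exact_mod_cast hTM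
  calc _ ≤ ∑ m ∈ Finset.Ico T M, 18 * (Real.exp (Real.sqrt M) / (M : ℝ) ^ 2) := by
        refine Finset.sum_le_sum fun m hm => ?_
        rw [Finset.mem_Ico] at hm
        have h1 : (T : ℝ) ≤ m := by exact_mod_cast hm.1
        have h2 : (m : ℝ) ≤ M := by exact_mod_cast hm.2.le
        have h3 : Real.exp (Real.sqrt m) ≤ Real.exp (Real.sqrt M) := by gcongr
        have h4 : (M : ℝ) ^ 2 ≤ 9 * (m : ℝ) ^ 2 := by nlinarith
        have h5 : (0 : ℝ) < m := by linarith
        rw [← mul_div_assoc, ← mul_div_assoc, div_le_div_iff₀ (by positivity) (by positivity)]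
        calc 2 * Real.exp (Real.sqrt m) * (M : ℝ) ^ 2 ≤
              2 * Real.exp (Real.sqrt M) * (9 * (m : ℝ) ^ 2) := by gcongr
          _ = _ := by ring
    _ = (M - T : ℕ) * (18 * (Real.exp (Real.sqrt M) / (M : ℝ) ^ 2)) := by
        rw [Finset.sum_const, Nat.card_Ico, nsmul_eq_mul]
    _ ≤ M * (18 * (Real.exp (Real.sqrt M) / (M : ℝ) ^ 2)) := by
        gcongr
        exact Nat.sub_le _ _
    _ = _ := by field_simp

/-- The blocks up to `M / 2` are negligible. -/
theorem eventually_angb_half_le (σ : ℕ → ℕ) {r : ℕ} (hr : 2 ≤ r) :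
    ∀ᶠ M : ℕ in atTop, (angb σ (M / 2) r : ℝ) ≤ Real.exp (Real.sqrt M) / M := by
  have e1 := ((tendsto_pow_mul_exp_neg_sqrt 1 (show (0 : ℝ) < 1 / 4 by norm_num)).const_mul
    (2 : ℝ)).eventually_le_const (show 2 * (0 : ℝ) < 1 / 2 by norm_num)
  have e2 := ((tendsto_pow_mul_exp_neg_sqrt 4 one_pos).const_mul
    (4 * (σ 1 : ℝ))).eventually_le_const (show 4 * (σ 1 : ℝ) * 0 < 1 / 2 by norm_num)
  filter_upwards [e1, e2, eventually_ge_atTop 1] with M h1 h2 hM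
  have hM0 : (0 : ℝ) < M := by exact_mod_cast hM
  rw [one_mul] at h2
  have hhalf : ((M / 2 : ℕ) : ℝ) ≤ M / 2 := Nat.cast_div_le
  have hle := angb_le (σ := σ) (M / 2) hr
  -- `1/2 ≤ 9/16`; the remaining quarter of `√M` beats the factor `M`.
  have hsqrt : Real.sqrt ((M / 2 : ℕ) : ℝ) ≤ 3 / 4 * Real.sqrt M := by
    rw [Real.sqrt_le_left (by positivity), mul_pow, Real.sq_sqrt hM0.le]
    linarith
  have hexp : Real.exp (Real.sqrt ((M / 2 : ℕ) : ℝ)) ≤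
      Real.exp (Real.sqrt M) * Real.exp (-(1 / 4 * Real.sqrt M)) := by
    rw [← Real.exp_add]
    exact Real.exp_le_exp.2 (by linarith)
  have hcube : ((M / 2 : ℕ) : ℝ) ^ 3 ≤ (M : ℝ) ^ 3 := by gcongr; exact Nat.div_le_self M 2
  refine hle.trans ?_
  rw [le_div_iff₀ hM0]
  have hE := Real.exp_pos (Real.sqrt M)
  have hE' : Real.exp (-Real.sqrt M) * Real.exp (Real.sqrt M) = 1 := by
    rw [← Real.exp_add]; simp
  calc 2 * (Real.exp (Real.sqrt ((M / 2 : ℕ) : ℝ)) + 2 * (σ 1 : ℝ) * ((M / 2 : ℕ) : ℝ) ^ 3) * M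
      ≤ 2 * (Real.exp (Real.sqrt M) * Real.exp (-(1 / 4 * Real.sqrt M)) +
          2 * (σ 1 : ℝ) * (M : ℝ) ^ 3) * M := by gcongr
    _ = (2 * ((M : ℝ) ^ 1 * Real.exp (-(1 / 4 * Real.sqrt M)))) * Real.exp (Real.sqrt M) +
        4 * (σ 1 : ℝ) * (M : ℝ) ^ 4 * 1 := by ring
    _ = (2 * ((M : ℝ) ^ 1 * Real.exp (-(1 / 4 * Real.sqrt M)))) * Real.exp (Real.sqrt M) +
        (4 * (σ 1 : ℝ) * ((M : ℝ) ^ 4 * Real.exp (-Real.sqrt M))) * Real.exp (Real.sqrt M) := by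
      rw [← hE']; ring
    _ ≤ 1 / 2 * Real.exp (Real.sqrt M) + 1 / 2 * Real.exp (Real.sqrt M) := by gcongr
    _ = _ := by ring

theorem exists_block_index (h1 : 1 ≤ σ 1) {r : ℕ} (hr : 2 ≤ r) {M₀ N : ℕ}
    (hN : angb σ M₀ r ≤ N) : ∃ M, M₀ ≤ M ∧ angb σ M r ≤ N ∧ N < angb σ (M + 1) r := by
  classical
  have hex : ∃ M, N < angb σ M r := by
    have hlim : Tendsto (fun M : ℕ => Real.exp (Real.sqrt M) / Real.log r) atTop atTop :=
      (Real.tendsto_exp_atTop.comp (Real.tendsto_sqrt_atTop.comp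
        tendsto_natCast_atTop_atTop)).atTop_div_const (by linarith [half_le_log hr])
    obtain ⟨M, hM, hM1⟩ := ((hlim.eventually_gt_atTop ((N : ℝ) + 1)).and
      (eventually_ge_atTop 1)).exists
    have := le_angb_add_one (σ := σ) h1 hM1 hr
    refine ⟨M, ?_⟩
    have h2 : (N : ℝ) < angb σ M r := by linarith
    exact_mod_cast h2
  have hspec := Nat.find_spec hex
  set M' := Nat.find hex
  have hlt : M₀ < M' := by
    by_contra hcon
    have := angb_mono (σ := σ) r (not_lt.1 hcon)
    simp only at this
    omega
  refine ⟨M' - 1, by omega, ?_, by rwa [Nat.sub_add_cancel (by omega)]⟩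
  exact not_lt.1 (Nat.find_min hex (m := M' - 1) (by omega))

theorem eventually_log_le (σ : ℕ → ℕ) {r : ℕ} (hr : 2 ≤ r) :
    ∀ᶠ M : ℕ in atTop, ∀ N : ℕ, 1 ≤ N → N < angb σ (M + 1) r → Real.log N ≤ 3 * Real.sqrt M := by
  have e1 := ((tendsto_pow_mul_exp_neg_sqrt 3 one_pos).const_mul
    (16 * (σ 1 : ℝ))).eventually_le_const (show 16 * (σ 1 : ℝ) * 0 < 1 by norm_num)
  have e2 : Tendsto (fun M : ℕ => Real.sqrt M) atTop atTop :=
    Real.tendsto_sqrt_atTop.comp tendsto_natCast_atTop_atTop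
  filter_upwards [e1, e2.eventually_ge_atTop 3, eventually_ge_atTop 1] with M h1 h2 hM N hN hNM
  rw [one_mul] at h1
  have hM1 : (1 : ℝ) ≤ M := by exact_mod_cast hM
  set y := Real.sqrt M with hy
  have hle := angb_le (σ := σ) (M + 1) hr
  have hsq : Real.sqrt ((M + 1 : ℕ) : ℝ) ≤ y + 1 := by
    rw [Real.sqrt_le_left (by positivity)]
    have : y ^ 2 = M := Real.sq_sqrt (by positivity)
    push_cast
    nlinarith
  have hcube : ((M + 1 : ℕ) : ℝ) ^ 3 ≤ 8 * (M : ℝ) ^ 3 := by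
    have : ((M + 1 : ℕ) : ℝ) ≤ 2 * M := by push_cast; linarith
    calc ((M + 1 : ℕ) : ℝ) ^ 3 ≤ (2 * M) ^ 3 := by gcongr
      _ = _ := by ring
  have hpoly : 16 * (σ 1 : ℝ) * (M : ℝ) ^ 3 ≤ Real.exp y := by
    have hE : Real.exp (-y) * Real.exp y = 1 := by rw [← Real.exp_add]; simp
    calc 16 * (σ 1 : ℝ) * (M : ℝ) ^ 3 = 16 * (σ 1 : ℝ) * (M : ℝ) ^ 3 * 1 := by ring
      _ = 16 * (σ 1 : ℝ) * ((M : ℝ) ^ 3 * Real.exp (-y)) * Real.exp y := by rw [← hE]; ring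
      _ ≤ 1 * Real.exp y := by gcongr
      _ = _ := one_mul _
  have hexp1 : Real.exp y ≤ Real.exp (y + 1) := Real.exp_le_exp.2 (by linarith)
  have hexp2 : Real.exp (y + 1) * 4 ≤ Real.exp (3 * y) := by
    have h4 : (4 : ℝ) ≤ Real.exp (2 * y - 1) := by
      have := Real.add_one_le_exp (2 * y - 1)
      linarith
    calc Real.exp (y + 1) * 4 ≤ Real.exp (y + 1) * Real.exp (2 * y - 1) := by gcongr
      _ = _ := by rw [← Real.exp_add]; ring_nf
  have hNle : (N : ℝ) ≤ Real.exp (3 * y) := by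
    have h5 : (N : ℝ) ≤ angb σ (M + 1) r := by exact_mod_cast hNM.le
    have h6 : Real.exp (Real.sqrt ((M + 1 : ℕ) : ℝ)) ≤ Real.exp (y + 1) := Real.exp_le_exp.2 hsq
    have h7 : 2 * (σ 1 : ℝ) * ((M + 1 : ℕ) : ℝ) ^ 3 ≤ 2 * (σ 1 : ℝ) * (8 * (M : ℝ) ^ 3) := by gcongr
    linarith
  have hN0 : (0 : ℝ) < N := by exact_mod_cast hN
  rwa [Real.log_le_iff_le_exp hN0]

/-- In `discrepancy_le` take `N'` at the last block boundary, `T = M / 2` and `δ = 1/√M`. Since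
`E/N` and `1/T` are `O(1/M)`, this `δ` balances `δ` against `(E/N + 1/T)/δ`, and the incomplete
block also contributes `O(1/√M)`. -/
theorem exists_discrepancy_le (h1 : 1 ≤ σ 1) {r : ℕ} (hr : 2 ≤ r) {ξ : ℝ}
    (hblock : ∀ᶠ m : ℕ in atTop, ∀ t : ℕ, 1 ≤ t → t ≤ m →
      ‖∑ j ∈ Finset.Ioc (angb σ m r) (angb σ (m + 1) r), expo ((r : ℝ) ^ j * t * ξ)‖ ≤
        2 * (Real.exp (Real.sqrt m) / m ^ 2)) :
    ∃ C : ℝ, 0 < C ∧ ∃ N₀ : ℕ, ∀ N : ℕ, N₀ ≤ N →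
      discrepancy (fun n => (r : ℝ) ^ n * ξ) N ≤ C * (1 / Real.log N) := by
  obtain ⟨m₁, hm₁⟩ := eventually_atTop.1 hblock
  obtain ⟨m₂, hm₂⟩ := eventually_atTop.1 (eventually_angb_half_le σ hr)
  obtain ⟨m₃, hm₃⟩ := eventually_atTop.1 (eventually_log_le σ hr)
  -- The term `2 * m₁` ensures `M / 2 ≥ m₁`, so the block bound applies from block `M / 2` on; the
  -- `+ 2` keeps `M / 2` positive.
  set M₀ := 2 * m₁ + m₂ + m₃ + 2 with hM₀
  have hlr := half_le_log hr
  set K : ℝ := Real.log r with hK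
  set B : ℝ := 3400 * σ 1 + 5 with hB
  have hB0 : 0 < B := by positivity
  set D : ℝ := 3 + 4 * (38 * K + 3) + 2 * K * B with hD
  have hD0 : 0 < D := by positivity
  refine ⟨3 * D, by positivity, max (angb σ M₀ r) 2, fun N hN => ?_⟩
  have hN2 : 2 ≤ N := (le_max_right _ _).trans hN
  obtain ⟨M, hMM₀, hMN, hNM⟩ := exists_block_index h1 hr ((le_max_left _ _).trans hN)
  have hM1 : (1 : ℝ) ≤ M := by exact_mod_cast (by omega : 1 ≤ M)
  have hM0 : (0 : ℝ) < M := by linarith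
  have hN1 : (1 : ℝ) ≤ N := by exact_mod_cast (by omega : 1 ≤ N)
  have hN0 : (0 : ℝ) < N := by linarith
  set y := Real.sqrt M with hy
  have hy1 : 1 ≤ y := by rw [hy, Real.one_le_sqrt]; exact hM1
  have hy0 : 0 < y := by linarith
  have hy2 : y * y = M := Real.mul_self_sqrt hM0.le
  set H := Real.exp y with hH
  have hH0 : 0 < H := Real.exp_pos y
  have hHN : H ≤ 2 * K * N := by
    have h := le_angb_add_one (σ := σ) h1 (m := M) (by omega) hr
    rw [div_le_iff₀ (by linarith)] at h
    have h' : (angb σ M r : ℝ) + 1 ≤ 2 * N := by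
      have : (angb σ M r : ℝ) ≤ N := by exact_mod_cast hMN
      linarith
    calc H ≤ (angb σ M r + 1) * K := h
      _ ≤ 2 * N * K := by gcongr
      _ = _ := by ring
  have hE : ∀ t : ℕ, 1 ≤ t → t ≤ M / 2 →
      ‖∑ n ∈ Finset.Icc 1 (angb σ M r), expo (t * ((r : ℝ) ^ n * ξ))‖ ≤ 19 * (H / M) := by
    intro t ht htT
    have hbl := norm_sum_le_of_blocks (σ := σ) (r := r) (ξ := ξ) (t := t) (T := M / 2)
      (fun m hm => hm₁ m (by omega) t ht (htT.trans hm)) (M := M) (by omega)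
    have hs := sum_block_bounds_le (T := M / 2) (M := M) (by omega) (by omega) (by omega)
    have hh := hm₂ M (by omega)
    linarith
  have hdisc := discrepancy_le (fun n => (r : ℝ) ^ n * ξ) (N' := angb σ M r) (N := N)
    (T := M / 2) (by omega) hMN (by omega) (E := 19 * (H / M)) (by positivity) hE
    (δ := 1 / y) (by positivity) (by rw [div_le_one hy0]; exact hy1)
  have hT : (1 : ℝ) / (M / 2 : ℕ) ≤ 3 / M := by
    have h2 : M ≤ 3 * (M / 2) := by omega
    have h3 : (M : ℝ) ≤ 3 * (M / 2 : ℕ) := by exact_mod_cast h2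
    have h4 : (0 : ℝ) < (M / 2 : ℕ) := by linarith
    rw [div_le_div_iff₀ h4 hM0]
    linarith
  have hEN : 19 * (H / M) / N ≤ 38 * K / M := by
    rw [div_le_div_iff₀ hN0 hM0]
    calc 19 * (H / M) * M = 19 * H := by field_simp
      _ ≤ 19 * (2 * K * N) := by gcongr
      _ = _ := by ring
  have hlast : ((N : ℝ) - angb σ M r) / N ≤ 2 * K * B * (1 / y) := by
    have h2 := angb_succ_sub_le (σ := σ) M (by omega) hr
    have h3 : (N : ℝ) ≤ angb σ (M + 1) r := by exact_mod_cast hNM.le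
    rw [div_le_iff₀ hN0]
    calc (N : ℝ) - angb σ M r ≤ B * (H / y) := by linarith
      _ ≤ B * (2 * K * N / y) := by gcongr
      _ = _ := by ring
  have hDy : discrepancy (fun n => (r : ℝ) ^ n * ξ) N ≤ D * (1 / y) := by
    refine hdisc.trans ?_
    have h5 : 4 * (19 * (H / M) / N + 1 / (M / 2 : ℕ)) / (1 / y) ≤
        4 * (38 * K / M + 3 / M) / (1 / y) := by gcongr
    have h6 : 4 * (38 * K / M + 3 / M) / (1 / y) = 4 * (38 * K + 3) * (1 / y) := by
      rw [← hy2]; field_simp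
    rw [h6] at h5
    rw [hD]
    linarith
  have hlog := hm₃ M (by omega) N (by omega) hNM
  have hlog0 : 0 < Real.log N := Real.log_pos (by exact_mod_cast (by omega : 1 < N))
  refine hDy.trans ?_
  have h7 : 1 / y ≤ 3 * (1 / Real.log N) := by
    rw [mul_one_div, div_le_div_iff₀ hy0 hlog0]
    linarith
  calc D * (1 / y) ≤ D * (3 * (1 / Real.log N)) := by gcongr
    _ = _ := by ring

end

end Schmidt

theorem mainTheorem1 :
    (∃ a : ℕ → ℕ → ℝ, ∀ r s : ℕ, 1 < r → 1 < s → Schmidt.IsCosExponent r s (a r s)) ∧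
    ∀ a : ℕ → ℕ → ℝ, (∀ r s : ℕ, 1 < r → 1 < s → Schmidt.IsCosExponent r s (a r s)) →
    ∀ s : ℕ → ℕ, Schmidt.IsBaseSequence s →
    ∀ m₀ : ℕ → ℕ, Schmidt.IsThreshold (Schmidt.repS a s) m₀ →
    ∃ ξ : ℝ,
      Tendsto (Schmidt.xi (Schmidt.repR a s) (Schmidt.repS a s) m₀) atTop (𝓝 ξ) ∧
      IsAbsolutelyNormal ξ ∧
      ∀ r : ℕ, 2 ≤ r → ∃ C : ℝ, 0 < C ∧ ∃ N₀ : ℕ, ∀ N : ℕ, N₀ ≤ N →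
        discrepancy (fun n => (r : ℝ) ^ n * ξ) N ≤
          C * (Real.log (Real.log N) / Real.log N) := by
  refine ⟨Schmidt.exists_cosExponents, fun a ha s hs m₀ hm₀ => ?_⟩
  have hσ : ∀ m, 1 ≤ m → 3 ≤ Schmidt.repS a s m := fun m hm => Schmidt.three_le_repS ha hs hm
  have hσ' : ∀ m, 1 ≤ m → Schmidt.repS a s m ≤ Schmidt.repS a s 1 * m :=
    fun m hm => Schmidt.repS_le ha hs hm
  obtain ⟨ξ, hlim, hξ⟩ := Schmidt.exists_tendsto_xi (ρ := Schmidt.repR a s) (m₀ := m₀) hσ hσ'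
  -- The bound without `log log N`; it serves both conclusions, since `log log N ≥ 1` eventually.
  have hdisc : ∀ r : ℕ, 2 ≤ r → ∃ C : ℝ, 0 < C ∧ ∃ N₀ : ℕ, ∀ N : ℕ, N₀ ≤ N →
      discrepancy (fun n => (r : ℝ) ^ n * ξ) N ≤ C * (1 / Real.log N) := by
    intro r hr
    obtain ⟨i, hi, rfl⟩ := Schmidt.exists_repR_eq ha hs hr
    exact Schmidt.exists_discrepancy_le (by have := hσ 1 le_rfl; omega) hr
      (Schmidt.eventually_norm_block_sum_le hσ hσ' (fun i hi => Schmidt.two_le_repR ha hs hi) hm₀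
        ha (Schmidt.beta_pos ha hs le_rfl)
        (fun i m hi him => Schmidt.le_exponent_rep ha hs hi him) hξ hi)
  refine ⟨ξ, hlim, fun b hb => ?_, fun r hr => ?_⟩
  · obtain ⟨C, hC, N₀, h⟩ := hdisc b hb
    refine Schmidt.isNormalTo_of_tendsto_discrepancy b hb ξ ?_
    have hup : Tendsto (fun N : ℕ => C * (1 / Real.log N)) atTop (𝓝 0) := by
      have h1 : Tendsto (fun N : ℕ => 1 / Real.log N) atTop (𝓝 0) :=
        (Real.tendsto_log_atTop.comp tendsto_natCast_atTop_atTop).const_div_atTop 1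
      simpa using h1.const_mul C
    refine squeeze_zero' (Eventually.of_forall fun N => ?_)
      ((eventually_ge_atTop N₀).mono fun N hN => h N hN) hup
    -- The empty interval shows that the discrepancy is nonnegative.
    exact (abs_nonneg _).trans
      (Schmidt.abs_ncard_div_sub_le_discrepancy _ N (Set.empty_subset _) Set.ordConnected_empty)
  · obtain ⟨C, hC, N₀, h⟩ := hdisc r hr
    have hll : Tendsto (fun N : ℕ => Real.log (Real.log N)) atTop atTop :=
      Real.tendsto_log_atTop.comp (Real.tendsto_log_atTop.comp tendsto_natCast_atTop_atTop)
    obtain ⟨N₁, hN₁⟩ := eventually_atTop.1 (hll.eventually_ge_atTop 1)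
    refine ⟨C, hC, max N₀ N₁, fun N hN => (h N ((le_max_left _ _).trans hN)).trans ?_⟩
    have h1 := hN₁ N ((le_max_right _ _).trans hN)
    have h2 : 0 ≤ Real.log N := Real.log_natCast_nonneg N
    gcongr
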